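/- Let $\mathcal I\subset\mathbb Z\setminus\{0\}$ be finite. For $i\in\mathcal I$ let $\lambda_i:[0,\infty)\to[0,\infty)$ be locally integrable and let $f_i$ be a Bernstein function of the form $f_i(x)=\int_{(0,\infty)}(1-e^{-xw})\,\nu_i(dw)$, $x\ge 0$, where $\int_{(0,\infty)}\min(w,1)\,\nu_i(dw)<\infty$; we use the same formula for $f_i(z)$ with $z\in\mathbb C$ whenever the integral converges. Let $B$ be the shift $(Bx)_n=x_{n-1}$ on sequences indexed by $\mathbb Z$, and for bounded $x$ put $$f_i\big(\lambda(I-B^i)\big)x_n=\int_{(0,\infty)}\Big(x_n-\big(e^{-w\lambda(I-B^i)}x\big)_n\Big)\nu_i(dw),\qquad \lambda\ge0,$$ with $e^{A}=\sum_{m\ge 0}A^m/m!$ applied coordinatewise. Consider the problem $$\frac{d}{dt}p_n(t)=-\sum_{i\in\mathcal I}f_i\big(\lambda_i(t)(I-B^i)\big)p_n(t),\quad t\ge0,\ n\in\mathbb Z,\qquad p_n(0)=\delta_{n0}. \tag{1}$$ A solution is a family $(p_n)_{n\in\mathbb Z}$ of functions on $[0,\infty)$ that is bounded uniformly in $n$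 and in $t\in[0,T]$ for every $T$, such that every $p_n$ is locally absolutely continuous, $p_n(0)=\delta_{n0}$, and the equation holds for almost every $t\ge0$. For a process $S=(S(t))_{t\ge0}$ with values in $\mathbb Z$ we say that (2) holds at time $t$ if, for all $k$ with $P\{S(t)=k\}>0$ and all $n\in\mathbb Z$, as $h\downarrow0$, $$P\{S(t+h)=k+n\mid S(t)=k\}=\begin{cases}\displaystyle h\sum_{\substack{m\ge1,\,i\in\mathcal I\\ mi=n}}\frac{\lambda_i(t)^m}{m!}\int_{(0,\infty)}e^{-\lambda_i(t)w}w^m\,\nu_i(dw)+o(h), & n\in\bigcup_{m\ge1}m\mathcal I,\\[2ex] 1-h\sum_{i\in\mathcal I}f_i(\lambda_i(t))+o(h), & n=0,\\ o(h), & \text{otherwise},\end{cases}\tag{2}$$ where $m\mathcal I=\{mi: i\in\mathcal I\}$. Write $\mathcal P$ for the class of $\mathbb Z$-valued processes $S_f$ with independent increments and $S_f(0)=0$ a.s., such that $t\mapsto P\{S_f(t)=n\}$ is locally absolutely continuous on $[0,\infty)$ for every $n$ and (2) holds at almost every $t\ge 0$. Then: 1. A process in $\mathcal P$ exists. 2.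 Problem (1) has at most one solution. For a $\mathbb Z$-valued process $S$ with independent increments and $S(0)=0$ a.s., the law $p_n(t)=P\{S(t)=n\}$ solves (1) if and only if $S\in\mathcal P$. Thus the unique solution of (1) is the law of $S_f$. If all $\lambda_i$ are continuous on $[0,\infty)$, this is also equivalent to: (2) holds at every $t\ge0$ and every function $t\mapsto P\{S(t)=n\}$ is continuous on $[0,\infty)$. 3. Let $S_f\in\mathcal P$. Then $S_f(t)$ lies almost surely in $\{\sum_{i\in\mathcal I}i\,n_i: n_i\in\mathbb N_0\}$ for every $t\ge 0$. The differential equation in (1) holds for $p_n(t)=P\{S_f(t)=n\}$ at every $t\ge0$ at which all $\lambda_i$ are continuous (one-sidedly at $t=0$), and (2) holds at every $t\ge0$ at which all $\lambda_i$ are right-continuous. 4. Let $S_f\in\mathcal P$ and $t\ge0$. If $\mathcal I\subset\{1,2,\dots\}$, then for all real $u$ with $|u|\le1$ the variable $u^{S_f(t)}$ is integrable and $$\mathbb E\,u^{S_f(t)}=\exp\Big(-\sum_{i\in\mathcal I}\int_0^t f_i\big(\lambda_i(s)(1-u^i)\big)\,ds\Big).\tag{3}$$ In general, let $u\in\mathbb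 C$, with $u\neq0$ unless $\mathcal I\subset\{1,2,\dots\}$. Then $u^{S_f(t)}$ is integrable if and only if $\int_0^t\int_{(0,\infty)}\big|1-e^{-\lambda_i(s)(1-|u|^i)w}\big|\,\nu_i(dw)\,ds<\infty$ for all $i\in\mathcal I$, and in that case (3) holds. -/

import Mathlib

open MeasureTheory ProbabilityTheory Set Filter Topology Asymptotics
open scoped NNReal ENNReal

universe v

noncomputable section

/-- `f : [0,∞) → [0,∞)` is a Bernstein function with Lévy triplet `(a, b, ν)`: it is smooth on
`(0,∞)`, satisfies `(-1)^n f^(n) ≤ 0` for all `n ≥ 1`, and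
`f x = a + b x + ∫_(0,∞) (1 - e^{-xw}) ν(dw)` for `x ≥ 0`, where `a, b ≥ 0` and
`∫_(0,∞) min(w,1) ν(dw) < ∞`.  Only the restriction of `ν` to `(0,∞)` matters. -/
structure IsBernstein (f : ℝ → ℝ) (a b : ℝ) (ν : Measure ℝ) : Prop where
  nonneg : ∀ x, 0 ≤ x → 0 ≤ f x
  smooth : ContDiffOn ℝ ((⊤ : ℕ∞) : WithTop ℕ∞) f (Ioi 0)
  sign : ∀ n : ℕ, 1 ≤ n → ∀ x : ℝ, 0 < x → (-1 : ℝ) ^ n * iteratedDeriv n f x ≤ 0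
  a_nonneg : 0 ≤ a
  b_nonneg : 0 ≤ b
  levy : ∫⁻ w in Ioi (0 : ℝ), ENNReal.ofReal (min w 1) ∂ν < ∞
  repr : ∀ x, 0 ≤ x → f x = a + b * x + ∫ w in Ioi (0 : ℝ), (1 - Real.exp (-(x * w))) ∂ν

/-- The extension `z ↦ ∫_(0,∞) (1 - e^{-zw}) ν(dw)` of a Bernstein function with triplet
`(0, 0, ν)` to all complex `z` for which the integral converges. -/
def bernsteinC (ν : Measure ℝ) (z : ℂ) : ℂ :=
  ∫ w in Ioi (0 : ℝ), (1 - Complex.exp (-(z * (w : ℂ)))) ∂ν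

/-- The backward shift `(B x) n = x (n - 1)`, as an invertible operator on sequences
indexed by `ℤ`; thus `B⁻¹` is the forward shift. -/
def shiftB : (ℤ → ℝ) ≃ₗ[ℝ] (ℤ → ℝ) :=
  LinearEquiv.funCongrLeft ℝ ℝ (Equiv.subRight (1 : ℤ))

theorem shiftB_apply (x : ℤ → ℝ) (n : ℤ) : shiftB x n = x (n - 1) := rfl

theorem shiftB_zpow_apply (i : ℤ) (x : ℤ → ℝ) (n : ℤ) : (shiftB ^ i) x n = x (n - i) := by
  have hinv : ∀ (y : ℤ → ℝ) (k : ℤ), (shiftB⁻¹) y k = y (k + 1) := fun y k => rfl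
  induction i using Int.induction_on generalizing x n with
  | zero => simp
  | succ j ih =>
    rw [zpow_add, zpow_one, LinearEquiv.mul_apply, ih, shiftB_apply]
    congr 1; ring
  | pred j ih =>
    rw [sub_eq_add_neg, zpow_add, zpow_neg_one, LinearEquiv.mul_apply, ih, hinv]
    congr 1; ring

/-- The difference operator `I - B^i`. -/
def diffOp (i : ℤ) : Module.End ℝ (ℤ → ℝ) :=
  1 - ((shiftB ^ i : (ℤ → ℝ) ≃ₗ[ℝ] (ℤ → ℝ)) : (ℤ → ℝ) →ₗ[ℝ] (ℤ → ℝ))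

theorem diffOp_apply (i : ℤ) (x : ℤ → ℝ) (n : ℤ) : diffOp i x n = x n - x (n - i) := by
  simp [diffOp, shiftB_zpow_apply]

/-- `(e^A x)_n = ∑_m (A^m x)_n / m!`, the exponential of an operator on sequences. -/
def opExp (A : Module.End ℝ (ℤ → ℝ)) (x : ℤ → ℝ) (n : ℤ) : ℝ :=
  ∑' m : ℕ, ((m.factorial : ℝ)⁻¹) * (A ^ m) x n

/-- `(f(A) x)_n = ∫_(0,∞) (x_n - (e^{-wA} x)_n) ν(dw)`, the operator `f(A)` for the Bernstein
function `f` with triplet `(0, 0, ν)`.  It is used for `A = c (I - B^i)` with `c ≥ 0` and bounded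
sequences `x`, for which the exponential series converges absolutely and the integrand is bounded
by a multiple of `min(w,1)`. -/
def bernsteinOp (ν : Measure ℝ) (A : Module.End ℝ (ℤ → ℝ)) (x : ℤ → ℝ) (n : ℤ) : ℝ :=
  ∫ w in Ioi (0 : ℝ), (x n - opExp ((-w) • A) x n) ∂ν

/-- The right-hand side `-∑_{i ∈ I} f_i(λ_i(t)(I - B^i)) x` at the index `n`. -/
def genRHS (I : Finset ℤ) (lam : ℤ → ℝ → ℝ) (ν : ℤ → Measure ℝ)
    (t : ℝ) (x : ℤ → ℝ) (n : ℤ) : ℝ :=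
  -∑ i ∈ I, bernsteinOp (ν i) (lam i t • diffOp i) x n

/-- `p` solves `d/dt p_n = -∑_{i ∈ I} f_i(λ_i(t)(I - B^i)) p_n`, `p_n(0) = δ_{n0}`, on `[0,∞)`.
As the rates are only integrable, the equation is understood in the sense of Carathéodory:
every `p_n` is locally absolutely continuous and the equation holds at almost every time.
Solutions are bounded in `n`, locally uniformly in time. -/
structure IsSolution (I : Finset ℤ) (lam : ℤ → ℝ → ℝ) (ν : ℤ → Measure ℝ)
    (p : ℤ → ℝ → ℝ) : Prop where
  bounded : ∀ T : ℝ, ∃ C : ℝ, ∀ n : ℤ, ∀ t ∈ Icc 0 T, |p n t| ≤ C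
  abs_cont : ∀ n : ℤ, ∀ T : ℝ, 0 ≤ T → AbsolutelyContinuousOnInterval (p n) 0 T
  init : ∀ n : ℤ, p n 0 = if n = 0 then 1 else 0
  eqn : ∀ᵐ t ∂(volume.restrict (Ici (0 : ℝ))), ∀ n : ℤ,
    HasDerivAt (p n) (genRHS I lam ν t (fun k => p k t) n) t

/-- The law `p_n(t) = P(S(t) = n)` of an integer-valued process. -/
def lawOf {Ω : Type*} [MeasurableSpace Ω] (P : Measure Ω) (S : ℝ≥0 → Ω → ℤ)
    (n : ℤ) (t : ℝ) : ℝ :=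
  P.real (S t.toNNReal ⁻¹' {n})

/-- A process on `ℤ` with independent increments and `S(0) = 0` almost surely. -/
structure IsAdditiveFromZero {Ω : Type*} [MeasurableSpace Ω] (P : Measure Ω)
    (S : ℝ≥0 → Ω → ℤ) : Prop where
  measurable : ∀ t, Measurable (S t)
  start : ∀ᵐ ω ∂P, S 0 ω = 0
  indep : HasIndepIncrements S P

/-- The rate `∑_{m ≥ 1, i ∈ I, mi = n} λ_i(t)^m / m! ∫_(0,∞) e^{-λ_i(t) w} w^m ν_i(dw)` of the
jumps of size `n ≠ 0`.  Since `|i| ≥ 1`, only `m ≤ |n|` can occur. -/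
def jumpRate (I : Finset ℤ) (lam : ℤ → ℝ → ℝ) (ν : ℤ → Measure ℝ) (t : ℝ) (n : ℤ) : ℝ :=
  ∑ i ∈ I, ∑ m ∈ (Finset.Icc 1 n.natAbs).filter (fun m : ℕ => (m : ℤ) * i = n),
    lam i t ^ m / (m.factorial : ℝ) *
      ∫ w in Ioi (0 : ℝ), Real.exp (-(lam i t * w)) * w ^ m ∂(ν i)

/-- The infinitesimal behaviour at time `t` of the conditional probabilities
`P(S(t+h) = k+n | S(t) = k)` as `h ↓ 0`, for all states `k` with `P(S(t) = k) > 0`. -/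
structure HasInfinitesimalAt {Ω : Type*} [MeasurableSpace Ω] (I : Finset ℤ) (lam : ℤ → ℝ → ℝ)
    (f : ℤ → ℝ → ℝ) (ν : ℤ → Measure ℝ) (P : Measure Ω) (S : ℝ≥0 → Ω → ℤ) (t : ℝ≥0) : Prop where
  jump : ∀ k : ℤ, P (S t ⁻¹' {k}) ≠ 0 →
    ∀ n : ℤ, (∃ i ∈ I, ∃ m : ℕ, 1 ≤ m ∧ (m : ℤ) * i = n) →
      (fun h : ℝ≥0 => (P[|S t ⁻¹' {k}]).real (S (t + h) ⁻¹' {k + n}) - jumpRate I lam ν t n * h)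
        =o[𝓝[>] 0] (fun h : ℝ≥0 => (h : ℝ))
  stay : ∀ k : ℤ, P (S t ⁻¹' {k}) ≠ 0 →
      (fun h : ℝ≥0 => (P[|S t ⁻¹' {k}]).real (S (t + h) ⁻¹' {k})
          - (1 - (∑ i ∈ I, f i (lam i t)) * h))
        =o[𝓝[>] 0] (fun h : ℝ≥0 => (h : ℝ))
  other : ∀ k : ℤ, P (S t ⁻¹' {k}) ≠ 0 →
    ∀ n : ℤ, n ≠ 0 → (¬ ∃ i ∈ I, ∃ m : ℕ, 1 ≤ m ∧ (m : ℤ) * i = n) →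
      (fun h : ℝ≥0 => (P[|S t ⁻¹' {k}]).real (S (t + h) ⁻¹' {k + n}))
        =o[𝓝[>] 0] (fun h : ℝ≥0 => (h : ℝ))

/-- The non-homogeneous generalized Bernstein-fractional Skellam process: independent increments,
`S(0) = 0` almost surely, locally absolutely continuous law, and the prescribed infinitesimal
behaviour at almost every time. -/
structure IsBernsteinSkellam {Ω : Type*} [MeasurableSpace Ω] (I : Finset ℤ) (lam : ℤ → ℝ → ℝ)
    (f : ℤ → ℝ → ℝ) (ν : ℤ → Measure ℝ) (P : Measure Ω) (S : ℝ≥0 → Ω → ℤ) : Prop where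
  additive : IsAdditiveFromZero P S
  abs_cont : ∀ n : ℤ, ∀ T : ℝ, 0 ≤ T → AbsolutelyContinuousOnInterval (lawOf P S n) 0 T
  infinitesimal : ∀ᵐ t ∂(volume.restrict (Ici (0 : ℝ))),
    HasInfinitesimalAt I lam f ν P S t.toNNReal

end

set_option linter.unusedSectionVars false

/-! Since `I - B^i` is the identity minus a shift, `e^{-b(I - B^i)}` averages over a Poisson(b)
number of shifts by `i`. Integrating against `ν_i` turns the right-hand side of (1) into `∑_k r_k(t)
(x_{n-k} - x_n)`, where `r_k = jumpRate` and the total rate is `q(t) = ∑_i f_i(λ_i(t))`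
(`hasSum_genRHS`). So (1) is the forward equation of a time-inhomogeneous random walk. Since `f_i(c)
≤ C max(c, 1)`, the total rate `q` is locally integrable, and the generator at time `t` is bounded
by `2 q(t)` on bounded sequences.

Uniqueness is Picard iteration in the sup norm: the difference of two solutions is bounded by `C (∫
2q)^m / m!` for every `m` (`eq_zero_of_abs_deriv_le`).

Existence comes from a Poisson point process with intensity `∑_n r_n(t) dt ⊗ δ_n`. Summing its jumps
gives independent increments, and the increment over `(s, t]` is compound Poisson with jump measure
`∑_n (∫_s^t r_n) δ_n` (`exists_additive_process`). This description of the increments,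
`HasCompoundPoissonIncrements`, is the hub of the proof. A compound Poisson law with jump measure
`μ` agrees with its first order expansion up to `μ(ℤ)^2`, so (2) holds wherever the integrals of the
rates have the right derivative, hence almost everywhere by Lebesgue differentiation.

Conversely, (2) at a time `t` gives the right derivative of the law. Exchanging limit and sum is a
Scheffé argument, because the individual rates and their total both converge. Absolute continuity
upgrades right derivatives to derivatives almost everywhere, so every member of the class solves
(1).

If the law of an additive process solves (1), uniqueness identifies it with the law of the
constructed process. Characteristic functions of compound Poisson laws never vanish, so
one-dimensional laws determine the increments by division
(`hasCompoundPoissonIncrements_of_lawOf_eq`). Hence all processes in the class have compound Poisson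
increments. State space and generating function then follow from `E χ = exp ∫ (χ - 1) dμ` for
multiplicative `χ`, applied to `χ(n) = u^n`. -/

theorem hasSum_of_eq {ι E : Type*} [AddCommMonoid E] [TopologicalSpace E] {f g : ι → E} {a b : E}
    (h : HasSum f a) (hfg : ∀ n, g n = f n) (hab : b = a) : HasSum g b := by
  rw [hab, funext hfg]; exact h

/-! ### Poisson weights and their mixtures over a Lévy measure -/

/-- The weight `e^{-x} x^m / m!` of the Poisson distribution. -/
noncomputable def poissonWeight (m : ℕ) (x : ℝ) : ℝ := Real.exp (-x) * x ^ m / (m.factorial : ℝ)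

theorem poissonWeight_nonneg (m : ℕ) {x : ℝ} (hx : 0 ≤ x) : 0 ≤ poissonWeight m x := by
  unfold poissonWeight; positivity

theorem continuous_poissonWeight (m : ℕ) : Continuous (poissonWeight m) := by
  unfold poissonWeight; fun_prop

theorem hasSum_poissonWeight_mul_pow (x : ℝ) (z : ℂ) :
    HasSum (fun m => (poissonWeight m x : ℂ) * z ^ m) (Complex.exp (-(x * (1 - z)))) := by
  have h := (NormedSpace.expSeries_div_hasSum_exp ((x : ℂ) * z)).mul_left (Complex.exp (-x))
  rw [← Complex.exp_eq_exp_ℂ, ← Complex.exp_add] at h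
  have e : (fun m => (poissonWeight m x : ℂ) * z ^ m)
      = fun m : ℕ => Complex.exp (-x) * (((x : ℂ) * z) ^ m / (m.factorial : ℂ)) := by
    ext m
    rw [poissonWeight, mul_pow]; push_cast; ring
  rw [e, show -((x : ℂ) * (1 - z)) = -x + x * z by ring]
  exact h

theorem hasSum_poissonWeight_mul_pow_real (x z : ℝ) :
    HasSum (fun m => poissonWeight m x * z ^ m) (Real.exp (-(x * (1 - z)))) := by
  have h := hasSum_poissonWeight_mul_pow x z
  exact_mod_cast h

theorem hasSum_poissonWeight (x : ℝ) : HasSum (fun m => poissonWeight m x) 1 := by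
  simpa using hasSum_poissonWeight_mul_pow_real x 1

theorem poissonWeight_zero (x : ℝ) : poissonWeight 0 x = Real.exp (-x) := by
  simp [poissonWeight]

theorem hasSum_poissonWeight_succ (x : ℝ) :
    HasSum (fun m => poissonWeight (m + 1) x) (1 - Real.exp (-x)) := by
  have h := (hasSum_nat_add_iff' 1).2 (hasSum_poissonWeight x)
  simpa [poissonWeight_zero] using h

theorem hasSum_poissonWeight_succ_mul_pow (x : ℝ) (z : ℂ) :
    HasSum (fun m => (poissonWeight (m + 1) x : ℂ) * z ^ (m + 1))
      (Complex.exp (-(x * (1 - z))) - Complex.exp (-x)) := by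
  have h := (hasSum_nat_add_iff' 1).2 (hasSum_poissonWeight_mul_pow x z)
  simpa [poissonWeight_zero] using h

/-- A single term is at most the whole sum over `m ≥ 1`. The zeroth weight is excluded because it
tends to `1` as `x → 0`, where the Lévy measure may have infinite mass. -/
theorem poissonWeight_succ_le (m : ℕ) {x : ℝ} (hx : 0 ≤ x) :
    poissonWeight (m + 1) x ≤ 1 - Real.exp (-x) :=
  le_hasSum (hasSum_poissonWeight_succ x) m fun _ _ => poissonWeight_nonneg _ hx

theorem one_sub_exp_nonneg {x : ℝ} (hx : 0 ≤ x) : 0 ≤ 1 - Real.exp (-x) := by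
  simpa using hx

/-- The growth in `c` is at most linear; this is why mere local integrability of `λ_i` makes `f_i ∘
λ_i` locally integrable. -/
theorem one_sub_exp_mul_le {c w : ℝ} (hw : 0 ≤ w) :
    1 - Real.exp (-(c * w)) ≤ max c 1 * min w 1 := by
  rcases le_total w 1 with h | h
  · rw [min_eq_left h]
    have h1 := Real.add_one_le_exp (-(c * w))
    have h2 : c * w ≤ max c 1 * w := mul_le_mul_of_nonneg_right (le_max_left _ _) hw
    linarith
  · rw [min_eq_right h]
    have h1 := Real.exp_pos (-(c * w))
    have h2 := le_max_right c 1
    linarith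

section Levy

variable {ν : Measure ℝ} (hν : ∫⁻ w in Ioi (0 : ℝ), ENNReal.ofReal (min w 1) ∂ν < ∞)
include hν

theorem integrable_min_one : IntegrableOn (fun w => min w 1) (Ioi (0 : ℝ)) ν := by
  refine ⟨(by fun_prop : Measurable fun w : ℝ => min w 1).aestronglyMeasurable, ?_⟩
  rw [hasFiniteIntegral_iff_ofReal]
  · exact hν
  · filter_upwards [ae_restrict_mem measurableSet_Ioi] with w hw
    exact le_min (le_of_lt hw) zero_le_one

theorem integrable_one_sub_exp {c : ℝ} (hc : 0 ≤ c) :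
    IntegrableOn (fun w => 1 - Real.exp (-(c * w))) (Ioi (0 : ℝ)) ν := by
  refine Integrable.mono' ((integrable_min_one hν).const_mul (max c 1))
    (by fun_prop : Measurable fun w : ℝ => 1 - Real.exp (-(c * w))).aestronglyMeasurable ?_
  filter_upwards [ae_restrict_mem measurableSet_Ioi] with w hw
  have hw : (0 : ℝ) < w := hw
  rw [Real.norm_of_nonneg (one_sub_exp_nonneg (by positivity))]
  exact one_sub_exp_mul_le hw.le

theorem integrable_poissonWeight_succ (m : ℕ) {c : ℝ} (hc : 0 ≤ c) :
    IntegrableOn (fun w => poissonWeight (m + 1) (c * w)) (Ioi (0 : ℝ)) ν := by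
  refine Integrable.mono' (integrable_one_sub_exp hν hc)
    ((continuous_poissonWeight _).comp (by fun_prop : Continuous fun w : ℝ => c * w)
      ).measurable.aestronglyMeasurable ?_
  filter_upwards [ae_restrict_mem measurableSet_Ioi] with w hw
  have hw : (0 : ℝ) < w := hw
  rw [Real.norm_of_nonneg (poissonWeight_nonneg _ (by positivity))]
  exact poissonWeight_succ_le m (by positivity)

end Levy

/-- The Bernstein function `c ↦ ∫_(0,∞) (1 - e^{-cw}) ν(dw)`. -/
noncomputable def bernsteinFun (ν : Measure ℝ) (c : ℝ) : ℝ :=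
  ∫ w in Ioi (0 : ℝ), (1 - Real.exp (-(c * w))) ∂ν

/-- The mixed Poisson weight `∫_(0,∞) e^{-cw} (cw)^m / m! ν(dw)`. -/
noncomputable def mixedWeight (ν : Measure ℝ) (m : ℕ) (c : ℝ) : ℝ :=
  ∫ w in Ioi (0 : ℝ), poissonWeight m (c * w) ∂ν

theorem mixedWeight_eq (ν : Measure ℝ) (m : ℕ) (c : ℝ) :
    mixedWeight ν m c = c ^ m / (m.factorial : ℝ) *
      ∫ w in Ioi (0 : ℝ), Real.exp (-(c * w)) * w ^ m ∂ν := by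
  rw [mixedWeight, ← integral_const_mul]
  congr 1
  ext w
  simp only [poissonWeight, mul_pow]
  ring

theorem mixedWeight_nonneg (ν : Measure ℝ) (m : ℕ) {c : ℝ} (hc : 0 ≤ c) :
    0 ≤ mixedWeight ν m c :=
  setIntegral_nonneg measurableSet_Ioi fun _ hw =>
    poissonWeight_nonneg _ (mul_nonneg hc (le_of_lt hw))

theorem bernsteinFun_nonneg (ν : Measure ℝ) {c : ℝ} (hc : 0 ≤ c) : 0 ≤ bernsteinFun ν c :=
  setIntegral_nonneg measurableSet_Ioi fun _ hw =>
    one_sub_exp_nonneg (mul_nonneg hc (le_of_lt hw))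

section Levy

variable {ν : Measure ℝ} (hν : ∫⁻ w in Ioi (0 : ℝ), ENNReal.ofReal (min w 1) ∂ν < ∞)
include hν

theorem bernsteinFun_le {c : ℝ} (hc : 0 ≤ c) :
    bernsteinFun ν c ≤ max c 1 * ∫ w in Ioi (0 : ℝ), min w 1 ∂ν := by
  rw [← integral_const_mul]
  exact setIntegral_mono_on (integrable_one_sub_exp hν hc) ((integrable_min_one hν).const_mul _)
    measurableSet_Ioi fun w hw => one_sub_exp_mul_le (le_of_lt hw)

/-- Dominated convergence: for `c` below `c₀ + 1` the integrands share the bound `max (c₀ + 1) 1 *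
min w 1`. It serves both the Bernstein functions and the mixed weights. -/
theorem continuousOn_integral_of_le_one_sub_exp {φ : ℝ → ℝ} (hφ : Continuous φ)
    (hle : ∀ x, 0 ≤ x → |φ x| ≤ 1 - Real.exp (-x)) :
    ContinuousOn (fun c => ∫ w in Ioi (0 : ℝ), φ (c * w) ∂ν) (Ici 0) := by
  intro c₀ hc₀
  refine continuousWithinAt_of_dominated (bound := fun w => max (c₀ + 1) 1 * min w 1) ?_ ?_
    ((integrable_min_one hν).const_mul _) ?_
  · exact Eventually.of_forall fun c =>
      (hφ.comp (by fun_prop : Continuous fun w : ℝ => c * w)).measurable.aestronglyMeasurable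
  · have h1 : ∀ᶠ c in 𝓝[Ici 0] c₀, c < c₀ + 1 :=
      nhdsWithin_le_nhds (eventually_lt_nhds (by linarith))
    filter_upwards [h1, self_mem_nhdsWithin] with c hc hc0
    filter_upwards [ae_restrict_mem measurableSet_Ioi] with w hw
    have hw : (0 : ℝ) < w := hw
    have hc0 : (0 : ℝ) ≤ c := hc0
    rw [Real.norm_eq_abs]
    refine (hle _ (by positivity)).trans ((one_sub_exp_mul_le hw.le).trans ?_)
    gcongr
  · exact Eventually.of_forall fun w =>
      (hφ.comp (by fun_prop : Continuous fun c : ℝ => c * w)).continuousWithinAt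

theorem continuousOn_bernsteinFun : ContinuousOn (bernsteinFun ν) (Ici 0) :=
  continuousOn_integral_of_le_one_sub_exp hν (φ := fun x => 1 - Real.exp (-x)) (by fun_prop)
    fun _ hx => (abs_of_nonneg (one_sub_exp_nonneg hx)).le

theorem continuousOn_mixedWeight_succ (m : ℕ) :
    ContinuousOn (mixedWeight ν (m + 1)) (Ici 0) :=
  continuousOn_integral_of_le_one_sub_exp hν (continuous_poissonWeight (m + 1))
    fun _ hx => (abs_of_nonneg (poissonWeight_nonneg _ hx)).le.trans (poissonWeight_succ_le m hx)

/-- Fubini for sum and integral. It is applied to differences of a bounded sequence, giving the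
generator, and to `u^n - 1`, giving the generating function. -/
theorem hasSum_smul_mixedWeight {E : Type*} [NormedAddCommGroup E] [NormedSpace ℝ E]
    [CompleteSpace E] {c : ℝ} (hc : 0 ≤ c) {y : ℕ → E}
    (hy : Summable fun m => mixedWeight ν (m + 1) c * ‖y m‖) :
    HasSum (fun m => mixedWeight ν (m + 1) c • y m)
      (∫ w in Ioi (0 : ℝ), ∑' m, poissonWeight (m + 1) (c * w) • y m ∂ν) := by
  have h := hasSum_integral_of_summable_integral_norm (μ := ν.restrict (Ioi 0))
    (F := fun m w => poissonWeight (m + 1) (c * w) • y m)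
    (fun m => (integrable_poissonWeight_succ hν m hc).smul_const (y m)) ?_
  · convert h using 2 with m
    rw [integral_smul_const]; rfl
  · convert hy using 2 with m
    rw [mixedWeight, ← integral_mul_const]
    refine setIntegral_congr_fun measurableSet_Ioi fun w hw => ?_
    simp only [norm_smul]
    rw [Real.norm_of_nonneg (poissonWeight_nonneg _ (mul_nonneg hc (le_of_lt hw)))]

theorem lintegral_tsum_poissonWeight {c : ℝ} (hc : 0 ≤ c) (y : ℕ → ℝ≥0∞) :
    ∑' m, ENNReal.ofReal (mixedWeight ν (m + 1) c) * y m =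
      ∫⁻ w in Ioi (0 : ℝ), ∑' m, ENNReal.ofReal (poissonWeight (m + 1) (c * w)) * y m ∂ν := by
  have hm : ∀ m, Measurable fun w : ℝ => ENNReal.ofReal (poissonWeight m (c * w)) := fun m =>
    ((continuous_poissonWeight m).measurable.comp (measurable_const_mul c)).ennreal_ofReal
  rw [lintegral_tsum fun m => ((hm _).mul_const _).aemeasurable]
  congr 1
  ext m
  rw [lintegral_mul_const _ (hm _), mixedWeight, ofReal_integral_eq_lintegral_ofReal
    (integrable_poissonWeight_succ hν m hc)]
  filter_upwards [ae_restrict_mem measurableSet_Ioi] with w hw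
  exact poissonWeight_nonneg _ (mul_nonneg hc (le_of_lt hw))

/-- The Poisson weights with `m ≥ 1` add up to `1 - e^{-cw}`, and their nonnegativity bounds all
partial sums of the integrals. -/
theorem hasSum_mixedWeight {c : ℝ} (hc : 0 ≤ c) :
    HasSum (fun m => mixedWeight ν (m + 1) c) (bernsteinFun ν c) := by
  have h := hasSum_integral_of_summable_integral_norm (μ := ν.restrict (Ioi 0))
    (F := fun m w => poissonWeight (m + 1) (c * w))
    (fun m => integrable_poissonWeight_succ hν m hc) ?_
  · simp only [(hasSum_poissonWeight_succ _).tsum_eq] at h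
    exact h
  · refine summable_of_sum_le (c := bernsteinFun ν c)
      (fun m => integral_nonneg fun _ => norm_nonneg _) fun s => ?_
    rw [← integral_finsetSum _ fun m _ => (integrable_poissonWeight_succ hν m hc).norm]
    refine setIntegral_mono_on (integrable_finsetSum _ fun m _ =>
      (integrable_poissonWeight_succ hν m hc).norm) (integrable_one_sub_exp hν hc)
      measurableSet_Ioi fun w hw => ?_
    have hw : (0 : ℝ) < w := hw
    have h0 : ∀ m, ‖poissonWeight (m + 1) (c * w)‖ = poissonWeight (m + 1) (c * w) := fun m =>
      Real.norm_of_nonneg (poissonWeight_nonneg _ (by positivity))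
    simp only [h0]
    exact sum_le_hasSum s (fun _ _ => poissonWeight_nonneg _ (by positivity))
      (hasSum_poissonWeight_succ _)

end Levy

/-! ### The operators of the equation as series of shifts -/

theorem coe_shiftB_zpow_pow_apply (i : ℤ) (j : ℕ) (x : ℤ → ℝ) (n : ℤ) :
    ((((shiftB ^ i : (ℤ → ℝ) ≃ₗ[ℝ] (ℤ → ℝ)) : (ℤ → ℝ) →ₗ[ℝ] (ℤ → ℝ)) : Module.End ℝ (ℤ → ℝ)) ^ j) x n
      = x (n - j * i) := by
  induction j generalizing n with
  | zero => simp
  | succ j ih =>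
    rw [pow_succ', Module.End.mul_apply, LinearEquiv.coe_coe, shiftB_zpow_apply, ih]
    congr 1; push_cast; ring

/-- Binomial theorem for the commuting operators `b B^i` and `-b`: the exponential series becomes
the Cauchy product of their two exponential series. -/
theorem pow_smul_diffOp_apply (i : ℤ) (b : ℝ) (m : ℕ) (x : ℤ → ℝ) (n : ℤ) :
    ((m.factorial : ℝ)⁻¹) * (((-b) • diffOp i) ^ m) x n =
      ∑ kl ∈ Finset.HasAntidiagonal.antidiagonal m, (b ^ kl.1 / (kl.1.factorial : ℝ) * x (n - kl.1 * i)) *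
        ((-b) ^ kl.2 / (kl.2.factorial : ℝ)) := by
  set B : Module.End ℝ (ℤ → ℝ) :=
    ((shiftB ^ i : (ℤ → ℝ) ≃ₗ[ℝ] (ℤ → ℝ)) : (ℤ → ℝ) →ₗ[ℝ] (ℤ → ℝ)) with hB
  have e : (-b) • diffOp i = b • B + (-b) • (1 : Module.End ℝ (ℤ → ℝ)) := by
    rw [diffOp, smul_sub, ← hB, neg_smul, neg_smul]; abel
  have hc : Commute (b • B) ((-b) • (1 : Module.End ℝ (ℤ → ℝ))) :=
    (Commute.one_right _).smul_right _
  rw [e, hc.add_pow', LinearMap.sum_apply, Finset.sum_apply, Finset.mul_sum]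
  refine Finset.sum_congr rfl fun kl hkl => ?_
  have hm : kl.1 + kl.2 = m := Finset.HasAntidiagonal.mem_antidiagonal.1 hkl
  rw [smul_pow, smul_pow, one_pow, mul_smul_comm, mul_one, LinearMap.smul_apply, Pi.smul_apply,
    LinearMap.smul_apply, Pi.smul_apply, LinearMap.smul_apply, Pi.smul_apply,
    coe_shiftB_zpow_pow_apply, ← hm, nsmul_eq_mul, smul_eq_mul, smul_eq_mul]
  have h1 := Nat.add_choose_mul_factorial_mul_factorial kl.1 kl.2
  have h2 : ((kl.1 + kl.2).choose kl.1 : ℝ) * kl.1.factorial * kl.2.factorial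
      = (kl.1 + kl.2).factorial := by rw [Nat.choose_symm_add]; exact_mod_cast h1
  have h3 : ((kl.1.factorial : ℕ) : ℝ) ≠ 0 := by positivity
  have h4 : ((kl.2.factorial : ℕ) : ℝ) ≠ 0 := by positivity
  have h5 : (((kl.1 + kl.2).factorial : ℕ) : ℝ) ≠ 0 := by positivity
  field_simp
  rw [← h2]; ring

/-- Boundedness of `x` makes both factors of the Cauchy product absolutely convergent, so `e^{-b(I -
B^i)} = e^{-b} e^{b B^i}`, the transition operator of a Poisson walk with steps `i`. -/
theorem opExp_smul_diffOp (i : ℤ) (b : ℝ) {x : ℤ → ℝ} {C : ℝ} (hx : ∀ k, |x k| ≤ C) (n : ℤ) :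
    HasSum (fun m : ℕ => poissonWeight m b * x (n - m * i)) (opExp ((-b) • diffOp i) x n) := by
  have hs : ∀ a : ℝ, Summable fun m : ℕ => ‖a ^ m / (m.factorial : ℝ)‖ := fun a => by
    exact (Real.summable_pow_div_factorial a).norm
  have h1 : Summable fun m : ℕ => ‖b ^ m / (m.factorial : ℝ) * x (n - m * i)‖ := by
    refine Summable.of_nonneg_of_le (fun _ => norm_nonneg _) (fun m => ?_) ((hs b).mul_right C)
    rw [norm_mul]
    exact mul_le_mul_of_nonneg_left (hx _) (norm_nonneg _)
  have h2 := tsum_mul_tsum_eq_tsum_sum_antidiagonal_of_summable_norm h1 (hs (-b))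
  have h3 : opExp ((-b) • diffOp i) x n =
      Real.exp (-b) * ∑' m : ℕ, b ^ m / (m.factorial : ℝ) * x (n - m * i) := by
    rw [opExp]
    simp only [pow_smul_diffOp_apply]
    rw [← h2, mul_comm, (NormedSpace.expSeries_div_hasSum_exp (-b)).tsum_eq, ← Real.exp_eq_exp_ℝ]
  rw [h3]
  refine hasSum_of_eq (h1.of_norm.hasSum.mul_left (Real.exp (-b))) (fun m => ?_) rfl
  rw [poissonWeight]; ring

/-- Writing `x_n` as the Poisson average of a constant makes the `m = 0` term cancel before
integration; what is left is dominated by a multiple of `1 - e^{-cw}`. -/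
theorem hasSum_bernsteinOp {ν : Measure ℝ}
    (hν : ∫⁻ w in Ioi (0 : ℝ), ENNReal.ofReal (min w 1) ∂ν < ∞) {c : ℝ} (hc : 0 ≤ c) (i : ℤ)
    {x : ℤ → ℝ} {C : ℝ} (hx : ∀ k, |x k| ≤ C) (n : ℤ) :
    HasSum (fun m : ℕ => mixedWeight ν (m + 1) c • (x n - x (n - ((m + 1 : ℕ) : ℤ) * i)))
      (bernsteinOp ν (c • diffOp i) x n) := by
  have hb : ∀ m : ℕ, ‖x n - x (n - ((m + 1 : ℕ) : ℤ) * i)‖ ≤ C + C := fun m =>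
    (norm_sub_le _ _).trans (add_le_add (hx _) (hx _))
  have h := hasSum_smul_mixedWeight hν hc
    (y := fun m : ℕ => x n - x (n - ((m + 1 : ℕ) : ℤ) * i)) ?_
  · refine hasSum_of_eq h (fun _ => rfl) ?_
    refine setIntegral_congr_fun measurableSet_Ioi fun w _ => ?_
    have e : (-w) • c • diffOp i = (-(c * w)) • diffOp i := by rw [smul_smul]; congr 1; ring
    have h1 := (hasSum_nat_add_iff' 1).2
      (((hasSum_poissonWeight (c * w)).mul_right (x n)).sub (opExp_smul_diffOp i (c * w) hx n))
    simp only [e]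
    refine (HasSum.tsum_eq (hasSum_of_eq h1 (fun m => ?_) ?_)).symm
    · rw [smul_eq_mul]; ring
    · simp [poissonWeight_zero]
  · refine Summable.of_nonneg_of_le (fun m => mul_nonneg (mixedWeight_nonneg _ _ hc)
      (norm_nonneg _)) (fun m => mul_le_mul_of_nonneg_left (hb m) (mixedWeight_nonneg _ _ hc))
      ((hasSum_mixedWeight hν hc).summable.mul_right _)

/-! ### Jump rates indexed by the jump size -/

/-- The rate of the jumps of size `n` which are multiples of `i`. -/
noncomputable def jumpWeight (i : ℤ) (ν : Measure ℝ) (c : ℝ) (n : ℤ) : ℝ :=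
  ∑ m ∈ (Finset.Icc 1 n.natAbs).filter (fun m : ℕ => (m : ℤ) * i = n), mixedWeight ν m c

theorem jumpRate_eq_sum_jumpWeight (I : Finset ℤ) (lam : ℤ → ℝ → ℝ) (ν : ℤ → Measure ℝ) (t : ℝ)
    (n : ℤ) : jumpRate I lam ν t n = ∑ i ∈ I, jumpWeight i (ν i) (lam i t) n := by
  simp only [jumpRate, jumpWeight, mixedWeight_eq]

theorem jumpWeight_succ_mul {i : ℤ} (hi : i ≠ 0) (ν : Measure ℝ) (c : ℝ) (m : ℕ) :
    jumpWeight i ν c (((m + 1 : ℕ) : ℤ) * i) = mixedWeight ν (m + 1) c := by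
  have e : (Finset.Icc 1 (((m + 1 : ℕ) : ℤ) * i).natAbs).filter
      (fun k : ℕ => (k : ℤ) * i = ((m + 1 : ℕ) : ℤ) * i) = {m + 1} := by
    ext k
    simp only [Finset.mem_filter, Finset.mem_Icc, Finset.mem_singleton]
    constructor
    · rintro ⟨-, h⟩
      exact_mod_cast mul_right_cancel₀ hi h
    · rintro rfl
      refine ⟨⟨by omega, ?_⟩, rfl⟩
      rw [Int.natAbs_mul, Int.natAbs_natCast]
      -- Since `|i| ≥ 1`, the cut-off at `|n|` in the definition loses no `m`.
      exact Nat.le_mul_of_pos_right _ (Int.natAbs_pos.2 hi)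
  rw [jumpWeight, e, Finset.sum_singleton]

theorem jumpWeight_eq_zero {i : ℤ} (ν : Measure ℝ) (c : ℝ) {n : ℤ}
    (h : n ∉ range fun m : ℕ => ((m + 1 : ℕ) : ℤ) * i) : jumpWeight i ν c n = 0 := by
  refine Finset.sum_eq_zero fun m hm => absurd ?_ h
  simp only [Finset.mem_filter, Finset.mem_Icc] at hm
  exact ⟨m - 1, by simp only [Nat.sub_add_cancel hm.1.1, hm.2]⟩

theorem injective_succ_mul {i : ℤ} (hi : i ≠ 0) :
    Function.Injective fun m : ℕ => ((m + 1 : ℕ) : ℤ) * i := fun a b h => by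
  have := mul_right_cancel₀ hi h
  omega

/-- For fixed `i ≠ 0` a jump size determines its multiplicity. Passing from multiplicities to jump
sizes puts the contributions of all `i` on the common index set `ℤ`, where they can be added. -/
theorem hasSum_jumpWeight_smul_iff {E : Type*} [NormedAddCommGroup E] [NormedSpace ℝ E] {i : ℤ}
    (hi : i ≠ 0) (ν : Measure ℝ) (c : ℝ) (y : ℤ → E) (s : E) :
    HasSum (fun n => jumpWeight i ν c n • y n) s ↔
      HasSum (fun m : ℕ => mixedWeight ν (m + 1) c • y (((m + 1 : ℕ) : ℤ) * i)) s := by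
  rw [← (injective_succ_mul hi).hasSum_iff fun n hn => by
    rw [jumpWeight_eq_zero ν c hn, zero_smul]]
  simp only [Function.comp_def, jumpWeight_succ_mul hi]

theorem tsum_jumpWeight_mul {i : ℤ} (hi : i ≠ 0) (ν : Measure ℝ) (c : ℝ) (y : ℤ → ℝ≥0∞) :
    ∑' n, ENNReal.ofReal (jumpWeight i ν c n) * y n =
      ∑' m : ℕ, ENNReal.ofReal (mixedWeight ν (m + 1) c) * y (((m + 1 : ℕ) : ℤ) * i) := by
  rw [← (injective_succ_mul hi).tsum_eq]
  · simp only [jumpWeight_succ_mul hi]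
  · intro n hn
    by_contra h
    exact hn (by simp [jumpWeight_eq_zero ν c h])

theorem jumpWeight_nonneg (i : ℤ) (ν : Measure ℝ) {c : ℝ} (hc : 0 ≤ c) (n : ℤ) :
    0 ≤ jumpWeight i ν c n := Finset.sum_nonneg fun _ _ => mixedWeight_nonneg _ _ hc

theorem jumpWeight_zero (i : ℤ) (ν : Measure ℝ) (c : ℝ) : jumpWeight i ν c 0 = 0 := by
  simp [jumpWeight]

section Levy

variable {ν : Measure ℝ} (hν : ∫⁻ w in Ioi (0 : ℝ), ENNReal.ofReal (min w 1) ∂ν < ∞)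
include hν

theorem continuousOn_jumpWeight (i n : ℤ) : ContinuousOn (fun c => jumpWeight i ν c n) (Ici 0) := by
  refine continuousOn_finsetSum _ fun m hm => ?_
  simp only [Finset.mem_filter, Finset.mem_Icc] at hm
  obtain ⟨k, rfl⟩ := Nat.exists_eq_add_of_le' hm.1.1
  exact continuousOn_mixedWeight_succ hν k

theorem hasSum_jumpWeight {i : ℤ} (hi : i ≠ 0) {c : ℝ} (hc : 0 ≤ c) :
    HasSum (fun n => jumpWeight i ν c n) (bernsteinFun ν c) := by
  have := (hasSum_jumpWeight_smul_iff hi ν c (fun _ => (1 : ℝ)) (bernsteinFun ν c)).2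
    (by simpa using hasSum_mixedWeight hν hc)
  simpa using this

theorem hasSum_jumpWeight_mul_sub {i : ℤ} (hi : i ≠ 0) {c : ℝ} (hc : 0 ≤ c)
    {x : ℤ → ℝ} {C : ℝ} (hx : ∀ k, |x k| ≤ C) (n : ℤ) :
    HasSum (fun k => jumpWeight i ν c k * (x (n - k) - x n)) (-bernsteinOp ν (c • diffOp i) x n) := by
  have := (hasSum_jumpWeight_smul_iff hi ν c (fun k => x n - x (n - k)) _).2
    (hasSum_bernsteinOp hν hc i hx n)
  refine hasSum_of_eq this.neg (fun k => ?_) rfl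
  rw [smul_eq_mul]; ring

end Levy

/-! ### Families of jump rates and their regularity in time -/

theorem aestronglyMeasurable_comp_of_continuousOn_Ici {φ : ℝ → ℝ} (hφ : ContinuousOn φ (Ici 0))
    {μ : Measure ℝ} {l : ℝ → ℝ} (hl : AEStronglyMeasurable l μ) (h0 : ∀ᵐ t ∂μ, 0 ≤ l t) :
    AEStronglyMeasurable (fun t => φ (l t)) μ := by
  -- Continuity of `φ` is known only on `[0, ∞)`, so `φ` is extended to the left by its value at
  -- `0`.
  have hc : Continuous fun c : ℝ => φ (max c 0) :=
    hφ.comp_continuous (by fun_prop) fun c => le_max_right c 0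
  refine (hc.comp_aestronglyMeasurable hl).congr ?_
  filter_upwards [h0] with t ht
  simp [max_eq_left ht]

/-- A family of nonnegative jump rates `r n t`, `n ≠ 0`, with locally integrable total rate
`q t = ∑ n, r n t`. -/
structure IsRateFamily (r : ℤ → ℝ → ℝ) (q : ℝ → ℝ) : Prop where
  nonneg : ∀ n t, 0 ≤ t → 0 ≤ r n t
  zero : ∀ t, r 0 t = 0
  hasSum : ∀ t, 0 ≤ t → HasSum (fun n => r n t) (q t)
  aesm : ∀ n, AEStronglyMeasurable (r n) (volume.restrict (Ici (0 : ℝ)))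
  intervalIntegrable_total : ∀ s t : ℝ, 0 ≤ s → 0 ≤ t → IntervalIntegrable q volume s t

section Rates

variable {I : Finset ℤ} (hI : (0 : ℤ) ∉ I) {lam : ℤ → ℝ → ℝ}
  (hlam_nonneg : ∀ i ∈ I, ∀ t : ℝ, 0 ≤ t → 0 ≤ lam i t)
  {ν : ℤ → Measure ℝ}
  (hν : ∀ i ∈ I, ∫⁻ w in Ioi (0 : ℝ), ENNReal.ofReal (min w 1) ∂(ν i) < ∞)

include hlam_nonneg hν in
-- This identifies (1) as a Kolmogorov forward equation with rates `jumpRate`; all later arguments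
-- use the equation in this form.
theorem hasSum_genRHS (hI : (0 : ℤ) ∉ I) {t : ℝ} (ht : 0 ≤ t) {x : ℤ → ℝ} {C : ℝ}
    (hx : ∀ k, |x k| ≤ C) (n : ℤ) :
    HasSum (fun k => jumpRate I lam ν t k * (x (n - k) - x n)) (genRHS I lam ν t x n) := by
  simp only [jumpRate_eq_sum_jumpWeight, genRHS, Finset.sum_mul, ← Finset.sum_neg_distrib]
  exact hasSum_sum fun i hi => hasSum_jumpWeight_mul_sub (hν i hi)
    (fun h => hI (h ▸ hi)) (hlam_nonneg i hi t ht) hx n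

theorem aestronglyMeasurable_comp_rate {l : ℝ → ℝ} (h0 : ∀ t : ℝ, 0 ≤ t → 0 ≤ l t)
    (hint : LocallyIntegrableOn l (Ici (0 : ℝ))) {φ : ℝ → ℝ} (hφ : ContinuousOn φ (Ici 0)) :
    AEStronglyMeasurable (fun t => φ (l t)) (volume.restrict (Ici (0 : ℝ))) := by
  refine aestronglyMeasurable_comp_of_continuousOn_Ici hφ hint.aestronglyMeasurable ?_
  filter_upwards [ae_restrict_mem measurableSet_Ici] with t ht using h0 t ht

theorem intervalIntegrable_bernsteinFun_comp {l : ℝ → ℝ} (h0 : ∀ t : ℝ, 0 ≤ t → 0 ≤ l t)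
    (hint : LocallyIntegrableOn l (Ici (0 : ℝ))) {ν : Measure ℝ}
    (hν : ∫⁻ w in Ioi (0 : ℝ), ENNReal.ofReal (min w 1) ∂ν < ∞) {s t : ℝ} (hs : 0 ≤ s)
    (ht : 0 ≤ t) : IntervalIntegrable (fun u => bernsteinFun ν (l u)) volume s t := by
  have hsub : uIcc s t ⊆ Ici (0 : ℝ) := fun u hu => (le_min hs ht).trans hu.1
  have hl : IntegrableOn l (uIcc s t) := hint.integrableOn_compact_subset hsub isCompact_uIcc
  have hb : IntegrableOn (fun u => (l u + 1) * ∫ w in Ioi (0 : ℝ), min w 1 ∂ν) (uIcc s t) :=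
    (hl.add (integrableOn_const isCompact_uIcc.measure_lt_top.ne)).mul_const _
  rw [intervalIntegrable_iff]
  refine IntegrableOn.mono_set ?_ uIoc_subset_uIcc
  refine Integrable.mono' hb ((aestronglyMeasurable_comp_rate h0 hint
    (continuousOn_bernsteinFun hν)).mono_measure (Measure.restrict_mono hsub le_rfl)) ?_
  filter_upwards [ae_restrict_mem measurableSet_uIcc] with u hu
  have hu0 := h0 u (hsub hu)
  rw [Real.norm_of_nonneg (bernsteinFun_nonneg ν hu0)]
  refine (bernsteinFun_le hν hu0).trans (mul_le_mul_of_nonneg_right ?_ ?_)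
  · exact max_le (by linarith) (by linarith)
  · exact setIntegral_nonneg measurableSet_Ioi fun w hw => le_min (le_of_lt hw) zero_le_one

include hI hlam_nonneg hν in
theorem isRateFamily_jumpRate
    (hlam_int : ∀ i ∈ I, LocallyIntegrableOn (lam i) (Ici (0 : ℝ))) :
    IsRateFamily (fun n t => jumpRate I lam ν t n)
      (fun t => ∑ i ∈ I, bernsteinFun (ν i) (lam i t)) where
  nonneg n t ht := by
    rw [jumpRate_eq_sum_jumpWeight]
    exact Finset.sum_nonneg fun i hi => jumpWeight_nonneg _ _ (hlam_nonneg i hi t ht) _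
  zero t := by simp [jumpRate_eq_sum_jumpWeight, jumpWeight_zero]
  hasSum t ht := by
    simp only [jumpRate_eq_sum_jumpWeight]
    exact hasSum_sum fun i hi => hasSum_jumpWeight (hν i hi) (fun h => hI (h ▸ hi))
      (hlam_nonneg i hi t ht)
  aesm n := by
    simp only [jumpRate_eq_sum_jumpWeight]
    exact Finset.aestronglyMeasurable_fun_sum _ fun i hi => aestronglyMeasurable_comp_rate
      (hlam_nonneg i hi) (hlam_int i hi) (continuousOn_jumpWeight (hν i hi) i n)
  intervalIntegrable_total s t hs ht := by
    have := IntervalIntegrable.sum I fun i hi => intervalIntegrable_bernsteinFun_comp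
      (hlam_nonneg i hi) (hlam_int i hi) (hν i hi) hs ht
    exact this.congr_ae (Eventually.of_forall fun u => Finset.sum_apply _ _ _)

include hlam_nonneg in
theorem continuousWithinAt_comp_rate {φ : ℝ → ℝ} (hφ : ContinuousOn φ (Ici 0)) {i : ℤ}
    (hi : i ∈ I) {s : Set ℝ} (hs : s ⊆ Ici 0) {t : ℝ} (ht : t ∈ s)
    (h : ContinuousWithinAt (lam i) s t) : ContinuousWithinAt (fun u => φ (lam i u)) s t :=
  (hφ (lam i t) (hlam_nonneg i hi t (hs ht))).comp h fun u hu => hlam_nonneg i hi u (hs hu)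

include hlam_nonneg hν in
theorem continuousWithinAt_jumpRate {s : Set ℝ} (hs : s ⊆ Ici 0) {t : ℝ} (ht : t ∈ s)
    (h : ∀ i ∈ I, ContinuousWithinAt (lam i) s t) (n : ℤ) :
    ContinuousWithinAt (fun u => jumpRate I lam ν u n) s t := by
  simp only [jumpRate_eq_sum_jumpWeight]
  exact tendsto_finsetSum _ fun i hi => continuousWithinAt_comp_rate hlam_nonneg
    (continuousOn_jumpWeight (hν i hi) i n) hi hs ht (h i hi)

include hlam_nonneg hν in
theorem continuousWithinAt_totalRate {s : Set ℝ} (hs : s ⊆ Ici 0) {t : ℝ} (ht : t ∈ s)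
    (h : ∀ i ∈ I, ContinuousWithinAt (lam i) s t) :
    ContinuousWithinAt (fun u => ∑ i ∈ I, bernsteinFun (ν i) (lam i u)) s t :=
  tendsto_finsetSum _ fun i hi => continuousWithinAt_comp_rate hlam_nonneg
    (continuousOn_bernsteinFun (hν i hi)) hi hs ht (h i hi)

end Rates

/-! ### Compound Poisson laws on the integers -/

/-- The `j`-th convolution power of a measure on `ℤ`. -/
noncomputable def convPow (μ : Measure ℤ) : ℕ → Measure ℤ
  | 0 => Measure.dirac 0
  | j + 1 => μ ∗ convPow μ j

/-- The compound Poisson law with finite jump measure `μ`. -/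
noncomputable def compoundPoisson (μ : Measure ℤ) : Measure ℤ :=
  Measure.sum fun j : ℕ => ENNReal.ofReal (Real.exp (-μ.real univ) / (j.factorial : ℝ)) • convPow μ j

theorem ae_mem_convPow {μ : Measure ℤ} [SFinite μ] {M : AddSubmonoid ℤ} (hM : ∀ᵐ x ∂μ, x ∈ M) (j : ℕ) :
    ∀ᵐ x ∂(convPow μ j), x ∈ M := by
  induction j with
  | zero => rw [convPow, ae_dirac_iff .of_discrete]; exact M.zero_mem
  | succ j ih =>
    rw [convPow, ae_iff, ← lintegral_indicator_one .of_discrete, Measure.lintegral_conv .of_discrete,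
      lintegral_eq_zero_iff .of_discrete]
    filter_upwards [hM] with x hx
    rw [Pi.zero_apply, lintegral_eq_zero_iff .of_discrete]
    filter_upwards [ih] with y hy
    simp [M.add_mem hx hy]

section CompoundPoisson

variable {μ : Measure ℤ} [IsFiniteMeasure μ]

theorem ae_mem_compoundPoisson {M : AddSubmonoid ℤ} (hM : ∀ᵐ x ∂μ, x ∈ M) :
    ∀ᵐ x ∂(compoundPoisson μ), x ∈ M := by
  rw [compoundPoisson, Measure.ae_sum_iff' .of_discrete]
  exact fun j => Measure.ae_smul_measure (ae_mem_convPow hM j) _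

/-- Multiplicativity is asked for only on a submonoid carrying `μ`, since `n ↦ 0^n` is
multiplicative on `ℕ` but not on `ℤ`. -/
theorem lintegral_convPow {M : AddSubmonoid ℤ} (hM : ∀ᵐ x ∂μ, x ∈ M) {χ : ℤ → ℝ≥0∞}
    (h0 : χ 0 = 1) (hadd : ∀ x ∈ M, ∀ y ∈ M, χ (x + y) = χ x * χ y) (j : ℕ) :
    ∫⁻ x, χ x ∂(convPow μ j) = (∫⁻ x, χ x ∂μ) ^ j := by
  induction j with
  | zero => simp [convPow, h0]
  | succ j ih =>
    rw [convPow, Measure.lintegral_conv .of_discrete, pow_succ', ← ih,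
      ← lintegral_mul_const _ .of_discrete]
    refine lintegral_congr_ae ?_
    filter_upwards [hM] with x hx
    rw [← lintegral_const_mul _ .of_discrete]
    refine lintegral_congr_ae ?_
    filter_upwards [ae_mem_convPow hM j] with y hy using hadd x hx y hy

theorem lintegral_compoundPoisson {M : AddSubmonoid ℤ} (hM : ∀ᵐ x ∂μ, x ∈ M) {χ : ℤ → ℝ≥0∞}
    (h0 : χ 0 = 1) (hadd : ∀ x ∈ M, ∀ y ∈ M, χ (x + y) = χ x * χ y) :
    ∫⁻ x, χ x ∂(compoundPoisson μ) =
      ∑' j : ℕ, ENNReal.ofReal (Real.exp (-μ.real univ) / (j.factorial : ℝ)) *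
        (∫⁻ x, χ x ∂μ) ^ j := by
  rw [compoundPoisson, lintegral_sum_measure]
  congr 1
  ext j
  rw [lintegral_smul_measure, lintegral_convPow hM h0 hadd, smul_eq_mul]

theorem tsum_exp_neg_mul_pow (a b : ℝ) (hb : 0 ≤ b) :
    ∑' j : ℕ, ENNReal.ofReal (Real.exp (-a) / (j.factorial : ℝ)) * (ENNReal.ofReal b) ^ j
      = ENNReal.ofReal (Real.exp (b - a)) := by
  have h := (NormedSpace.expSeries_div_hasSum_exp b).mul_left (Real.exp (-a))
  rw [← Real.exp_eq_exp_ℝ, ← Real.exp_add, neg_add_eq_sub] at h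
  rw [← h.tsum_eq, ENNReal.ofReal_tsum_of_nonneg (fun j => by positivity) h.summable]
  congr 1
  ext j
  rw [← ENNReal.ofReal_pow hb, ← ENNReal.ofReal_mul (by positivity)]
  congr 1; ring

/-- The term `j = 1` has a positive coefficient, so finiteness passes down to `μ`; conversely the
exponential series converges at every finite value. -/
theorem lintegral_compoundPoisson_lt_top_iff {M : AddSubmonoid ℤ} (hM : ∀ᵐ x ∂μ, x ∈ M)
    {χ : ℤ → ℝ≥0∞} (h0 : χ 0 = 1) (hadd : ∀ x ∈ M, ∀ y ∈ M, χ (x + y) = χ x * χ y) :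
    ∫⁻ x, χ x ∂(compoundPoisson μ) < ∞ ↔ ∫⁻ x, χ x ∂μ < ∞ := by
  rw [lintegral_compoundPoisson hM h0 hadd]
  constructor
  · intro h
    have h1 := (ENNReal.le_tsum 1).trans_lt h
    rw [pow_one] at h1
    refine ENNReal.lt_top_of_mul_ne_top_right h1.ne ?_
    rw [ne_eq, ENNReal.ofReal_eq_zero, not_le]
    positivity
  · intro h
    rw [← ENNReal.ofReal_toReal h.ne, tsum_exp_neg_mul_pow _ _ ENNReal.toReal_nonneg]
    exact ENNReal.ofReal_lt_top

instance isProbabilityMeasure_compoundPoisson : IsProbabilityMeasure (compoundPoisson μ) := by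
  constructor
  have h := lintegral_compoundPoisson (μ := μ) (M := ⊤) (by simp) (χ := fun _ => 1) rfl (by simp)
  rw [lintegral_one, lintegral_one] at h
  rw [h, ← ofReal_measureReal, tsum_exp_neg_mul_pow _ _ measureReal_nonneg]
  simp

theorem integral_convPow {M : AddSubmonoid ℤ} (hM : ∀ᵐ x ∂μ, x ∈ M) {χ : ℤ → ℂ}
    (h0 : χ 0 = 1) (hadd : ∀ x ∈ M, ∀ y ∈ M, χ (x + y) = χ x * χ y) (hint : Integrable χ μ)
    (j : ℕ) : Integrable χ (convPow μ j) ∧ ∫ x, χ x ∂(convPow μ j) = (∫ x, χ x ∂μ) ^ j := by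
  have hi : ∀ j, Integrable χ (convPow μ j) := fun j => by
    refine ⟨.of_discrete, ?_⟩
    rw [hasFiniteIntegral_iff_enorm, lintegral_convPow hM (χ := fun x => ‖χ x‖ₑ) (by simp [h0])
      fun x hx y hy => by rw [hadd x hx y hy, enorm_mul]]
    exact ENNReal.pow_lt_top hint.2
  refine ⟨hi j, ?_⟩
  induction j with
  | zero => simp [convPow, h0]
  | succ j ih =>
    have h := hi (j + 1)
    rw [convPow] at h ⊢
    rw [integral_conv h, pow_succ', ← ih, ← integral_mul_const]
    refine integral_congr_ae ?_
    filter_upwards [hM] with x hx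
    rw [← integral_const_mul]
    refine integral_congr_ae ?_
    filter_upwards [ae_mem_convPow hM j] with y hy using hadd x hx y hy

theorem integrable_compoundPoisson_iff {M : AddSubmonoid ℤ} (hM : ∀ᵐ x ∂μ, x ∈ M) {χ : ℤ → ℂ}
    (h0 : χ 0 = 1) (hadd : ∀ x ∈ M, ∀ y ∈ M, χ (x + y) = χ x * χ y) :
    Integrable χ (compoundPoisson μ) ↔ Integrable χ μ := by
  have h := lintegral_compoundPoisson_lt_top_iff hM (χ := fun x => ‖χ x‖ₑ) (by simp [h0])
      fun x hx y hy => by rw [hadd x hx y hy, enorm_mul]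
  exact ⟨fun hi => ⟨.of_discrete, h.1 hi.2⟩, fun hi => ⟨.of_discrete, h.2 hi.2⟩⟩

theorem integral_compoundPoisson {M : AddSubmonoid ℤ} (hM : ∀ᵐ x ∂μ, x ∈ M) {χ : ℤ → ℂ}
    (h0 : χ 0 = 1) (hadd : ∀ x ∈ M, ∀ y ∈ M, χ (x + y) = χ x * χ y) (hint : Integrable χ μ) :
    ∫ x, χ x ∂(compoundPoisson μ) = Complex.exp (∫ x, (χ x - 1) ∂μ) := by
  have hi := (integrable_compoundPoisson_iff hM h0 hadd).2 hint
  rw [compoundPoisson] at hi ⊢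
  have h := (NormedSpace.expSeries_div_hasSum_exp (∫ x, χ x ∂μ)).mul_left
    (Complex.exp (-(μ.real univ : ℂ)))
  rw [← Complex.exp_eq_exp_ℂ, ← Complex.exp_add, neg_add_eq_sub] at h
  rw [integral_sub hint (integrable_const _), integral_const, ← (hasSum_integral_measure hi).tsum_eq,
    Complex.real_smul, mul_one, ← h.tsum_eq]
  congr 1
  ext j
  rw [integral_smul_measure, (integral_convPow hM h0 hadd hint j).2,
    ENNReal.toReal_ofReal (by positivity), Complex.real_smul]
  push_cast
  ring

/-- Only the events of no jump and of exactly one jump are kept. Applied to complements, the same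
bound yields the upper estimate. -/
theorem compoundPoisson_real_ge (s : Set ℤ) :
    Real.exp (-μ.real univ) * ((Measure.dirac (0 : ℤ)).real s + μ.real s) ≤
      (compoundPoisson μ).real s := by
  have h2 : ENNReal.ofReal (Real.exp (-μ.real univ)) * (Measure.dirac (0 : ℤ) s + μ s) ≤
      compoundPoisson μ s := by
    rw [compoundPoisson, Measure.sum_apply _ .of_discrete]
    refine le_trans (le_of_eq ?_) (ENNReal.sum_le_tsum (Finset.range 2))
    simp [Finset.sum_range_succ, mul_add, convPow]
  have h3 := ENNReal.toReal_mono (measure_ne_top _ _) h2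
  rwa [ENNReal.toReal_mul, ENNReal.toReal_ofReal (Real.exp_pos _).le,
    ENNReal.toReal_add (measure_ne_top _ _) (measure_ne_top _ _)] at h3

theorem compoundPoisson_real_le (s : Set ℤ) :
    (compoundPoisson μ).real s ≤ 1 - Real.exp (-μ.real univ) *
      (1 + μ.real univ - (Measure.dirac (0 : ℤ)).real s - μ.real s) := by
  have h1 := compoundPoisson_real_ge (μ := μ) sᶜ
  rw [probReal_compl_eq_one_sub (μ := compoundPoisson μ) .of_discrete,
    probReal_compl_eq_one_sub (μ := Measure.dirac (0 : ℤ)) .of_discrete,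
    measureReal_compl (μ := μ) .of_discrete] at h1
  linarith

/-- With `a` the total mass, both deviations are at most `a^2`, by `e^{-a} ≥ 1 - a` and `(1 - a)(1 +
a) = 1 - a^2`. This quadratic error is what becomes the `o(h)` in (2). -/
theorem abs_compoundPoisson_real_singleton_sub_le {n : ℤ} (hn : n ≠ 0) :
    |(compoundPoisson μ).real {n} - μ.real {n}| ≤ μ.real univ ^ 2 := by
  have h1 := compoundPoisson_real_ge (μ := μ) {n}
  have h2 := compoundPoisson_real_le (μ := μ) {n}
  have h3 : (Measure.dirac (0 : ℤ)).real {n} = 0 := by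
    rw [measureReal_def, Measure.dirac_apply' _ .of_discrete]; simp [hn.symm]
  rw [h3] at h1 h2
  have h4 : μ.real {n} ≤ μ.real univ := measureReal_mono (subset_univ _)
  have h5 : 0 ≤ μ.real {n} := measureReal_nonneg
  have h6 := Real.add_one_le_exp (-μ.real univ)
  have h7 : Real.exp (-μ.real univ) ≤ 1 := Real.exp_le_one_iff.2 (by linarith)
  rw [abs_le]
  constructor <;> nlinarith

theorem abs_compoundPoisson_real_zero_sub_le (hμ : μ {0} = 0) :
    |(compoundPoisson μ).real {0} - (1 - μ.real univ)| ≤ μ.real univ ^ 2 := by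
  have h1 := compoundPoisson_real_ge (μ := μ) {0}
  have h2 := compoundPoisson_real_le (μ := μ) {0}
  have h3 : (Measure.dirac (0 : ℤ)).real {0} = 1 := by
    rw [measureReal_def, Measure.dirac_apply' _ .of_discrete]; simp
  have h4 : μ.real {0} = 0 := by rw [measureReal_def, hμ]; simp
  rw [h3, h4] at h1 h2
  have h5 : 0 ≤ μ.real univ := measureReal_nonneg
  have h6 := Real.add_one_le_exp (-μ.real univ)
  have h7 : Real.exp (-μ.real univ) ≤ 1 := Real.exp_le_one_iff.2 (by linarith)
  rw [abs_le]
  constructor <;> nlinarith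

theorem one_sub_le_compoundPoisson_real_zero :
    1 - μ.real univ ≤ (compoundPoisson μ).real {0} := by
  have h1 := compoundPoisson_real_ge (μ := μ) {0}
  have h3 : (Measure.dirac (0 : ℤ)).real {0} = 1 := by
    rw [measureReal_def, Measure.dirac_apply' _ .of_discrete]; simp
  rw [h3] at h1
  have h5 : 0 ≤ μ.real {0} := measureReal_nonneg
  have h6 := Real.add_one_le_exp (-μ.real univ)
  have h7 := Real.exp_pos (-μ.real univ)
  nlinarith

end CompoundPoisson

/-! ### Finite Poisson point configurations -/

section PoissonPoints

variable {X : Type*} [MeasurableSpace X]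

theorem measurable_prod_range_fst {g : X → ℂ} (hg : Measurable g) :
    Measurable fun ω : ℕ × (ℕ → X) => ∏ j ∈ Finset.range ω.1, g (ω.2 j) := by
  refine measurable_from_prod_countable_right fun n => ?_
  change Measurable fun y : ℕ → X => ∏ j ∈ Finset.range n, g (y j)
  exact Finset.measurable_fun_prod _ fun j _ => hg.comp (measurable_pi_apply j)

/-- Given `n` points, independence makes the expectation `(∫ g dρ)^n`; averaging over the Poisson
number of points gives an exponential series. -/
theorem integral_prod_poissonPoints (c : ℝ≥0) (ρ : Measure X) [IsProbabilityMeasure ρ] {g : X → ℂ}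
    (hg : Measurable g) (hg1 : ∀ x, ‖g x‖ ≤ 1) :
    ∫ ω : ℕ × (ℕ → X), ∏ j ∈ Finset.range ω.1, g (ω.2 j)
        ∂((poissonMeasure c).prod (Measure.infinitePi fun _ => ρ)) =
      Complex.exp (c * ((∫ x, g x ∂ρ) - 1)) := by
  have hb : ∀ ω : ℕ × (ℕ → X), ‖∏ j ∈ Finset.range ω.1, g (ω.2 j)‖ ≤ 1 := fun ω => by
    rw [norm_prod]
    exact Finset.prod_le_one (fun _ _ => norm_nonneg _) fun _ _ => hg1 _
  have hint : Integrable (fun ω : ℕ × (ℕ → X) => ∏ j ∈ Finset.range ω.1, g (ω.2 j))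
      ((poissonMeasure c).prod (Measure.infinitePi fun _ => ρ)) :=
    Integrable.of_bound (measurable_prod_range_fst hg).aestronglyMeasurable 1
      (Eventually.of_forall hb)
  have hone : ∀ j : ℕ, ∫ x : ℕ → X, g (x j) ∂(Measure.infinitePi fun _ => ρ) = ∫ x, g x ∂ρ :=
    fun j => by
      have h := integral_map (μ := Measure.infinitePi fun _ : ℕ => ρ) (φ := fun x => x j)
        (measurable_pi_apply j).aemeasurable (f := g) hg.aestronglyMeasurable
      rw [Measure.infinitePi_map_eval] at h
      exact h.symm
  have hin : ∀ n : ℕ, ∫ x : ℕ → X, ∏ j ∈ Finset.range n, g (x j) ∂(Measure.infinitePi fun _ => ρ)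
      = (∫ x, g x ∂ρ) ^ n := fun n => by
    have hind : iIndepFun (fun (j : ℕ) (x : ℕ → X) => g (x j)) (Measure.infinitePi fun _ => ρ) :=
      iIndepFun_infinitePi (P := fun _ => ρ) (X := fun _ x => g x) fun _ => hg
    have h := (hind.precomp (g := fun j : Fin n => (j : ℕ)) Fin.val_injective
      ).integral_fun_prod_eq_prod_integral
        fun j => (hg.comp (measurable_pi_apply _)).aestronglyMeasurable
    simp only [Finset.prod_range]
    rw [h]
    simp [hone]
  rw [integral_prod _ hint]
  simp only [hin]
  rw [integral_poissonMeasure]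
  have h := (NormedSpace.expSeries_div_hasSum_exp ((c : ℂ) * ∫ x, g x ∂ρ)).mul_left
    (Complex.exp (-(c : ℂ)))
  rw [← Complex.exp_eq_exp_ℂ, ← Complex.exp_add] at h
  rw [show (c : ℂ) * ((∫ x, g x ∂ρ) - 1) = -(c : ℂ) + c * ∫ x, g x ∂ρ by ring, ← h.tsum_eq]
  congr 1
  ext n
  rw [Complex.real_smul, mul_pow]
  push_cast
  ring

theorem exists_prob_smul_eq [Nonempty X] (L : Measure X) [IsFiniteMeasure L] :
    ∃ ρ : Measure X, IsProbabilityMeasure ρ ∧ L = (L univ).toNNReal • ρ := by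
  rcases eq_zero_or_neZero L with h | h
  -- The zero measure has no normalisation, but it is `0` times any probability measure.
  · obtain ⟨x⟩ := ‹Nonempty X›
    exact ⟨Measure.dirac x, inferInstance, by simp [h]⟩
  · refine ⟨(L univ)⁻¹ • L, isProbabilityMeasureSMul, ?_⟩
    have hne : L univ ≠ 0 := by simpa using h.out
    rw [ENNReal.smul_def, ENNReal.coe_toNNReal (measure_ne_top _ _), smul_smul,
      ENNReal.mul_inv_cancel hne (measure_ne_top _ _), one_smul]

/-- Probability space of independent Poisson point configurations. -/
theorem exists_poissonPoints [Nonempty X] (L : ℕ → Measure X) [∀ k, IsFiniteMeasure (L k)] :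
    ∃ P : Measure (ℕ → ℕ × (ℕ → X)), IsProbabilityMeasure P ∧
      ∀ (K : ℕ) (g : ℕ → X → ℂ), (∀ k, Measurable (g k)) → (∀ k x, ‖g k x‖ ≤ 1) →
        ∫ ω, ∏ k ∈ Finset.range K, ∏ j ∈ Finset.range (ω k).1, g k ((ω k).2 j) ∂P =
          Complex.exp (∑ k ∈ Finset.range K, ∫ x, (g k x - 1) ∂(L k)) := by
  choose ρ hρ hL using fun k => exists_prob_smul_eq (L k)
  let Q : ℕ → Measure (ℕ × (ℕ → X)) := fun k =>
    (poissonMeasure (L k univ).toNNReal).prod (Measure.infinitePi fun _ => ρ k)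
  refine ⟨Measure.infinitePi Q, inferInstance, fun K g hg hg1 => ?_⟩
  have hm : ∀ k, Measurable fun ω : ℕ × (ℕ → X) => ∏ j ∈ Finset.range ω.1, g k (ω.2 j) :=
    fun k => measurable_prod_range_fst (hg k)
  have hind : iIndepFun (fun (k : ℕ) (ω : ℕ → ℕ × (ℕ → X)) =>
      ∏ j ∈ Finset.range (ω k).1, g k ((ω k).2 j)) (Measure.infinitePi Q) :=
    iIndepFun_infinitePi (P := Q)
      (X := fun k ω => ∏ j ∈ Finset.range ω.1, g k (ω.2 j)) hm
  have h := (hind.precomp (g := fun j : Fin K => (j : ℕ)) Fin.val_injective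
      ).integral_fun_prod_eq_prod_integral
        fun k => ((hm k).comp (measurable_pi_apply _)).aestronglyMeasurable
  have hone : ∀ k : ℕ, ∫ ω : ℕ → ℕ × (ℕ → X), ∏ j ∈ Finset.range (ω k).1, g k ((ω k).2 j)
      ∂(Measure.infinitePi Q) = Complex.exp (∫ x, (g k x - 1) ∂(L k)) := fun k => by
    have h1 : ∫ ω, ∏ j ∈ Finset.range ω.1, g k (ω.2 j) ∂(Q k) = _ :=
      integral_prod_poissonPoints _ (ρ k) (hg k) (hg1 k)
    rw [← Measure.infinitePi_map_eval Q k, integral_map (measurable_pi_apply k).aemeasurable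
      (hm k).aestronglyMeasurable] at h1
    rw [h1]
    have hi : Integrable (g k) (ρ k) :=
      Integrable.of_bound (hg k).aestronglyMeasurable 1 (Eventually.of_forall (hg1 k))
    conv_rhs => rw [hL k]
    rw [integral_smul_nnreal_measure, integral_sub hi (integrable_const _), NNReal.smul_def,
      Complex.real_smul]
    simp
  rw [Finset.sum_range, Complex.exp_sum]
  refine (integral_congr_ae (Eventually.of_forall fun ω => Finset.prod_range _)).trans
    (h.trans ?_)
  exact Finset.prod_congr rfl fun k _ => hone k

end PoissonPoints

/-! ### The process of summed jumps -/

section PoissonProcess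

/-- The contribution at time `t` of a point `x = (time, jump)` of the `k`-th block. -/
noncomputable def jumpUpTo (t : ℝ≥0) (k : ℕ) (x : ℝ × ℤ) : ℤ :=
  if (k : ℝ) < x.1 ∧ x.1 ≤ t then x.2 else 0

/-- The sum of the jumps up to time `t` of a sequence of finite point configurations, the `k`-th
of which is located in the time interval `(k, k + 1]`. -/
noncomputable def sumOfJumps (t : ℝ≥0) (ω : ℕ → ℕ × (ℕ → ℝ × ℤ)) : ℤ :=
  ∑ k ∈ Finset.range ⌈t⌉₊, ∑ j ∈ Finset.range (ω k).1, jumpUpTo t k ((ω k).2 j)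

theorem measurable_jumpUpTo (t : ℝ≥0) (k : ℕ) : Measurable (jumpUpTo t k) := by
  unfold jumpUpTo
  exact Measurable.ite ((measurableSet_lt measurable_const measurable_fst).inter
    (measurableSet_le measurable_fst measurable_const)) measurable_snd measurable_const

theorem measurable_sumOfJumps (t : ℝ≥0) : Measurable (sumOfJumps t) := by
  unfold sumOfJumps
  refine Finset.measurable_fun_sum _ fun k _ => ?_
  have h : Measurable fun η : ℕ × (ℕ → ℝ × ℤ) => ∑ j ∈ Finset.range η.1, jumpUpTo t k (η.2 j) := by
    refine measurable_from_prod_countable_right fun n => ?_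
    change Measurable fun y : ℕ → ℝ × ℤ => ∑ j ∈ Finset.range n, jumpUpTo t k (y j)
    exact Finset.measurable_fun_sum _ fun j _ =>
      (measurable_jumpUpTo t k).comp (measurable_pi_apply j)
  exact h.comp (measurable_pi_apply k)

theorem sumOfJumps_zero (ω : ℕ → ℕ × (ℕ → ℝ × ℤ)) : sumOfJumps 0 ω = 0 := by
  simp [sumOfJumps]

/-- Blocks starting at or after `t` contribute nothing, so finitely many times can be treated with
one common number of blocks. -/
theorem sumOfJumps_eq {t : ℝ≥0} {K : ℕ} (hK : t ≤ K) (ω : ℕ → ℕ × (ℕ → ℝ × ℤ)) :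
    sumOfJumps t ω =
      ∑ k ∈ Finset.range K, ∑ j ∈ Finset.range (ω k).1, jumpUpTo t k ((ω k).2 j) := by
  refine Finset.sum_subset (Finset.range_mono (Nat.ceil_le.2 hK)) fun k _ hk => ?_
  refine Finset.sum_eq_zero fun j _ => ?_
  have h1 : t ≤ k := Nat.ceil_le.1 (by simpa using hk)
  have h2 : (t : ℝ) ≤ k := by exact_mod_cast h1
  rw [jumpUpTo, if_neg]
  rintro ⟨h3, h4⟩
  linarith

theorem jumpUpTo_sub {s t : ℝ≥0} (hst : s ≤ t) {k : ℕ} {x : ℝ × ℤ} (hx : (k : ℝ) < x.1) :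
    jumpUpTo t k x - jumpUpTo s k x = if x.1 ∈ Ioc (s : ℝ) t then x.2 else 0 := by
  have hst' : (s : ℝ) ≤ t := hst
  simp only [jumpUpTo, hx, true_and, mem_Ioc]
  by_cases h1 : x.1 ≤ s
  · simp [h1, h1.trans hst', not_lt.2 h1]
  · simp [h1, not_le.1 h1]

/-- The jump measure of the time interval `(s, t]`. -/
noncomputable def jumpMeasure (L : Measure (ℝ × ℤ)) (s t : ℝ) : Measure ℤ :=
  (L.restrict (Ioc s t ×ˢ univ)).map Prod.snd

variable {L : Measure (ℝ × ℤ)}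

theorem sum_restrict_Ioc (L : Measure (ℝ × ℤ)) (K : ℕ) :
    ∑ k ∈ Finset.range K, L.restrict (Ioc (k : ℝ) (k + 1) ×ˢ univ) =
      L.restrict (Ioc (0 : ℝ) K ×ˢ univ) := by
  induction K with
  | zero => simp
  | succ K ih =>
    rw [Finset.sum_range_succ, ih, ← Measure.restrict_union _ (measurableSet_Ioc.prod .univ),
      ← union_prod, Ioc_union_Ioc_eq_Ioc (by positivity) (by linarith)]
    · push_cast; rfl
    · rw [Set.disjoint_prod]
      left
      rw [Set.Ioc_disjoint_Ioc]
      simp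

/-- The intervals between successive times are disjoint, so a point enters at most one increment.
Hence `g - 1` splits additively over the increments, which is the source of their independence. -/
theorem exp_sum_mul_indicator_sub_one {n : ℕ} {τ : Fin (n + 1) → ℝ≥0} (hτ : Monotone τ)
    (θ : Fin n → ℝ) {k : ℕ} {x : ℝ × ℤ} (hx : (k : ℝ) < x.1) :
    Complex.exp ((∑ l : Fin n, ((jumpUpTo (τ l.succ) k x - jumpUpTo (τ l.castSucc) k x : ℤ) : ℂ)
      * θ l) * Complex.I) - 1 =
    ∑ l : Fin n, (Ioc (τ l.castSucc : ℝ) (τ l.succ) ×ˢ univ).indicator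
      (fun x : ℝ × ℤ => Complex.exp (x.2 * θ l * Complex.I) - 1) x := by
  have hs : ∀ l : Fin n, jumpUpTo (τ l.succ) k x - jumpUpTo (τ l.castSucc) k x = _ :=
    fun l => jumpUpTo_sub (hτ (Fin.castSucc_le_succ l)) hx
  simp only [hs]
  by_cases h : ∃ l : Fin n, x.1 ∈ Ioc (τ l.castSucc : ℝ) (τ l.succ)
  · obtain ⟨l, hl⟩ := h
    have hne : ∀ l', l' ≠ l → x.1 ∉ Ioc (τ l'.castSucc : ℝ) (τ l'.succ) := fun l' hl' hm => by
      rcases lt_or_gt_of_ne hl' with h | h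
      · have : (τ l'.succ : ℝ) ≤ τ l.castSucc := hτ (Fin.succ_le_castSucc_iff.2 h)
        exact absurd (hl.1.trans_le hm.2) (not_lt.2 this)
      · have : (τ l.succ : ℝ) ≤ τ l'.castSucc := hτ (Fin.succ_le_castSucc_iff.2 h)
        exact absurd (hm.1.trans_le hl.2) (not_lt.2 this)
    rw [Finset.sum_eq_single l (fun l' _ h => by simp [hne l' h]) (by simp),
      Finset.sum_eq_single l (fun l' _ h => indicator_of_notMem (fun hm => hne l' h hm.1) _)
        (by simp), indicator_of_mem (show x ∈ Ioc (τ l.castSucc : ℝ) (τ l.succ) ×ˢ univ from ⟨hl, mem_univ _⟩), if_pos hl]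
  · push Not at h
    rw [Finset.sum_eq_zero, Finset.sum_eq_zero]
    · simp
    · exact fun l _ => indicator_of_notMem (fun hm => h l hm.1) _
    · exact fun l _ => by simp [h l]

variable (hL : ∀ T : ℝ, L (Ioc 0 T ×ˢ univ) < ∞)
include hL

theorem isFiniteMeasure_restrict_Ioc {s t : ℝ} (hs : 0 ≤ s) :
    IsFiniteMeasure (L.restrict (Ioc s t ×ˢ univ)) := by
  refine ⟨?_⟩
  rw [Measure.restrict_apply_univ]
  exact (measure_mono (prod_mono_left (Ioc_subset_Ioc_left hs))).trans_lt (hL t)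

theorem isFiniteMeasure_jumpMeasure {s t : ℝ} (hs : 0 ≤ s) :
    IsFiniteMeasure (jumpMeasure L s t) := by
  have := isFiniteMeasure_restrict_Ioc hL (t := t) hs
  unfold jumpMeasure
  infer_instance

/-- The exponential formula for Poisson points is applied to `g = exp(i ∑_l θ_l a_l)`, where `a_l`
is the contribution of a point to the `l`-th increment. The exponent is then a sum over `l`, so the
joint characteristic function factorises. -/
theorem exists_charFun_increments :
    ∃ P : Measure (ℕ → ℕ × (ℕ → ℝ × ℤ)), IsProbabilityMeasure P ∧
      ∀ (n : ℕ) (τ : Fin (n + 1) → ℝ≥0), Monotone τ → ∀ θ : Fin n → ℝ,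
        ∫ ω, Complex.exp ((∑ l : Fin n,
          ((sumOfJumps (τ l.succ) ω - sumOfJumps (τ l.castSucc) ω : ℤ) : ℂ) * θ l) * Complex.I) ∂P =
        Complex.exp (∑ l : Fin n, ∫ m, (Complex.exp ((m : ℂ) * θ l * Complex.I) - 1)
          ∂(jumpMeasure L (τ l.castSucc) (τ l.succ))) := by
  have hfin : ∀ k : ℕ, IsFiniteMeasure (L.restrict (Ioc (k : ℝ) (k + 1) ×ˢ univ)) := fun k =>
    isFiniteMeasure_restrict_Ioc hL (by positivity)
  obtain ⟨P, hP, h⟩ := exists_poissonPoints fun k : ℕ => L.restrict (Ioc (k : ℝ) (k + 1) ×ˢ univ)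
  refine ⟨P, hP, fun n τ hτ θ => ?_⟩
  obtain ⟨K, hK⟩ := exists_nat_ge (τ (Fin.last n))
  have hK' : ∀ l, τ l ≤ K := fun l => (hτ (Fin.le_last l)).trans hK
  let a : Fin n → ℕ → ℝ × ℤ → ℤ := fun l k x =>
    jumpUpTo (τ l.succ) k x - jumpUpTo (τ l.castSucc) k x
  have ha : ∀ l k, Measurable (a l k) := fun l k =>
    (measurable_jumpUpTo _ _).sub (measurable_jumpUpTo _ _)
  let g : ℕ → ℝ × ℤ → ℂ := fun k x => Complex.exp ((∑ l, (a l k x : ℂ) * θ l) * Complex.I)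
  have hg : ∀ k, Measurable (g k) := fun k => by
    refine Complex.measurable_exp.comp (Measurable.mul_const ?_ _)
    exact Finset.measurable_fun_sum _ fun l _ =>
      ((measurable_from_top (f := fun z : ℤ => (z : ℂ))).comp (ha l k)).mul_const _
  have hg1 : ∀ k x, ‖g k x‖ ≤ 1 := fun k x => by
    have : (∑ l, (a l k x : ℂ) * θ l) = ((∑ l, (a l k x : ℝ) * θ l : ℝ) : ℂ) := by push_cast; rfl
    simp only [g, this, Complex.norm_exp_ofReal_mul_I, le_refl]
  have hφ : ∀ l : Fin n, Measurable fun x : ℝ × ℤ => Complex.exp (x.2 * θ l * Complex.I) - 1 :=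
    fun l => (measurable_from_top
      (f := fun z : ℤ => Complex.exp (z * θ l * Complex.I) - 1)).comp measurable_snd
  have hφ2 : ∀ (l : Fin n) (x : ℝ × ℤ), ‖Complex.exp (x.2 * θ l * Complex.I) - 1‖ ≤ 2 := by
    intro l x
    have : (x.2 : ℂ) * θ l = ((x.2 * θ l : ℝ) : ℂ) := by push_cast; rfl
    refine (norm_sub_le _ _).trans ?_
    rw [this, Complex.norm_exp_ofReal_mul_I]; norm_num
  have hA : ∀ l : Fin n, MeasurableSet (Ioc (τ l.castSucc : ℝ) (τ l.succ) ×ˢ (univ : Set ℤ)) :=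
    fun l => measurableSet_Ioc.prod .univ
  have hφi : ∀ (l : Fin n) (k : ℕ), Integrable
      (fun x : ℝ × ℤ => Complex.exp (x.2 * θ l * Complex.I) - 1)
      (L.restrict (Ioc (k : ℝ) (k + 1) ×ˢ univ)) := fun l k =>
    Integrable.of_bound (hφ l).aestronglyMeasurable 2 (Eventually.of_forall (hφ2 l))
  have hint : ∀ k : ℕ, ∫ x, (g k x - 1) ∂(L.restrict (Ioc (k : ℝ) (k + 1) ×ˢ univ)) =
      ∑ l : Fin n, ∫ x in Ioc (τ l.castSucc : ℝ) (τ l.succ) ×ˢ univ,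
        (Complex.exp (x.2 * θ l * Complex.I) - 1)
        ∂(L.restrict (Ioc (k : ℝ) (k + 1) ×ˢ univ)) := fun k => by
    simp only [← integral_indicator (hA _)]
    rw [← integral_finsetSum _ fun l _ => (hφi l k).indicator (hA l)]
    refine integral_congr_ae ?_
    filter_upwards [ae_restrict_mem (measurableSet_Ioc.prod .univ)] with x hx
    exact exp_sum_mul_indicator_sub_one hτ θ hx.1.1
  have h1 := h K g hg hg1
  simp only [hint] at h1
  have h2 : ∀ ω : ℕ → ℕ × (ℕ → ℝ × ℤ), Complex.exp ((∑ l : Fin n,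
      ((sumOfJumps (τ l.succ) ω - sumOfJumps (τ l.castSucc) ω : ℤ) : ℂ) * θ l) * Complex.I) =
      ∏ k ∈ Finset.range K, ∏ j ∈ Finset.range (ω k).1, g k ((ω k).2 j) := fun ω => by
    simp only [g, ← Complex.exp_sum]
    congr 1
    simp only [sumOfJumps_eq (hK' _), ← Finset.sum_sub_distrib, Finset.sum_mul, Int.cast_sum]
    rw [Finset.sum_comm]
    exact Finset.sum_congr rfl fun k _ => Finset.sum_comm
  simp only [h2, h1]
  rw [Finset.sum_comm]
  congr 1
  refine Finset.sum_congr rfl fun l _ => ?_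
  rw [jumpMeasure, integral_map measurable_snd.aemeasurable
    (measurable_from_top.aestronglyMeasurable)]
  have hsub : Ioc (τ l.castSucc : ℝ) (τ l.succ) ×ˢ (univ : Set ℤ) ⊆ Ioc (0 : ℝ) K ×ˢ univ :=
    prod_mono_left (Ioc_subset_Ioc (NNReal.coe_nonneg _) (by exact_mod_cast hK' l.succ))
  rw [← Measure.restrict_restrict_of_subset hsub, ← sum_restrict_Ioc]
  simp only [← integral_indicator (hA l)]
  rw [integral_finsetSum_measure fun k _ => (hφi l k).indicator (hA l)]

end PoissonProcess

/-! ### Characteristic functions and existence of the additive process -/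

theorem measurableEmbedding_intCast : MeasurableEmbedding (Int.cast : ℤ → ℝ) :=
  Int.isClosedEmbedding_coe_real.measurableEmbedding

theorem charFun_map_intCast (μ : Measure ℤ) (θ : ℝ) :
    charFun (μ.map (Int.cast : ℤ → ℝ)) θ = ∫ m, Complex.exp ((m : ℂ) * θ * Complex.I) ∂μ := by
  rw [charFun_apply_real, measurableEmbedding_intCast.integral_map]
  congr 1
  ext m
  rw [mul_comm (θ : ℂ)]; push_cast; rfl

theorem measure_int_ext_of_integral_exp {μ κ : Measure ℤ} [IsFiniteMeasure μ] [IsFiniteMeasure κ]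
    (h : ∀ θ : ℝ, ∫ m, Complex.exp ((m : ℂ) * θ * Complex.I) ∂μ =
      ∫ m, Complex.exp ((m : ℂ) * θ * Complex.I) ∂κ) : μ = κ := by
  apply measurableEmbedding_intCast.map_injective
  apply Measure.ext_of_charFun
  ext θ
  rw [charFun_map_intCast, charFun_map_intCast, h]

theorem norm_exp_int_mul_I (m : ℤ) (θ : ℝ) : ‖Complex.exp ((m : ℂ) * θ * Complex.I)‖ = 1 := by
  rw [show (m : ℂ) * θ = ((m * θ : ℝ) : ℂ) by push_cast; rfl, Complex.norm_exp_ofReal_mul_I]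

theorem integrable_exp_int_mul_I (μ : Measure ℤ) [IsFiniteMeasure μ] (θ : ℝ) :
    Integrable (fun m : ℤ => Complex.exp ((m : ℂ) * θ * Complex.I)) μ :=
  Integrable.of_bound .of_discrete 1
    (Eventually.of_forall fun m => (norm_exp_int_mul_I m θ).le)

theorem integral_exp_compoundPoisson (μ : Measure ℤ) [IsFiniteMeasure μ] (θ : ℝ) :
    ∫ m, Complex.exp ((m : ℂ) * θ * Complex.I) ∂(compoundPoisson μ) =
      Complex.exp (∫ m, (Complex.exp ((m : ℂ) * θ * Complex.I) - 1) ∂μ) := by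
  refine integral_compoundPoisson (M := ⊤) (by simp) (by simp) (fun x _ y _ => ?_)
    (integrable_exp_int_mul_I μ θ)
  rw [← Complex.exp_add]
  congr 1
  push_cast
  ring

/-- One increment identifies the compound Poisson law; several increments give a joint
characteristic function equal to the product of the marginal ones, hence independence. -/
theorem exists_additive_process {L : Measure (ℝ × ℤ)} (hL : ∀ T : ℝ, L (Ioc 0 T ×ˢ univ) < ∞) :
    ∃ P : Measure (ℕ → ℕ × (ℕ → ℝ × ℤ)), IsProbabilityMeasure P ∧
      IsAdditiveFromZero P sumOfJumps ∧
      ∀ s t : ℝ≥0, s ≤ t → P.map (fun ω => sumOfJumps t ω - sumOfJumps s ω) =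
        compoundPoisson (jumpMeasure L s t) := by
  obtain ⟨P, hP, h⟩ := exists_charFun_increments hL
  have hmeas : ∀ s t : ℝ≥0, Measurable fun ω => sumOfJumps t ω - sumOfJumps s ω := fun s t =>
    (measurable_sumOfJumps t).sub (measurable_sumOfJumps s)
  have hlaw : ∀ s t : ℝ≥0, s ≤ t → P.map (fun ω => sumOfJumps t ω - sumOfJumps s ω) =
        compoundPoisson (jumpMeasure L s t) := fun s t hst => by
    have := isFiniteMeasure_jumpMeasure hL (s := s) (t := t) s.2
    have := Measure.isProbabilityMeasure_map (μ := P) (hmeas s t).aemeasurable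
    refine measure_int_ext_of_integral_exp fun θ => ?_
    rw [integral_exp_compoundPoisson, integral_map (hmeas s t).aemeasurable .of_discrete]
    have hτ : Monotone ![s, t] := by
      intro a b hab
      fin_cases a <;> fin_cases b <;> simp_all
    simpa using h 1 ![s, t] hτ fun _ => θ
  refine ⟨P, hP, ⟨measurable_sumOfJumps, Eventually.of_forall fun ω => sumOfJumps_zero ω, ?_⟩, hlaw⟩
  intro n τ hτ
  have hcast : Measurable (Int.cast : ℤ → ℝ) := measurable_from_top
  have hind : iIndepFun (fun (l : Fin n) ω =>
      ((sumOfJumps (τ l.succ) ω - sumOfJumps (τ l.castSucc) ω : ℤ) : ℝ)) P := by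
    have hmc : ∀ l : Fin n, AEMeasurable (fun ω =>
        ((sumOfJumps (τ l.succ) ω - sumOfJumps (τ l.castSucc) ω : ℤ) : ℝ)) P := fun l =>
      (hcast.comp (hmeas _ _)).aemeasurable
    rw [iIndepFun_iff_charFun_pi hmc]
    intro θ
    have h1 : ∀ l : Fin n, charFun (P.map fun ω =>
        ((sumOfJumps (τ l.succ) ω - sumOfJumps (τ l.castSucc) ω : ℤ) : ℝ)) (θ l) =
        Complex.exp (∫ m, (Complex.exp ((m : ℂ) * θ l * Complex.I) - 1)
          ∂(jumpMeasure L (τ l.castSucc) (τ l.succ))) := fun l => by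
      have := isFiniteMeasure_jumpMeasure hL (s := τ l.castSucc) (t := τ l.succ)
        (τ l.castSucc).2
      have e := Measure.map_map (μ := P) hcast (hmeas (τ l.castSucc) (τ l.succ))
      rw [Function.comp_def] at e
      rw [← e, charFun_map_intCast, hlaw _ _ (hτ (Fin.castSucc_le_succ l)),
        integral_exp_compoundPoisson]
    simp only [h1]
    rw [← Complex.exp_sum, ← h n τ hτ, charFun_apply, integral_map]
    · congr 1
      ext ω
      congr 2
      rw [PiLp.inner_apply]
      push_cast
      refine Finset.sum_congr rfl fun l _ => ?_
      simp [mul_comm]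
    · fun_prop
    · fun_prop
  -- Independence was obtained for the increments viewed as real numbers; the floor map brings them
  -- back to `ℤ`.
  have := hind.comp (fun _ => Int.floor) fun _ => Int.measurable_floor
  convert this using 2 with l
  ext ω
  simp

/-! ### The jump measure of a rate family -/

/-- The intensity measure `∑ n, r n t dt ⊗ δ_n` on `(0,∞) × ℤ`. -/
noncomputable def pointIntensity (r : ℤ → ℝ → ℝ) : Measure (ℝ × ℤ) :=
  Measure.sum fun n : ℤ => ((volume.restrict (Ioi (0 : ℝ))).withDensity
    fun t => ENNReal.ofReal (r n t)).map fun t => (t, n)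

theorem jumpMeasure_pointIntensity (r : ℤ → ℝ → ℝ) {s : ℝ} (hs : 0 ≤ s) (t : ℝ) :
    jumpMeasure (pointIntensity r) s t =
      Measure.sum fun n : ℤ => (∫⁻ u in Ioc s t, ENNReal.ofReal (r n u)) • Measure.dirac n := by
  ext A hA
  have hB : MeasurableSet (Prod.snd ⁻¹' A ∩ Ioc s t ×ˢ (univ : Set ℤ)) :=
    (measurable_snd hA).inter (measurableSet_Ioc.prod .univ)
  rw [jumpMeasure, Measure.map_apply measurable_snd hA, Measure.restrict_apply (measurable_snd hA),
    pointIntensity, Measure.sum_apply _ hB, Measure.sum_apply _ hA]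
  congr 1
  ext n
  rw [Measure.map_apply measurable_prodMk_right hB, withDensity_apply _
    (measurable_prodMk_right hB), Measure.restrict_restrict (measurable_prodMk_right hB),
    Measure.smul_apply, Measure.dirac_apply' _ hA, smul_eq_mul]
  by_cases hn : n ∈ A
  · have e : ((fun u : ℝ => (u, n)) ⁻¹' (Prod.snd ⁻¹' A ∩ Ioc s t ×ˢ (univ : Set ℤ))) ∩ Ioi 0
        = Ioc s t := by
      ext u
      simp only [mem_inter_iff, mem_preimage, hn, true_and, mem_prod, mem_univ, and_true, mem_Ioi,
        and_iff_left_iff_imp]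
      exact fun h => hs.trans_lt h.1
    rw [e]
    simp [hn]
  · have e : ((fun u : ℝ => (u, n)) ⁻¹' (Prod.snd ⁻¹' A ∩ Ioc s t ×ˢ (univ : Set ℤ))) ∩ Ioi 0
        = ∅ := by
      ext u
      simp [hn]
    rw [e]
    simp [hn]

namespace IsRateFamily

variable {r : ℤ → ℝ → ℝ} {q : ℝ → ℝ} (hr : IsRateFamily r q)
include hr

theorem le_total (n : ℤ) {t : ℝ} (ht : 0 ≤ t) : r n t ≤ q t :=
  le_hasSum (hr.hasSum t ht) n fun k _ => hr.nonneg k t ht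

theorem total_nonneg {t : ℝ} (ht : 0 ≤ t) : 0 ≤ q t :=
  (hr.hasSum t ht).nonneg fun n => hr.nonneg n t ht

theorem aesm_Ioc (n : ℤ) {s : ℝ} (hs : 0 ≤ s) (t : ℝ) :
    AEStronglyMeasurable (r n) (volume.restrict (Ioc s t)) :=
  (hr.aesm n).mono_measure (Measure.restrict_mono
    (fun _ hu => hs.trans (le_of_lt hu.1)) le_rfl)

theorem intervalIntegrable (n : ℤ) {s t : ℝ} (hs : 0 ≤ s) (ht : 0 ≤ t) :
    IntervalIntegrable (r n) volume s t := by
  have hq := hr.intervalIntegrable_total s t hs ht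
  rw [intervalIntegrable_iff] at hq ⊢
  have hsub : uIoc s t ⊆ Ici (0 : ℝ) := fun u hu => (le_min hs ht).trans (le_of_lt hu.1)
  refine Integrable.mono' hq ((hr.aesm n).mono_measure (Measure.restrict_mono hsub le_rfl)) ?_
  filter_upwards [ae_restrict_mem measurableSet_uIoc] with u hu
  rw [Real.norm_of_nonneg (hr.nonneg n u (hsub hu))]
  exact hr.le_total n (hsub hu)

theorem lintegral_Ioc (n : ℤ) {s t : ℝ} (hs : 0 ≤ s) (hst : s ≤ t) :
    ∫⁻ u in Ioc s t, ENNReal.ofReal (r n u) = ENNReal.ofReal (∫ u in s..t, r n u) := by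
  rw [intervalIntegral.integral_of_le hst, ofReal_integral_eq_lintegral_ofReal]
  · exact (intervalIntegrable_iff_integrableOn_Ioc_of_le hst).1
      (hr.intervalIntegrable n hs (hs.trans hst))
  · filter_upwards [ae_restrict_mem measurableSet_Ioc] with u hu
    exact hr.nonneg n u (hs.trans (le_of_lt hu.1))

theorem lintegral_jumpMeasure (F : ℤ → ℝ≥0∞) {s : ℝ} (hs : 0 ≤ s) (t : ℝ) :
    ∫⁻ n, F n ∂(jumpMeasure (pointIntensity r) s t) =
      ∫⁻ u in Ioc s t, ∑' n, ENNReal.ofReal (r n u) * F n := by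
  have hm : ∀ n, AEMeasurable (fun u => ENNReal.ofReal (r n u)) (volume.restrict (Ioc s t)) :=
    fun n => (hr.aesm_Ioc n hs t).aemeasurable.ennreal_ofReal
  rw [jumpMeasure_pointIntensity r hs, lintegral_sum_measure,
    lintegral_tsum fun n => (hm n).mul_const _]
  congr 1
  ext n
  rw [lintegral_smul_measure, lintegral_dirac, lintegral_mul_const'' _ (hm n), smul_eq_mul]

theorem jumpMeasure_univ {s t : ℝ} (hs : 0 ≤ s) (hst : s ≤ t) :
    jumpMeasure (pointIntensity r) s t univ = ENNReal.ofReal (∫ u in s..t, q u) := by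
  rw [← lintegral_one, hr.lintegral_jumpMeasure _ hs, intervalIntegral.integral_of_le hst,
    ofReal_integral_eq_lintegral_ofReal]
  · refine setLIntegral_congr_fun measurableSet_Ioc fun u hu => ?_
    have hu0 : 0 ≤ u := hs.trans (le_of_lt hu.1)
    simp only [mul_one]
    rw [← (hr.hasSum u hu0).tsum_eq, ENNReal.ofReal_tsum_of_nonneg (fun n => hr.nonneg n u hu0)
      (hr.hasSum u hu0).summable]
  · exact (intervalIntegrable_iff_integrableOn_Ioc_of_le hst).1
      (hr.intervalIntegrable_total s t hs (hs.trans hst))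
  · filter_upwards [ae_restrict_mem measurableSet_Ioc] with u hu
    exact hr.total_nonneg (hs.trans (le_of_lt hu.1))

theorem integral_total_nonneg {s t : ℝ} (hs : 0 ≤ s) (hst : s ≤ t) : 0 ≤ ∫ u in s..t, q u :=
  intervalIntegral.integral_nonneg hst fun _ hu => hr.total_nonneg (hs.trans hu.1)

theorem integral_nonneg (n : ℤ) {s t : ℝ} (hs : 0 ≤ s) (hst : s ≤ t) : 0 ≤ ∫ u in s..t, r n u :=
  intervalIntegral.integral_nonneg hst fun u hu => hr.nonneg n u (hs.trans hu.1)

theorem jumpMeasure_real_univ {s t : ℝ} (hs : 0 ≤ s) (hst : s ≤ t) :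
    (jumpMeasure (pointIntensity r) s t).real univ = ∫ u in s..t, q u := by
  rw [measureReal_def, hr.jumpMeasure_univ hs hst,
    ENNReal.toReal_ofReal (hr.integral_total_nonneg hs hst)]

theorem jumpMeasure_singleton (n : ℤ) {s t : ℝ} (hs : 0 ≤ s) (hst : s ≤ t) :
    jumpMeasure (pointIntensity r) s t {n} = ENNReal.ofReal (∫ u in s..t, r n u) := by
  rw [jumpMeasure_pointIntensity r hs, Measure.sum_smul_dirac_singleton, hr.lintegral_Ioc n hs hst]

theorem jumpMeasure_real_singleton (n : ℤ) {s t : ℝ} (hs : 0 ≤ s) (hst : s ≤ t) :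
    (jumpMeasure (pointIntensity r) s t).real {n} = ∫ u in s..t, r n u := by
  rw [measureReal_def, hr.jumpMeasure_singleton n hs hst,
    ENNReal.toReal_ofReal (hr.integral_nonneg n hs hst)]

theorem jumpMeasure_zero {s t : ℝ} (hs : 0 ≤ s) (hst : s ≤ t) :
    jumpMeasure (pointIntensity r) s t {0} = 0 := by
  rw [hr.jumpMeasure_singleton 0 hs hst]
  simp [hr.zero]

theorem pointIntensity_lt_top (T : ℝ) : pointIntensity r (Ioc 0 T ×ˢ univ) < ∞ := by
  have h : pointIntensity r (Ioc 0 T ×ˢ univ) = jumpMeasure (pointIntensity r) 0 T univ := by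
    rw [jumpMeasure, Measure.map_apply measurable_snd .univ, preimage_univ,
      Measure.restrict_apply_univ]
  rw [h]
  rcases _root_.le_total 0 T with hT | hT
  · rw [hr.jumpMeasure_univ le_rfl hT]
    exact ENNReal.ofReal_lt_top
  · rw [jumpMeasure, Ioc_eq_empty (not_lt.2 hT)]
    simp

theorem isFiniteMeasure_jumpMeasure {s t : ℝ} (hs : 0 ≤ s) :
    IsFiniteMeasure (jumpMeasure (pointIntensity r) s t) :=
  _root_.isFiniteMeasure_jumpMeasure hr.pointIntensity_lt_top hs

end IsRateFamily

/-! ### Laws and increments of additive processes -/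

theorem absolutelyContinuousOnInterval_of_dist_le {f g : ℝ → ℝ} {a b : ℝ}
    (hg : AbsolutelyContinuousOnInterval g a b)
    (h : ∀ x ∈ uIcc a b, ∀ y ∈ uIcc a b, dist (f x) (f y) ≤ dist (g x) (g y)) :
    AbsolutelyContinuousOnInterval f a b := by
  refine squeeze_zero' (Eventually.of_forall fun E => Finset.sum_nonneg fun _ _ => dist_nonneg)
    ?_ hg
  filter_upwards [mem_inf_of_right (mem_principal_self _)] with E hE
  exact Finset.sum_le_sum fun i hi => h _ (hE.1 i hi).1 _ (hE.1 i hi).2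

/-- The increments of `S` over `(s, t]` are compound Poisson with jump measure
`∑ n, (∫_s^t r n) δ_n`. -/
def HasCompoundPoissonIncrements {Ω : Type*} [MeasurableSpace Ω] (P : Measure Ω)
    (S : ℝ≥0 → Ω → ℤ) (r : ℤ → ℝ → ℝ) : Prop :=
  ∀ s t : ℝ≥0, s ≤ t →
    P.map (fun ω => S t ω - S s ω) = compoundPoisson (jumpMeasure (pointIntensity r) s t)

section AdditiveLaw

variable {Ω : Type*} [MeasurableSpace Ω] {P : Measure Ω} [IsProbabilityMeasure P]
  {S : ℝ≥0 → Ω → ℤ}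

/-- The probability `P(S(t + h) - S(t) = n)`. -/
noncomputable def incrLaw (P : Measure Ω) (S : ℝ≥0 → Ω → ℤ) (t h : ℝ≥0) (n : ℤ) : ℝ :=
  P.real ((fun ω => S (t + h) ω - S t ω) ⁻¹' {n})

theorem incrLaw_nonneg (t h : ℝ≥0) (n : ℤ) : 0 ≤ incrLaw P S t h n := measureReal_nonneg

theorem hasSum_measureReal_fiber {T : Ω → ℤ} (hT : Measurable T) (A : Set Ω) :
    HasSum (fun n => P.real (T ⁻¹' {n} ∩ A)) (P.real A) := by
  have h := hasSum_integral_iUnion (μ := P.restrict A) (f := fun _ => (1 : ℝ))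
    (s := fun n : ℤ => T ⁻¹' {n}) (fun n => hT .of_discrete)
    (fun a b hab => Disjoint.preimage _ (by simpa using hab)) (integrable_const _).integrableOn
  refine hasSum_of_eq h (fun n => ?_) ?_
  · rw [setIntegral_const, measureReal_restrict_apply (hT .of_discrete)]; simp
  · have : ⋃ n : ℤ, T ⁻¹' {n} = univ := by ext ω; simp
    rw [this, setIntegral_const, measureReal_restrict_apply .univ]; simp

theorem hasSum_measureReal_fiber_one {T : Ω → ℤ} (hT : Measurable T) :
    HasSum (fun n => P.real (T ⁻¹' {n})) 1 := by
  simpa using hasSum_measureReal_fiber (P := P) hT univ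

variable (hS : IsAdditiveFromZero P S)
include hS

theorem measurable_increment (t h : ℝ≥0) : Measurable fun ω => S (t + h) ω - S t ω :=
  (hS.measurable _).sub (hS.measurable _)

theorem hasSum_incrLaw (t h : ℝ≥0) : HasSum (incrLaw P S t h) 1 :=
  hasSum_measureReal_fiber_one (measurable_increment hS t h)

theorem hasSum_lawOf (t : ℝ) : HasSum (fun n => lawOf P S n t) 1 :=
  hasSum_measureReal_fiber_one (hS.measurable _)

theorem indepFun_increment (t h : ℝ≥0) : S t ⟂ᵢ[P] (fun ω => S (t + h) ω - S t ω) :=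
  hS.indep.indepFun_eval_sub (r := 0) (s := t) (t := t + h) zero_le le_self_add hS.start

theorem measureReal_inter_increment (t h : ℝ≥0) (k n : ℤ) :
    P.real (S t ⁻¹' {k} ∩ S (t + h) ⁻¹' {k + n}) = lawOf P S k t * incrLaw P S t h n := by
  have e : S t ⁻¹' {k} ∩ S (t + h) ⁻¹' {k + n} =
      S t ⁻¹' {k} ∩ (fun ω => S (t + h) ω - S t ω) ⁻¹' {n} := by
    ext ω
    simp only [mem_inter_iff, mem_preimage, mem_singleton_iff]
    constructor <;> rintro ⟨h1, h2⟩ <;> exact ⟨h1, by omega⟩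
  rw [e, measureReal_def, (indepFun_increment hS t h).measure_inter_preimage_eq_mul _ _
    .of_discrete .of_discrete, ENNReal.toReal_mul, lawOf, incrLaw, Real.toNNReal_coe]
  rfl

/-- By independence the conditional probability does not depend on the state `k`, so (2) is a
statement about the increment alone. -/
theorem cond_real_increment (t h : ℝ≥0) {k : ℤ} (hk : P (S t ⁻¹' {k}) ≠ 0) (n : ℤ) :
    (P[|S t ⁻¹' {k}]).real (S (t + h) ⁻¹' {k + n}) = incrLaw P S t h n := by
  have hk' : lawOf P S k t ≠ 0 := by
    rw [lawOf, Real.toNNReal_coe, measureReal_def]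
    exact ENNReal.toReal_ne_zero.2 ⟨hk, measure_ne_top _ _⟩
  rw [measureReal_def, cond_apply (hS.measurable t .of_discrete), ENNReal.toReal_mul,
    ENNReal.toReal_inv, ← measureReal_def, ← measureReal_def, measureReal_inter_increment hS]
  rw [lawOf, Real.toNNReal_coe] at hk' ⊢
  field_simp

/-- Some state is charged at every time, so (2) is never vacuous. -/
theorem exists_lawOf_ne_zero (t : ℝ≥0) : ∃ k : ℤ, P (S t ⁻¹' {k}) ≠ 0 := by
  by_contra h
  push Not at h
  have h1 := hasSum_lawOf hS t
  have h2 : ∀ n, lawOf P S n t = 0 := fun n => by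
    rw [lawOf, Real.toNNReal_coe, measureReal_def, h n]; rfl
  simp only [h2] at h1
  exact one_ne_zero (h1.unique hasSum_zero)

theorem hasSum_lawOf_add (t h : ℝ≥0) (n : ℤ) :
    HasSum (fun k => incrLaw P S t h k * lawOf P S (n - k) t) (lawOf P S n ((t + h : ℝ≥0) : ℝ)) := by
  have h1 := hasSum_measureReal_fiber (P := P) (hS.measurable t) (S (t + h) ⁻¹' {n})
  have h2 := (Equiv.subLeft n).hasSum_iff.2 h1
  refine hasSum_of_eq h2 (fun k => ?_) ?_
  · have h3 := measureReal_inter_increment hS t h (n - k) k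
    rw [sub_add_cancel] at h3
    simp only [Function.comp_apply, Equiv.subLeft_apply]
    rw [h3, mul_comm]
  · rw [lawOf, Real.toNNReal_coe]

theorem lawOf_zero (n : ℤ) : lawOf P S n 0 = if n = 0 then 1 else 0 := by
  rw [lawOf, Real.toNNReal_zero]
  split_ifs with h
  · have e : S 0 ⁻¹' {n} =ᵐ[P] univ := by
      filter_upwards [hS.start] with ω hω
      exact propext ⟨fun _ => trivial, fun _ => hω.trans h.symm⟩
    rw [measureReal_congr e, probReal_univ]
  · have e : S 0 ⁻¹' {n} =ᵐ[P] (∅ : Set Ω) := by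
      filter_upwards [hS.start] with ω hω
      exact propext ⟨fun h' => h (hω.symm.trans h').symm, fun h' => h'.elim⟩
    rw [measureReal_congr e, measureReal_empty]

omit hS in
theorem abs_lawOf_le (n : ℤ) (t : ℝ) : |lawOf P S n t| ≤ 1 := by
  rw [lawOf, abs_of_nonneg measureReal_nonneg]
  exact measureReal_le_one

end AdditiveLaw

/-! ### Infinitesimal behaviour of compound Poisson increments -/

/-- The increments of `S` after time `t` have jump rates `ρ n`, `n ≠ 0`, and total rate `κ`. -/
structure HasIncrementRates {Ω : Type*} [MeasurableSpace Ω] (P : Measure Ω) (S : ℝ≥0 → Ω → ℤ)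
    (t : ℝ≥0) (ρ : ℤ → ℝ) (κ : ℝ) : Prop where
  jump : ∀ n : ℤ, n ≠ 0 →
    (fun h : ℝ≥0 => incrLaw P S t h n - ρ n * h) =o[𝓝[>] 0] (fun h : ℝ≥0 => (h : ℝ))
  stay : (fun h : ℝ≥0 => incrLaw P S t h 0 - (1 - κ * h)) =o[𝓝[>] 0] (fun h : ℝ≥0 => (h : ℝ))

theorem tendsto_coe_add_nhdsWithin (t : ℝ≥0) :
    Tendsto (fun h : ℝ≥0 => ((t + h : ℝ≥0) : ℝ)) (𝓝[>] 0) (𝓝[≥] (t : ℝ)) := by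
  refine tendsto_nhdsWithin_iff.2 ⟨?_, Eventually.of_forall fun h => ?_⟩
  · have : Tendsto (fun h : ℝ≥0 => ((t + h : ℝ≥0) : ℝ)) (𝓝 0) (𝓝 ((t + 0 : ℝ≥0) : ℝ)) :=
      Continuous.tendsto (by fun_prop) 0
    rw [add_zero] at this
    exact this.mono_left nhdsWithin_le_nhds
  · simp

theorem isLittleO_integral_sub {g : ℝ → ℝ} {t : ℝ≥0} {c : ℝ}
    (hg : HasDerivWithinAt (fun u => ∫ v in (t : ℝ)..u, g v) c (Ici t) t) :
    (fun h : ℝ≥0 => (∫ v in (t : ℝ)..((t + h : ℝ≥0) : ℝ), g v) - c * h)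
      =o[𝓝[>] 0] (fun h : ℝ≥0 => (h : ℝ)) := by
  have h1 := (hasDerivWithinAt_iff_isLittleO.1 hg).comp_tendsto (tendsto_coe_add_nhdsWithin t)
  refine h1.congr (fun h => ?_) (fun h => ?_)
  · simp [mul_comm]
  · simp

theorem tendsto_coe_nhdsGT_zero : Tendsto (fun h : ℝ≥0 => (h : ℝ)) (𝓝[>] 0) (𝓝 0) := by
  have : Tendsto (fun h : ℝ≥0 => (h : ℝ)) (𝓝 0) (𝓝 ((0 : ℝ≥0) : ℝ)) :=
    Continuous.tendsto (by fun_prop) 0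
  exact this.mono_left nhdsWithin_le_nhds

section AdditiveLaw

variable {Ω : Type*} [MeasurableSpace Ω] {P : Measure Ω} [IsProbabilityMeasure P]
  {S : ℝ≥0 → Ω → ℤ} (hS : IsAdditiveFromZero P S) {r : ℤ → ℝ → ℝ} {q : ℝ → ℝ}
  (hr : IsRateFamily r q) (hCP : HasCompoundPoissonIncrements P S r)

include hS hCP in
theorem incrLaw_eq_compoundPoisson (t h : ℝ≥0) (n : ℤ) : incrLaw P S t h n =
    (compoundPoisson (jumpMeasure (pointIntensity r) t ((t + h : ℝ≥0) : ℝ))).real {n} := by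
  rw [← hCP t (t + h) le_self_add, map_measureReal_apply (measurable_increment hS t h) .of_discrete]
  rfl

include hS hr hCP

theorem one_sub_incrLaw_zero_le (t h : ℝ≥0) :
    1 - incrLaw P S t h 0 ≤ ∫ v in (t : ℝ)..((t + h : ℝ≥0) : ℝ), q v := by
  have := hr.isFiniteMeasure_jumpMeasure (s := t) (t := (t + h : ℝ≥0)) t.coe_nonneg
  rw [incrLaw_eq_compoundPoisson hS hCP]
  have h1 := one_sub_le_compoundPoisson_real_zero
    (μ := jumpMeasure (pointIntensity r) t ((t + h : ℝ≥0) : ℝ))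
  rw [hr.jumpMeasure_real_univ t.coe_nonneg (by simp)] at h1
  linarith

/-- The events `S(s) = n` and `S(t) = n` can differ only if the increment is nonzero, which has
probability at most `∫_s^t q`. Absolute continuity of the law follows from that of the primitive of
`q`. -/
theorem abs_lawOf_sub_le (n : ℤ) {s t : ℝ} (hs : 0 ≤ s) (hst : s ≤ t) :
    |lawOf P S n t - lawOf P S n s| ≤ ∫ u in s..t, q u := by
  lift s to ℝ≥0 using hs
  lift t to ℝ≥0 using s.2.trans hst
  obtain ⟨h, rfl⟩ := exists_add_of_le (show s ≤ t from hst)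
  refine le_trans ?_ (one_sub_incrLaw_zero_le hS hr hCP s h)
  have hm := measurable_increment hS s h
  rw [incrLaw, ← probReal_compl_eq_one_sub (hm .of_discrete), lawOf, lawOf, Real.toNNReal_coe,
    Real.toNNReal_coe]
  refine (abs_measureReal_sub_le_measureReal_symmDiff
    (hS.measurable _ .of_discrete).nullMeasurableSet
    (hS.measurable _ .of_discrete).nullMeasurableSet).trans (measureReal_mono ?_)
  intro ω hω h0
  have h0 : S (s + h) ω - S s ω = 0 := h0
  have h1 : S (s + h) ω = S s ω := by omega
  simp only [mem_symmDiff, mem_preimage, mem_singleton_iff, h1] at hω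
  tauto

theorem abs_lawOf_sub_le_abs (n : ℤ) {s t : ℝ} (hs : 0 ≤ s) (ht : 0 ≤ t) :
    |lawOf P S n t - lawOf P S n s| ≤ |∫ u in s..t, q u| := by
  rcases le_total s t with h | h
  · exact (abs_lawOf_sub_le hS hr hCP n hs h).trans (le_abs_self _)
  · rw [abs_sub_comm, intervalIntegral.integral_symm, abs_neg]
    exact (abs_lawOf_sub_le hS hr hCP n ht h).trans (le_abs_self _)

theorem absolutelyContinuousOnInterval_lawOf (n : ℤ) {T : ℝ} (hT : 0 ≤ T) :
    AbsolutelyContinuousOnInterval (lawOf P S n) 0 T := by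
  have hq := hr.intervalIntegrable_total 0 T le_rfl hT
  refine absolutelyContinuousOnInterval_of_dist_le
    (hq.absolutelyContinuousOnInterval_intervalIntegral (c := 0) left_mem_uIcc) ?_
  intro x hx y hy
  rw [uIcc_of_le hT] at hx hy
  rw [Real.dist_eq, Real.dist_eq, intervalIntegral.integral_interval_sub_left
    (hr.intervalIntegrable_total 0 x le_rfl hx.1) (hr.intervalIntegrable_total 0 y le_rfl hy.1)]
  exact abs_lawOf_sub_le_abs hS hr hCP n hy.1 hx.1

/-- The first order expansion of the compound Poisson law has error `(∫_t^{t+h} q)^2 = O(h^2)`, and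
the first order terms are differentiated from the right. -/
theorem hasIncrementRates_of_hasDerivWithinAt {t : ℝ≥0}
    (hrt : ∀ n, HasDerivWithinAt (fun u => ∫ v in (t : ℝ)..u, r n v) (r n t) (Ici t) t)
    (hqt : HasDerivWithinAt (fun u => ∫ v in (t : ℝ)..u, q v) (q t) (Ici t) t) :
    HasIncrementRates P S t (fun n => r n t) (q t) := by
  have hq1 := isLittleO_integral_sub hqt
  have hid : (fun h : ℝ≥0 => (h : ℝ)) =O[𝓝[>] 0] (fun h : ℝ≥0 => (h : ℝ)) := isBigO_refl _ _
  have hQ : (fun h : ℝ≥0 => ∫ v in (t : ℝ)..((t + h : ℝ≥0) : ℝ), q v)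
      =O[𝓝[>] 0] (fun h : ℝ≥0 => (h : ℝ)) := by
    have := hq1.isBigO.add (hid.const_mul_left (q t))
    simpa using this
  have hh : (fun h : ℝ≥0 => (h : ℝ)) =o[𝓝[>] 0] (fun _ : ℝ≥0 => (1 : ℝ)) :=
    (isLittleO_one_iff ℝ).2 tendsto_coe_nhdsGT_zero
  have hQ2 : (fun h : ℝ≥0 => (∫ v in (t : ℝ)..((t + h : ℝ≥0) : ℝ), q v) ^ 2)
      =o[𝓝[>] 0] (fun h : ℝ≥0 => (h : ℝ)) := by
    have := (hQ.trans_isLittleO hh).mul_isBigO hQ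
    simpa [sq] using this
  have hfin : ∀ h : ℝ≥0, IsFiniteMeasure
      (jumpMeasure (pointIntensity r) t ((t + h : ℝ≥0) : ℝ)) := fun h =>
    hr.isFiniteMeasure_jumpMeasure t.coe_nonneg
  have hle : ∀ h : ℝ≥0, (t : ℝ) ≤ ((t + h : ℝ≥0) : ℝ) := fun h => by simp
  constructor
  · intro n hn
    have h1 : (fun h : ℝ≥0 => incrLaw P S t h n - ∫ v in (t : ℝ)..((t + h : ℝ≥0) : ℝ), r n v)
        =o[𝓝[>] 0] (fun h : ℝ≥0 => (h : ℝ)) := by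
      refine IsBigO.trans_isLittleO (IsBigO.of_bound 1 (Eventually.of_forall fun h => ?_)) hQ2
      have := hfin h
      have h2 := abs_compoundPoisson_real_singleton_sub_le
        (μ := jumpMeasure (pointIntensity r) t ((t + h : ℝ≥0) : ℝ)) hn
      rw [← incrLaw_eq_compoundPoisson hS hCP, hr.jumpMeasure_real_singleton n t.coe_nonneg (hle h),
        hr.jumpMeasure_real_univ t.coe_nonneg (hle h)] at h2
      rw [Real.norm_eq_abs, Real.norm_eq_abs, one_mul, abs_of_nonneg (sq_nonneg (∫ v in _.._, q v))]
      exact h2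
    refine (h1.add (isLittleO_integral_sub (hrt n))).congr_left fun h => ?_
    ring
  · have h1 : (fun h : ℝ≥0 => incrLaw P S t h 0 -
        (1 - ∫ v in (t : ℝ)..((t + h : ℝ≥0) : ℝ), q v)) =o[𝓝[>] 0] (fun h : ℝ≥0 => (h : ℝ)) := by
      refine IsBigO.trans_isLittleO (IsBigO.of_bound 1 (Eventually.of_forall fun h => ?_)) hQ2
      have := hfin h
      have h2 := abs_compoundPoisson_real_zero_sub_le
        (μ := jumpMeasure (pointIntensity r) t ((t + h : ℝ≥0) : ℝ))
        (hr.jumpMeasure_zero t.coe_nonneg (hle h))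
      rw [← incrLaw_eq_compoundPoisson hS hCP, hr.jumpMeasure_real_univ t.coe_nonneg (hle h)] at h2
      rw [Real.norm_eq_abs, Real.norm_eq_abs, one_mul, abs_of_nonneg (sq_nonneg (∫ v in _.._, q v))]
      exact h2
    refine (h1.sub hq1).congr_left fun h => ?_
    ring

end AdditiveLaw

/-! ### Scheffé's lemma for sums -/

section Scheffe

variable {α ι : Type*} {l : Filter α} {a : α → ι → ℝ} {A : α → ℝ} {b : ι → ℝ} {B : ℝ}

/-- Use `|a - b| = (a - b) + 2 (b - a)^+`: the first part sums to `A - B`, and the positive part is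
dominated by the summable `b`. -/
theorem tendsto_tsum_abs_sub (ha : ∀ᶠ x in l, ∀ i, 0 ≤ a x i) (hA : ∀ᶠ x in l, HasSum (a x) (A x))
    (hb0 : ∀ i, 0 ≤ b i) (hb : HasSum b B) (hlim : ∀ i, Tendsto (fun x => a x i) l (𝓝 (b i)))
    (hAB : Tendsto A l (𝓝 B)) : Tendsto (fun x => ∑' i, |a x i - b i|) l (𝓝 0) := by
  have h1 : Tendsto (fun x => ∑' i, max (b i - a x i) 0) l (𝓝 (∑' _ : ι, 0)) := by
    refine tendsto_tsum_of_dominated_convergence hb.summable (fun i => ?_) ?_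
    · have := ((hlim i).const_sub (b i)).max (tendsto_const_nhds (x := (0 : ℝ)))
      simpa using this
    · filter_upwards [ha] with x hx i
      rw [Real.norm_of_nonneg (le_max_right _ _)]
      exact max_le (by linarith [hx i]) (hb0 i)
  have h2 : Tendsto (fun x => (A x - B) + 2 * ∑' i, max (b i - a x i) 0) l (𝓝 0) := by
    have := (hAB.sub_const B).add (h1.const_mul 2)
    simpa using this
  refine h2.congr' ?_
  filter_upwards [ha, hA] with x hx hAx
  have hs : Summable fun i => max (b i - a x i) 0 :=
    Summable.of_nonneg_of_le (fun i => le_max_right _ _)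
      (fun i => max_le (by linarith [hx i]) (hb0 i)) hb.summable
  refine (HasSum.tsum_eq (hasSum_of_eq ((hAx.sub hb).add (hs.hasSum.mul_left 2)) (fun i => ?_)
    rfl)).symm
  rcases le_total (b i) (a x i) with h | h
  · rw [abs_of_nonneg (by linarith), max_eq_right (by linarith)]; ring
  · rw [abs_of_nonpos (by linarith), max_eq_left (by linarith)]; ring

theorem abs_tsum_mul_sub_le {a b y : ι → ℝ} {C : ℝ} (ha : Summable a) (hb : Summable b)
    (hy : ∀ i, |y i| ≤ C) : |∑' i, a i * y i - ∑' i, b i * y i| ≤ C * ∑' i, |a i - b i| := by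
  have hs : ∀ {c : ι → ℝ}, Summable c → Summable fun i => c i * y i := fun {c} hc => by
    refine Summable.of_norm_bounded (hc.abs.mul_right C) fun i => ?_
    rw [norm_mul, Real.norm_eq_abs, Real.norm_eq_abs]
    exact mul_le_mul_of_nonneg_left (hy i) (abs_nonneg _)
  rw [← (hs ha).tsum_sub (hs hb), ← tsum_mul_left, ← Real.norm_eq_abs]
  refine tsum_of_norm_bounded ((ha.sub hb).abs.mul_left C).hasSum fun i => ?_
  rw [← sub_mul, norm_mul, Real.norm_eq_abs, Real.norm_eq_abs, mul_comm]
  exact mul_le_mul_of_nonneg_right (hy i) (abs_nonneg _)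

theorem tendsto_tsum_mul (ha : ∀ᶠ x in l, ∀ i, 0 ≤ a x i) (hA : ∀ᶠ x in l, HasSum (a x) (A x))
    (hb0 : ∀ i, 0 ≤ b i) (hb : HasSum b B) (hlim : ∀ i, Tendsto (fun x => a x i) l (𝓝 (b i)))
    (hAB : Tendsto A l (𝓝 B)) {y : ι → ℝ} {C : ℝ} (hy : ∀ i, |y i| ≤ C) :
    Tendsto (fun x => ∑' i, a x i * y i) l (𝓝 (∑' i, b i * y i)) := by
  rw [tendsto_iff_norm_sub_tendsto_zero]
  have h := (tendsto_tsum_abs_sub ha hA hb0 hb hlim hAB).const_mul C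
  rw [mul_zero] at h
  refine squeeze_zero' (Eventually.of_forall fun _ => norm_nonneg _) ?_ h
  filter_upwards [hA] with x hx
  exact abs_tsum_mul_sub_le hx.summable hb.summable hy

end Scheffe

/-! ### From infinitesimal behaviour to right derivatives of the law -/

section AdditiveLaw

variable {Ω : Type*} [MeasurableSpace Ω] {P : Measure Ω} [IsProbabilityMeasure P]
  {S : ℝ≥0 → Ω → ℤ} (hS : IsAdditiveFromZero P S)
include hS

/-- Condition on the increment and let `h ↓ 0` under the sum. No uniformity in the jump size is
assumed: the probability of staying supplies convergence of the total rate, and Scheffé does the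
rest. -/
theorem HasIncrementRates.tendsto_slope {t : ℝ≥0} {ρ : ℤ → ℝ} {κ : ℝ}
    (h : HasIncrementRates P S t ρ κ) (hρ0 : ρ 0 = 0) (hρ : ∀ n, 0 ≤ ρ n) (hκ : HasSum ρ κ) (n : ℤ) :
    Tendsto (fun h : ℝ≥0 => (h : ℝ)⁻¹ * (lawOf P S n ((t + h : ℝ≥0) : ℝ) - lawOf P S n t))
      (𝓝[>] 0) (𝓝 (∑' k, ρ k * (lawOf P S (n - k) t - lawOf P S n t))) := by
  -- The term `k = 0` would blow up like `1/h`; it may be dropped because it multiplies `p_n - p_n =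
  -- 0`.
  let a : ℝ≥0 → ℤ → ℝ := fun h k => if k = 0 then 0 else incrLaw P S t h k / h
  have hpos : ∀ᶠ h : ℝ≥0 in 𝓝[>] 0, (0 : ℝ) < h := by
    filter_upwards [self_mem_nhdsWithin] with h hh using hh
  have hsum : ∀ h : ℝ≥0, HasSum (a h) ((1 - incrLaw P S t h 0) / h) := fun h => by
    have h1 := ((hasSum_incrLaw hS t h).sub (hasSum_ite_eq (0 : ℤ) (incrLaw P S t h 0))).div_const
      (h : ℝ)
    refine hasSum_of_eq h1 (fun k => ?_) rfl
    by_cases hk : k = 0 <;> simp [a, hk]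
  have hlim : ∀ k, Tendsto (fun h => a h k) (𝓝[>] 0) (𝓝 (ρ k)) := fun k => by
    by_cases hk : k = 0
    · simp [a, hk, hρ0]
    · have h1 := (h.jump k hk).tendsto_div_nhds_zero.add_const (ρ k)
      rw [zero_add] at h1
      refine h1.congr' ?_
      filter_upwards [hpos] with x hx
      simp only [a, hk, if_false]
      field_simp
      ring
  have htot : Tendsto (fun h : ℝ≥0 => (1 - incrLaw P S t h 0) / h) (𝓝[>] 0) (𝓝 κ) := by
    have h1 := h.stay.tendsto_div_nhds_zero.const_sub κ
    rw [sub_zero] at h1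
    refine h1.congr' ?_
    filter_upwards [hpos] with x hx
    field_simp
    ring
  have hy : ∀ k, |lawOf P S (n - k) t - lawOf P S n t| ≤ 2 := fun k => by
    refine (abs_sub _ _).trans ?_
    linarith [abs_lawOf_le (P := P) (S := S) (n - k) t, abs_lawOf_le (P := P) (S := S) n t]
  refine (tendsto_tsum_mul (Eventually.of_forall fun h k => ?_) (Eventually.of_forall hsum) hρ hκ
    hlim htot hy).congr' ?_
  · simp only [a]
    split_ifs
    · exact le_rfl
    · exact div_nonneg (incrLaw_nonneg _ _ _) h.coe_nonneg
  · filter_upwards [hpos] with x hx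
    have h1 := ((hasSum_lawOf_add hS t x n).sub
      ((hasSum_incrLaw hS t x).mul_right (lawOf P S n t))).mul_left ((x : ℝ)⁻¹)
    refine HasSum.tsum_eq (hasSum_of_eq h1 (fun k => ?_) (by ring))
    by_cases hk : k = 0
    · simp [a, hk]
    · simp only [a, hk, if_false]
      ring

theorem HasIncrementRates.hasDerivWithinAt {t : ℝ≥0} {ρ : ℤ → ℝ} {κ : ℝ}
    (h : HasIncrementRates P S t ρ κ) (hρ0 : ρ 0 = 0) (hρ : ∀ n, 0 ≤ ρ n) (hκ : HasSum ρ κ) (n : ℤ) :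
    HasDerivWithinAt (lawOf P S n) (∑' k, ρ k * (lawOf P S (n - k) t - lawOf P S n t))
      (Ioi t) t := by
  rw [hasDerivWithinAt_iff_tendsto_slope' self_notMem_Ioi]
  have h1 : Tendsto (fun u : ℝ => (u - t).toNNReal) (𝓝[>] (t : ℝ)) (𝓝[>] 0) := by
    refine tendsto_nhdsWithin_iff.2 ⟨?_, ?_⟩
    · have : Tendsto (fun u : ℝ => (u - t).toNNReal) (𝓝 (t : ℝ)) (𝓝 ((t - t : ℝ).toNNReal)) :=
        Continuous.tendsto (by fun_prop) _
      rw [sub_self, Real.toNNReal_zero] at this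
      exact this.mono_left nhdsWithin_le_nhds
    · filter_upwards [self_mem_nhdsWithin] with u hu
      exact Real.toNNReal_pos.2 (sub_pos.2 hu)
  refine ((h.tendsto_slope hS hρ0 hρ hκ n).comp h1).congr' ?_
  filter_upwards [self_mem_nhdsWithin] with u hu
  have hu : (t : ℝ) < u := hu
  have e : (((u - t).toNNReal : ℝ≥0) : ℝ) = u - t := Real.coe_toNNReal _ (by linarith)
  simp only [Function.comp_apply]
  rw [slope_def_field, NNReal.coe_add, e, add_sub_cancel, inv_mul_eq_div]

end AdditiveLaw

/-! ### Uniqueness by Picard iteration -/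

section Uniqueness

/-- For a merely integrable `g` the chain rule holds only almost everywhere; powers of its primitive
are absolutely continuous, so the fundamental theorem still applies. -/
theorem integral_mul_pow_primitive {g : ℝ → ℝ} {T : ℝ}
    (hg : IntervalIntegrable g volume 0 T) (m : ℕ) {t : ℝ} (ht : t ∈ uIcc 0 T) :
    IntervalIntegrable (fun s => g s * (∫ u in (0 : ℝ)..s, g u) ^ m) volume 0 t ∧
    ∫ s in (0 : ℝ)..t, g s * (∫ u in (0 : ℝ)..s, g u) ^ m =
      (∫ u in (0 : ℝ)..t, g u) ^ (m + 1) / (m + 1) := by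
  have hsub : uIcc 0 t ⊆ uIcc 0 T := uIcc_subset_uIcc_left ht
  have hgt : IntervalIntegrable g volume 0 t := hg.mono_set hsub
  have hac := hgt.absolutelyContinuousOnInterval_intervalIntegral (c := 0) left_mem_uIcc
  have hpow : ∀ m : ℕ, AbsolutelyContinuousOnInterval
      (fun s => (∫ u in (0 : ℝ)..s, g u) ^ (m + 1)) 0 t := fun m => by
    induction m with
    | zero => simpa using hac
    | succ m ih => simpa only [pow_succ _ (m + 1)] using ih.fun_mul hac
  refine ⟨hgt.mul_continuousOn (hac.continuousOn.pow m), ?_⟩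
  have h1 := (hpow m).integral_deriv_eq_sub
  have h2 : ∫ s in (0 : ℝ)..t, deriv (fun s => (∫ u in (0 : ℝ)..s, g u) ^ (m + 1)) s =
      ∫ s in (0 : ℝ)..t, (m + 1) * (g s * (∫ u in (0 : ℝ)..s, g u) ^ m) := by
    refine intervalIntegral.integral_congr_ae ?_
    filter_upwards [hgt.ae_hasDerivAt_integral] with s hs hs'
    have h3 := (hs (uIoc_subset_uIcc hs') 0 left_mem_uIcc).fun_pow (m + 1)
    rw [h3.deriv]
    push_cast
    ring
  rw [h2, intervalIntegral.integral_const_mul, intervalIntegral.integral_same,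
    zero_pow (Nat.succ_ne_zero m), sub_zero] at h1
  have : (m + 1 : ℝ) ≠ 0 := by positivity
  field_simp
  linarith

/-- Integrating the derivative bound repeatedly gives `C (∫ c)^m / m!` for all `m`, which tends to
`0`. Each iterate is an explicit function of time, so the supremum over `n` never has to be
measurable. -/
theorem eq_zero_of_abs_deriv_le {ι : Type*} {d : ι → ℝ → ℝ} {g : ι → ℝ → ℝ} {c : ℝ → ℝ} {T C : ℝ}
    (hT : 0 ≤ T) (hc : IntervalIntegrable c volume 0 T)
    (hd : ∀ n, AbsolutelyContinuousOnInterval (d n) 0 T) (hd0 : ∀ n, d n 0 = 0)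
    (hC : ∀ n, ∀ t ∈ Icc 0 T, |d n t| ≤ C)
    (hderiv : ∀ n, ∀ᵐ t, t ∈ Ioc 0 T → HasDerivAt (d n) (g n t) t)
    (hg : ∀ t ∈ Icc 0 T, ∀ b : ℝ, (∀ n, |d n t| ≤ b) → ∀ n, |g n t| ≤ c t * b) (n : ι) :
    d n T = 0 := by
  have key : ∀ m : ℕ, ∀ n, ∀ t ∈ Icc 0 T, |d n t| ≤ C * ((∫ u in (0 : ℝ)..t, c u) ^ m / m.factorial) := by
    intro m
    induction m with
    | zero => simpa using hC
    | succ m ih =>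
      intro n t ht
      have htT : t ∈ uIcc 0 T := by rwa [uIcc_of_le hT]
      obtain ⟨hi, he⟩ := integral_mul_pow_primitive hc m htT
      have h1 := ((hd n).mono (uIcc_subset_uIcc_left htT)).integral_deriv_eq_sub
      rw [hd0, sub_zero] at h1
      rw [← h1, ← Real.norm_eq_abs]
      have h2 : ∫ s in (0 : ℝ)..t, C / m.factorial * (c s * (∫ u in (0 : ℝ)..s, c u) ^ m) =
          C * ((∫ u in (0 : ℝ)..t, c u) ^ (m + 1) / (m + 1).factorial) := by
        rw [intervalIntegral.integral_const_mul, he, Nat.factorial_succ]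
        push_cast
        field_simp
      rw [← h2]
      refine intervalIntegral.norm_integral_le_of_norm_le ht.1 ?_ (hi.const_mul _)
      filter_upwards [hderiv n] with s hs hs'
      have hsT : s ∈ Ioc 0 T := ⟨hs'.1, hs'.2.trans ht.2⟩
      rw [(hs hsT).deriv, Real.norm_eq_abs]
      refine (hg s (Ioc_subset_Icc_self hsT) _ (fun k => ih k s (Ioc_subset_Icc_self hsT)) n).trans
        (le_of_eq ?_)
      ring
  have hlim := (FloorSemiring.tendsto_pow_div_factorial_atTop (∫ u in (0 : ℝ)..T, c u)).const_mul C
  rw [mul_zero] at hlim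
  have h0 := ge_of_tendsto' hlim fun m => key m n T ⟨hT, le_rfl⟩
  exact abs_nonpos_iff.1 h0

end Uniqueness

/-! ### One-dimensional laws determine the increments -/

section Determined

variable {Ω : Type*} [MeasurableSpace Ω] {P : Measure Ω} [IsProbabilityMeasure P]
  {S : ℝ≥0 → Ω → ℤ} (hS : IsAdditiveFromZero P S)
include hS

theorem integral_exp_law_add (t h : ℝ≥0) (θ : ℝ) :
    ∫ m, Complex.exp ((m : ℂ) * θ * Complex.I) ∂(P.map (S (t + h))) =
      (∫ m, Complex.exp ((m : ℂ) * θ * Complex.I) ∂(P.map (S t))) *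
        ∫ m, Complex.exp ((m : ℂ) * θ * Complex.I) ∂(P.map fun ω => S (t + h) ω - S t ω) := by
  have hm := measurable_increment hS t h
  rw [integral_map (hS.measurable _).aemeasurable .of_discrete,
    integral_map (hS.measurable _).aemeasurable .of_discrete,
    integral_map hm.aemeasurable .of_discrete]
  refine Eq.trans ?_ ((indepFun_increment hS t h).integral_fun_comp_mul_comp
    (f := fun m : ℤ => Complex.exp ((m : ℂ) * θ * Complex.I))
    (g := fun m : ℤ => Complex.exp ((m : ℂ) * θ * Complex.I)) (hS.measurable t).aemeasurable
    hm.aemeasurable .of_discrete .of_discrete)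
  congr 1
  ext ω
  rw [← Complex.exp_add]
  congr 1
  push_cast
  ring

theorem map_sub_zero_eq (t : ℝ≥0) : P.map (fun ω => S t ω - S 0 ω) = P.map (S t) := by
  refine Measure.map_congr ?_
  filter_upwards [hS.start] with ω hω
  rw [hω, sub_zero]

theorem HasCompoundPoissonIncrements.map_eq {r : ℤ → ℝ → ℝ}
    (hCP : HasCompoundPoissonIncrements P S r) (t : ℝ≥0) :
    P.map (S t) = compoundPoisson (jumpMeasure (pointIntensity r) 0 t) := by
  rw [← map_sub_zero_eq hS, hCP 0 t zero_le, NNReal.coe_zero]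

/-- The characteristic function at the later time is that at `s` times that of the increment. The
factor at `s` is an exponential, hence nonzero, and can be cancelled. -/
theorem hasCompoundPoissonIncrements_of_lawOf_eq {Ω' : Type*} [MeasurableSpace Ω'] {P' : Measure Ω'}
    [IsProbabilityMeasure P'] {S' : ℝ≥0 → Ω' → ℤ} (hS' : IsAdditiveFromZero P' S')
    {r : ℤ → ℝ → ℝ} {q : ℝ → ℝ} (hr : IsRateFamily r q)
    (hCP : HasCompoundPoissonIncrements P' S' r)
    (h : ∀ (n : ℤ) (t : ℝ), 0 ≤ t → lawOf P S n t = lawOf P' S' n t) :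
    HasCompoundPoissonIncrements P S r := by
  have hmap : ∀ t : ℝ≥0, P.map (S t) = P'.map (S' t) := fun t => by
    refine Measure.ext_of_singleton fun n => ?_
    have h1 := h n t t.coe_nonneg
    rw [lawOf, lawOf, Real.toNNReal_coe, measureReal_def, measureReal_def,
      ENNReal.toReal_eq_toReal_iff' (measure_ne_top _ _) (measure_ne_top _ _)] at h1
    rw [Measure.map_apply (hS.measurable t) .of_discrete,
      Measure.map_apply (hS'.measurable t) .of_discrete, h1]
  intro s t hst
  obtain ⟨u, rfl⟩ := exists_add_of_le hst
  rw [← hCP s (s + u) hst]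
  have := Measure.isProbabilityMeasure_map (μ := P) (measurable_increment hS s u).aemeasurable
  have := Measure.isProbabilityMeasure_map (μ := P') (measurable_increment hS' s u).aemeasurable
  refine measure_int_ext_of_integral_exp fun θ => ?_
  have h1 := integral_exp_law_add hS s u θ
  rw [hmap, hmap, integral_exp_law_add hS' s u θ, hCP.map_eq hS' s] at h1
  have := hr.isFiniteMeasure_jumpMeasure (s := 0) (t := s) le_rfl
  rw [integral_exp_compoundPoisson] at h1
  exact (mul_left_cancel₀ (Complex.exp_ne_zero _) h1).symm

end Determined

/-! ### Equivalence of the equation and the infinitesimal description -/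

section Skellam

variable {I : Finset ℤ} (hI : (0 : ℤ) ∉ I) {lam : ℤ → ℝ → ℝ}
  (hlam_nonneg : ∀ i ∈ I, ∀ t : ℝ, 0 ≤ t → 0 ≤ lam i t)
  (hlam_int : ∀ i ∈ I, LocallyIntegrableOn (lam i) (Ici (0 : ℝ)))
  {f : ℤ → ℝ → ℝ} {ν : ℤ → Measure ℝ} (hf : ∀ i ∈ I, IsBernstein (f i) 0 0 (ν i))

theorem IsBernstein.eq_bernsteinFun {f : ℝ → ℝ} {ν : Measure ℝ} (hf : IsBernstein f 0 0 ν) {x : ℝ}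
    (hx : 0 ≤ x) : f x = bernsteinFun ν x := by
  rw [hf.repr x hx, bernsteinFun]; ring

include hlam_nonneg hf in
theorem sum_bernstein_eq {t : ℝ} (ht : 0 ≤ t) :
    ∑ i ∈ I, f i (lam i t) = ∑ i ∈ I, bernsteinFun (ν i) (lam i t) :=
  Finset.sum_congr rfl fun i hi => (hf i hi).eq_bernsteinFun (hlam_nonneg i hi t ht)

theorem jumpRate_eq_zero (lam : ℤ → ℝ → ℝ) (ν : ℤ → Measure ℝ) (t : ℝ) {n : ℤ}
    (h : ¬ ∃ i ∈ I, ∃ m : ℕ, 1 ≤ m ∧ (m : ℤ) * i = n) : jumpRate I lam ν t n = 0 := by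
  refine Finset.sum_eq_zero fun i hi => Finset.sum_eq_zero fun m hm => absurd ?_ h
  simp only [Finset.mem_filter, Finset.mem_Icc] at hm
  exact ⟨i, hi, m, hm.1.1, hm.2⟩

include hI hlam_nonneg hlam_int hf

theorem isRateFamily_of_isBernstein : IsRateFamily (fun n t => jumpRate I lam ν t n)
    (fun t => ∑ i ∈ I, bernsteinFun (ν i) (lam i t)) :=
  isRateFamily_jumpRate hI hlam_nonneg (fun i hi => (hf i hi).levy) hlam_int

/-- Each difference `x_{n-k} - x_n` is at most twice the sup norm and the rates sum to `q`, hence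
the constant `2q` in the iteration. -/
theorem IsSolution.unique {p p' : ℤ → ℝ → ℝ} (hp : IsSolution I lam ν p)
    (hp' : IsSolution I lam ν p') (n : ℤ) {t : ℝ} (ht : 0 ≤ t) : p n t = p' n t := by
  have hr := isRateFamily_of_isBernstein hI hlam_nonneg hlam_int hf
  obtain ⟨C, hC⟩ := hp.bounded t
  obtain ⟨C', hC'⟩ := hp'.bounded t
  have h := eq_zero_of_abs_deriv_le (d := fun n s => p n s - p' n s)
    (g := fun n s => genRHS I lam ν s (fun k => p k s) n - genRHS I lam ν s (fun k => p' k s) n)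
    (c := fun s => (∑ i ∈ I, bernsteinFun (ν i) (lam i s)) * 2) (C := C + C') ht
    ((hr.intervalIntegrable_total 0 t le_rfl ht).mul_const 2)
    (fun n => (hp.abs_cont n t ht).sub (hp'.abs_cont n t ht))
    (fun n => by rw [hp.init, hp'.init, sub_self])
    (fun n s hs => (abs_sub _ _).trans (add_le_add (hC n s hs) (hC' n s hs))) ?_ ?_ n
  · exact sub_eq_zero.1 h
  · intro n
    have h1 := ae_imp_of_ae_restrict hp.eqn
    have h2 := ae_imp_of_ae_restrict hp'.eqn
    filter_upwards [h1, h2] with s hs hs' hst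
    exact (hs hst.1.le n).sub (hs' hst.1.le n)
  · intro s hs b hb n
    have h1 := hasSum_genRHS hlam_nonneg (fun i hi => (hf i hi).levy) hI hs.1
      (x := fun k => p k s) (fun k => hC k s hs) n
    have h2 := hasSum_genRHS hlam_nonneg (fun i hi => (hf i hi).levy) hI hs.1
      (x := fun k => p' k s) (fun k => hC' k s hs) n
    rw [← (h1.sub h2).tsum_eq, ← Real.norm_eq_abs]
    refine tsum_of_norm_bounded (g := fun k => jumpRate I lam ν s k * (2 * b)) ?_ fun k => ?_
    · exact hasSum_of_eq ((hr.hasSum s hs.1).mul_right (2 * b)) (fun _ => rfl) (by ring)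
    · rw [← mul_sub, norm_mul, Real.norm_of_nonneg (hr.nonneg k s hs.1)]
      refine mul_le_mul_of_nonneg_left ?_ (hr.nonneg k s hs.1)
      have h3 := abs_le.1 (hb (n - k))
      have h4 := abs_le.1 (hb n)
      rw [Real.norm_eq_abs, abs_le]
      constructor <;> linarith [h3.1, h3.2, h4.1, h4.2]

section AdditiveLaw

variable {Ω : Type*} [MeasurableSpace Ω] {P : Measure Ω} [IsProbabilityMeasure P]
  {S : ℝ≥0 → Ω → ℤ} (hS : IsAdditiveFromZero P S)
include hS

/-- The first and third cases of (2) merge because the rate vanishes off the positive multiples of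
elements of `I`; these multiples are nonzero since `0 ∉ I`. -/
theorem hasInfinitesimalAt_iff (t : ℝ≥0) : HasInfinitesimalAt I lam f ν P S t ↔
    HasIncrementRates P S t (fun n => jumpRate I lam ν t n)
      (∑ i ∈ I, bernsteinFun (ν i) (lam i t)) := by
  rw [← sum_bernstein_eq hlam_nonneg hf t.coe_nonneg]
  constructor
  · intro h
    obtain ⟨k, hk⟩ := exists_lawOf_ne_zero hS t
    constructor
    · intro n hn
      by_cases hm : ∃ i ∈ I, ∃ m : ℕ, 1 ≤ m ∧ (m : ℤ) * i = n
      · simpa only [cond_real_increment hS t _ hk] using h.jump k hk n hm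
      · simpa only [cond_real_increment hS t _ hk, jumpRate_eq_zero lam ν t hm, zero_mul, sub_zero]
          using h.other k hk n hn hm
    · have h1 := h.stay k hk
      have h2 := fun x => cond_real_increment hS t x hk 0
      simp only [add_zero] at h2
      simpa only [h2] using h1
  · intro h
    refine ⟨fun k hk n hm => ?_, fun k hk => ?_, fun k hk n hn hm => ?_⟩
    · simp only [cond_real_increment hS t _ hk]
      obtain ⟨i, hi, m, hm1, rfl⟩ := hm
      refine h.jump _ (mul_ne_zero (by omega) fun h0 => hI (h0 ▸ hi))
    · have h2 := fun x => cond_real_increment hS t x hk 0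
      simp only [add_zero] at h2
      simpa only [h2] using h.stay
    · simpa only [cond_real_increment hS t _ hk, jumpRate_eq_zero lam ν t hm, zero_mul, sub_zero]
        using h.jump n hn

theorem HasInfinitesimalAt.hasDerivWithinAt_lawOf {t : ℝ≥0}
    (h : HasInfinitesimalAt I lam f ν P S t) (n : ℤ) :
    HasDerivWithinAt (lawOf P S n) (genRHS I lam ν t (fun k => lawOf P S k t) n) (Ioi t) t := by
  have hr := isRateFamily_of_isBernstein hI hlam_nonneg hlam_int hf
  rw [← (hasSum_genRHS hlam_nonneg (fun i hi => (hf i hi).levy) hI t.coe_nonneg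
    (fun k => abs_lawOf_le k t) n).tsum_eq]
  exact ((hasInfinitesimalAt_iff hI hlam_nonneg hlam_int hf hS t).1 h).hasDerivWithinAt hS
    (hr.zero t) (fun n => hr.nonneg n t t.coe_nonneg) (hr.hasSum t t.coe_nonneg) n

/-- Almost everywhere absolute continuity provides a two-sided derivative, which must agree with the
right derivative obtained from (2). -/
theorem isSolution_of_hasInfinitesimalAt
    (hac : ∀ n : ℤ, ∀ T : ℝ, 0 ≤ T → AbsolutelyContinuousOnInterval (lawOf P S n) 0 T)
    (hinf : ∀ᵐ t ∂(volume.restrict (Ici (0 : ℝ))), HasInfinitesimalAt I lam f ν P S t.toNNReal) :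
    IsSolution I lam ν (lawOf P S) where
  bounded _ := ⟨1, fun n t _ => abs_lawOf_le n t⟩
  abs_cont := hac
  init := lawOf_zero hS
  eqn := by
    have hdiff : ∀ᵐ t : ℝ, ∀ (n : ℤ) (N : ℕ), t ∈ uIcc 0 (N : ℝ) →
        DifferentiableAt ℝ (lawOf P S n) t :=
      ae_all_iff.2 fun n => ae_all_iff.2 fun N => (hac n N (by positivity)).ae_differentiableAt
    filter_upwards [hinf, ae_restrict_of_ae hdiff, ae_restrict_mem measurableSet_Ici] with t h1 h2
      ht n
    have ht : (0 : ℝ) ≤ t := ht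
    obtain ⟨N, hN⟩ := exists_nat_ge t
    have h3 := (h2 n N (by rw [uIcc_of_le (ht.trans hN)]; exact ⟨ht, hN⟩)).hasDerivAt
    have h4 := h1.hasDerivWithinAt_lawOf hI hlam_nonneg hlam_int hf hS n
    rw [Real.coe_toNNReal t ht] at h4
    rw [← (uniqueDiffWithinAt_Ioi t).eq_deriv _ h3.hasDerivWithinAt h4]
    exact h3

/-- Lebesgue differentiation of the primitives of `q` and of the countably many rates, on the
intervals `[0, N]`, gives one null set outside which (2) holds. -/
theorem HasCompoundPoissonIncrements.isBernsteinSkellam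
    (hCP : HasCompoundPoissonIncrements P S fun n t => jumpRate I lam ν t n) :
    IsBernsteinSkellam I lam f ν P S where
  additive := hS
  abs_cont n T hT := absolutelyContinuousOnInterval_lawOf hS
    (isRateFamily_of_isBernstein hI hlam_nonneg hlam_int hf) hCP n hT
  infinitesimal := by
    have hr := isRateFamily_of_isBernstein hI hlam_nonneg hlam_int hf
    have hrd : ∀ᵐ t : ℝ, ∀ (n : ℤ) (N : ℕ), t ∈ uIcc 0 (N : ℝ) → ∀ c ∈ uIcc 0 (N : ℝ),
        HasDerivAt (fun u => ∫ v in c..u, jumpRate I lam ν v n) (jumpRate I lam ν t n) t :=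
      ae_all_iff.2 fun n => ae_all_iff.2 fun N =>
        (hr.intervalIntegrable n le_rfl (by positivity)).ae_hasDerivAt_integral
    have hqd : ∀ᵐ t : ℝ, ∀ (N : ℕ), t ∈ uIcc 0 (N : ℝ) → ∀ c ∈ uIcc 0 (N : ℝ),
        HasDerivAt (fun u => ∫ v in c..u, ∑ i ∈ I, bernsteinFun (ν i) (lam i v))
          (∑ i ∈ I, bernsteinFun (ν i) (lam i t)) t :=
      ae_all_iff.2 fun N =>
        (hr.intervalIntegrable_total 0 N le_rfl (by positivity)).ae_hasDerivAt_integral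
    filter_upwards [ae_restrict_of_ae hrd, ae_restrict_of_ae hqd,
      ae_restrict_mem measurableSet_Ici] with t h1 h2 ht
    have ht : (0 : ℝ) ≤ t := ht
    obtain ⟨N, hN⟩ := exists_nat_ge t
    have htN : t ∈ uIcc 0 (N : ℝ) := by rw [uIcc_of_le (ht.trans hN)]; exact ⟨ht, hN⟩
    lift t to ℝ≥0 using ht
    rw [Real.toNNReal_coe, hasInfinitesimalAt_iff hI hlam_nonneg hlam_int hf hS]
    exact hasIncrementRates_of_hasDerivWithinAt hS hr hCP
      (fun n => (h1 n N htN t htN).hasDerivWithinAt) (h2 N htN t htN).hasDerivWithinAt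

end AdditiveLaw

theorem exists_isBernsteinSkellam : ∃ (Ω : Type) (_ : MeasurableSpace Ω) (P : Measure Ω)
    (S : ℝ≥0 → Ω → ℤ), IsProbabilityMeasure P ∧ IsBernsteinSkellam I lam f ν P S ∧
      HasCompoundPoissonIncrements P S fun n t => jumpRate I lam ν t n := by
  have hr := isRateFamily_of_isBernstein hI hlam_nonneg hlam_int hf
  obtain ⟨P, hP, hS, hCP⟩ := exists_additive_process hr.pointIntensity_lt_top
  exact ⟨_, _, P, sumOfJumps, hP,
    HasCompoundPoissonIncrements.isBernsteinSkellam hI hlam_nonneg hlam_int hf hS hCP, hCP⟩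

section AdditiveLaw

variable {Ω : Type*} [MeasurableSpace Ω] {P : Measure Ω} [IsProbabilityMeasure P]
  {S : ℝ≥0 → Ω → ℤ}

theorem IsBernsteinSkellam.isSolution (h : IsBernsteinSkellam I lam f ν P S) :
    IsSolution I lam ν (lawOf P S) :=
  isSolution_of_hasInfinitesimalAt hI hlam_nonneg hlam_int hf h.additive h.abs_cont h.infinitesimal

/-- The constructed process also solves (1), so uniqueness gives equal laws at all times, and these
determine the increments. -/
theorem IsSolution.hasCompoundPoissonIncrements (hS : IsAdditiveFromZero P S)
    (h : IsSolution I lam ν (lawOf P S)) :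
    HasCompoundPoissonIncrements P S fun n t => jumpRate I lam ν t n := by
  obtain ⟨Ω', _, P', S', hP', hS', hCP'⟩ :=
    exists_isBernsteinSkellam hI hlam_nonneg hlam_int hf
  refine hasCompoundPoissonIncrements_of_lawOf_eq hS hS'.additive
    (isRateFamily_of_isBernstein hI hlam_nonneg hlam_int hf) hCP' fun n t ht => ?_
  exact h.unique hI hlam_nonneg hlam_int hf
    (hS'.isSolution hI hlam_nonneg hlam_int hf) n ht

theorem isSolution_iff_isBernsteinSkellam (hS : IsAdditiveFromZero P S) :
    IsSolution I lam ν (lawOf P S) ↔ IsBernsteinSkellam I lam f ν P S :=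
  ⟨fun h => HasCompoundPoissonIncrements.isBernsteinSkellam hI hlam_nonneg hlam_int hf hS
    (h.hasCompoundPoissonIncrements hI hlam_nonneg hlam_int hf hS),
    fun h => h.isSolution hI hlam_nonneg hlam_int hf⟩

end AdditiveLaw

end Skellam

/-! ### Statements at individual times under continuity of the rates -/

theorem hasDerivWithinAt_integral_Ici {g : ℝ → ℝ} {t : ℝ} (ht : 0 ≤ t)
    (hg : AEStronglyMeasurable g (volume.restrict (Ici (0 : ℝ)))) (hc : ContinuousWithinAt g (Ici t) t) :
    HasDerivWithinAt (fun u => ∫ v in t..u, g v) (g t) (Ici t) t := by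
  refine intervalIntegral.integral_hasDerivWithinAt_right (t := Ioi t)
    IntervalIntegrable.refl ?_ (hc.mono Ioi_subset_Ici_self)
  exact ⟨Ioi t, self_mem_nhdsWithin, hg.mono_measure
    (Measure.restrict_mono (fun u hu => ht.trans (le_of_lt hu)) le_rfl)⟩

theorem Icc_add_one_mem_nhdsWithin {t : ℝ} : Icc 0 (t + 1) ∈ 𝓝[Ici (0 : ℝ)] t := by
  have h : Iic (t + 1) ∈ 𝓝 t := Iic_mem_nhds (by linarith)
  rw [← Ici_inter_Iic]
  exact inter_mem self_mem_nhdsWithin (mem_nhdsWithin_of_mem_nhds h)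

theorem hasDerivWithinAt_of_eq_integral {p g : ℝ → ℝ} {t : ℝ} (ht : 0 ≤ t)
    (hi : IntervalIntegrable g volume 0 (t + 1)) (hc : ContinuousWithinAt g (Ici 0) t)
    (hp : ∀ u ∈ Icc 0 (t + 1), p u = p 0 + ∫ v in (0 : ℝ)..u, g v) :
    HasDerivWithinAt p (g t) (Ici 0) t := by
  -- The interval reaches beyond `t`, so it is a neighbourhood of `t` within `[0, ∞)`; `t = 0` is
  -- thereby covered one-sidedly.
  have : Fact (t ∈ Icc 0 (t + 1)) := ⟨ht, by linarith⟩
  have hm : IntegrableOn g (Icc 0 (t + 1)) := by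
    rw [integrableOn_Icc_iff_integrableOn_Ioc]
    exact (intervalIntegrable_iff_integrableOn_Ioc_of_le (by linarith)).1 hi
  have h1 : HasDerivWithinAt (fun u => ∫ v in (0 : ℝ)..u, g v) (g t) (Icc 0 (t + 1)) t := by
    refine intervalIntegral.integral_hasDerivWithinAt_right (hi.mono_set ?_) ?_
      (hc.mono Icc_subset_Ici_self)
    · rw [uIcc_of_le ht, uIcc_of_le (by linarith)]
      exact Icc_subset_Icc_right (by linarith)
    · exact ⟨Icc 0 (t + 1), self_mem_nhdsWithin, hm.aestronglyMeasurable⟩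
  exact ((h1.const_add (p 0)).congr hp (hp t ⟨ht, by linarith⟩)).mono_of_mem_nhdsWithin
    Icc_add_one_mem_nhdsWithin

/-- The right-hand side of the equation is continuous wherever the rates and the (bounded)
solution are. -/
theorem IsRateFamily.continuousWithinAt_tsum {r : ℤ → ℝ → ℝ} {q : ℝ → ℝ} (hr : IsRateFamily r q)
    {s : Set ℝ} (hs : s ⊆ Ici 0) {t : ℝ} (ht : t ∈ s) (hrt : ∀ n, ContinuousWithinAt (r n) s t)
    (hqt : ContinuousWithinAt q s t) {y : ℤ → ℝ → ℝ} {C : ℝ} (hyC : ∀ k u, |y k u| ≤ C)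
    (hy : ∀ k, ContinuousWithinAt (y k) s t) :
    ContinuousWithinAt (fun u => ∑' k, r k u * y k u) s t := by
  have ht0 : (0 : ℝ) ≤ t := hs ht
  have hmem : ∀ᶠ u in 𝓝[s] t, (0 : ℝ) ≤ u := by
    filter_upwards [self_mem_nhdsWithin] with u hu using hs hu
  -- The change of the rates is controlled in `ℓ¹` by Scheffé, uniformly over bounded `y`; the
  -- change of `y` with rates frozen at `t` by dominated convergence.
  have h1 : Tendsto (fun u => ∑' k, |r k u - r k t|) (𝓝[s] t) (𝓝 0) := by
    refine tendsto_tsum_abs_sub ?_ ?_ (fun k => hr.nonneg k t ht0) (hr.hasSum t ht0) hrt hqt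
    · filter_upwards [hmem] with u hu k using hr.nonneg k u hu
    · filter_upwards [hmem] with u hu using hr.hasSum u hu
  have h2 : Tendsto (fun u => ∑' k, r k t * y k u) (𝓝[s] t) (𝓝 (∑' k, r k t * y k t)) := by
    refine tendsto_tsum_of_dominated_convergence ((hr.hasSum t ht0).summable.mul_right C)
      (fun k => (hy k).const_mul _) (Eventually.of_forall fun u k => ?_)
    rw [norm_mul, Real.norm_of_nonneg (hr.nonneg k t ht0)]
    exact mul_le_mul_of_nonneg_left (hyC k u) (hr.nonneg k t ht0)
  have h3 : Tendsto (fun u => ∑' k, r k u * y k u - ∑' k, r k t * y k u) (𝓝[s] t) (𝓝 0) := by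
    rw [tendsto_zero_iff_norm_tendsto_zero]
    have h4 := h1.const_mul C
    rw [mul_zero] at h4
    refine squeeze_zero' (Eventually.of_forall fun _ => norm_nonneg _) ?_ h4
    filter_upwards [hmem] with u hu
    exact abs_tsum_mul_sub_le (hr.hasSum u hu).summable (hr.hasSum t ht0).summable
      fun k => hyC k u
  have h5 := h3.add h2
  simpa [ContinuousWithinAt] using h5

section Skellam

variable {I : Finset ℤ} (hI : (0 : ℤ) ∉ I) {lam : ℤ → ℝ → ℝ}
  (hlam_nonneg : ∀ i ∈ I, ∀ t : ℝ, 0 ≤ t → 0 ≤ lam i t)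
  (hlam_int : ∀ i ∈ I, LocallyIntegrableOn (lam i) (Ici (0 : ℝ)))
  {f : ℤ → ℝ → ℝ} {ν : ℤ → Measure ℝ} (hf : ∀ i ∈ I, IsBernstein (f i) 0 0 (ν i))
  {Ω : Type*} [MeasurableSpace Ω] {P : Measure Ω} [IsProbabilityMeasure P]
  {S : ℝ≥0 → Ω → ℤ}

include hI hlam_nonneg hlam_int hf

theorem HasCompoundPoissonIncrements.hasInfinitesimalAt (hS : IsAdditiveFromZero P S)
    (hCP : HasCompoundPoissonIncrements P S fun n t => jumpRate I lam ν t n) {t : ℝ≥0}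
    (hc : ∀ i ∈ I, ContinuousWithinAt (lam i) (Ici (t : ℝ)) t) :
    HasInfinitesimalAt I lam f ν P S t := by
  have hr := isRateFamily_of_isBernstein hI hlam_nonneg hlam_int hf
  have hsub : Ici (t : ℝ) ⊆ Ici 0 := Ici_subset_Ici.2 t.coe_nonneg
  rw [hasInfinitesimalAt_iff hI hlam_nonneg hlam_int hf hS]
  refine hasIncrementRates_of_hasDerivWithinAt hS hr hCP (fun n => ?_) ?_
  · exact hasDerivWithinAt_integral_Ici t.coe_nonneg (hr.aesm n) (continuousWithinAt_jumpRate
      hlam_nonneg (fun i hi => (hf i hi).levy) hsub self_mem_Ici hc n)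
  · refine hasDerivWithinAt_integral_Ici t.coe_nonneg ?_ (continuousWithinAt_totalRate
      hlam_nonneg (fun i hi => (hf i hi).levy) hsub self_mem_Ici hc)
    exact Finset.aestronglyMeasurable_fun_sum _ fun i hi => aestronglyMeasurable_comp_rate
      (hlam_nonneg i hi) (hlam_int i hi) (continuousOn_bernsteinFun (hf i hi).levy)

theorem continuousWithinAt_genRHS_lawOf {t : ℝ} (ht : 0 ≤ t)
    (hc : ∀ i ∈ I, ContinuousWithinAt (lam i) (Ici 0) t)
    (hp : ∀ n, ContinuousWithinAt (lawOf P S n) (Ici 0) t) (n : ℤ) :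
    ContinuousWithinAt (fun s => genRHS I lam ν s (fun k => lawOf P S k s) n) (Ici 0) t := by
  have hr := isRateFamily_of_isBernstein hI hlam_nonneg hlam_int hf
  have h := hr.continuousWithinAt_tsum subset_rfl (show t ∈ Ici 0 from ht)
    (continuousWithinAt_jumpRate hlam_nonneg (fun i hi => (hf i hi).levy) subset_rfl ht hc)
    (continuousWithinAt_totalRate hlam_nonneg (fun i hi => (hf i hi).levy) subset_rfl ht hc)
    (y := fun k s => lawOf P S (n - k) s - lawOf P S n s) (C := 2) (fun k s => by
      refine (abs_sub _ _).trans ?_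
      linarith [abs_lawOf_le (P := P) (S := S) (n - k) s, abs_lawOf_le (P := P) (S := S) n s])
    (fun k => (hp _).sub (hp _))
  have e : ∀ s ∈ Ici (0 : ℝ), genRHS I lam ν s (fun k => lawOf P S k s) n =
      ∑' k, jumpRate I lam ν s k * (lawOf P S (n - k) s - lawOf P S n s) := fun s hs =>
    (hasSum_genRHS hlam_nonneg (fun i hi => (hf i hi).levy) hI hs
      (fun k => abs_lawOf_le k s) n).tsum_eq.symm
  exact h.congr e (e t ht)

omit hI hlam_nonneg hlam_int hf [IsProbabilityMeasure P] in
theorem continuousOn_lawOf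
    (hac : ∀ n : ℤ, ∀ T : ℝ, 0 ≤ T → AbsolutelyContinuousOnInterval (lawOf P S n) 0 T) (n : ℤ) :
    ContinuousOn (lawOf P S n) (Ici 0) := by
  intro t ht
  have ht : (0 : ℝ) ≤ t := ht
  have h := (hac n (t + 1) (by linarith)).continuousOn t
    (by rw [uIcc_of_le (by linarith)]; exact ⟨ht, by linarith⟩)
  rw [uIcc_of_le (by linarith)] at h
  exact h.mono_of_mem_nhdsWithin Icc_add_one_mem_nhdsWithin

/-- Integrating the almost everywhere equation shows that the law is a primitive of the right-hand
side, which is continuous at `t` when the rates are. -/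
theorem IsSolution.hasDerivWithinAt_lawOf (h : IsSolution I lam ν (lawOf P S)) {t : ℝ} (ht : 0 ≤ t)
    (hc : ∀ i ∈ I, ContinuousWithinAt (lam i) (Ici 0) t) (n : ℤ) :
    HasDerivWithinAt (lawOf P S n) (genRHS I lam ν t (fun k => lawOf P S k t) n) (Ici 0) t := by
  have he : ∀ u : ℝ, 0 ≤ u → ∀ᵐ s : ℝ, s ∈ uIoc 0 u → deriv (lawOf P S n) s =
      genRHS I lam ν s (fun k => lawOf P S k s) n := fun u hu => by
    filter_upwards [ae_imp_of_ae_restrict h.eqn] with s hs hsu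
    rw [uIoc_of_le hu] at hsu
    exact (hs hsu.1.le n).deriv
  have ht1 : 0 ≤ t + 1 := by linarith
  refine hasDerivWithinAt_of_eq_integral
    (g := fun s => genRHS I lam ν s (fun k => lawOf P S k s) n) ht ?_ ?_ fun u hu => ?_
  · refine (h.abs_cont n (t + 1) ht1).intervalIntegrable_deriv.congr_ae ?_
    exact (ae_restrict_iff' measurableSet_uIoc).2 (he _ ht1)
  · exact continuousWithinAt_genRHS_lawOf hI hlam_nonneg hlam_int hf ht hc
      (fun n => continuousOn_lawOf h.abs_cont n t ht) n
  · rw [← intervalIntegral.integral_congr_ae (he u hu.1),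
      (h.abs_cont n u hu.1).integral_deriv_eq_sub]
    ring

/-- With continuous rates and law the right-hand side is continuous. A continuous function whose
right derivative is everywhere this function is its primitive, which supplies the absolute
continuity that was not assumed. -/
theorem isSolution_of_continuousOn (hS : IsAdditiveFromZero P S)
    (hc : ∀ i ∈ I, ContinuousOn (lam i) (Ici (0 : ℝ)))
    (hp : ∀ n : ℤ, ContinuousOn (lawOf P S n) (Ici (0 : ℝ)))
    (hinf : ∀ t : ℝ≥0, HasInfinitesimalAt I lam f ν P S t) :
    IsSolution I lam ν (lawOf P S) := by
  refine isSolution_of_hasInfinitesimalAt hI hlam_nonneg hlam_int hf hS (fun n T hT => ?_)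
    (Eventually.of_forall fun t => hinf _)
  have hG : ContinuousOn (fun s => genRHS I lam ν s (fun k => lawOf P S k s) n) (Ici 0) :=
    fun t ht => continuousWithinAt_genRHS_lawOf hI hlam_nonneg hlam_int hf ht
      (fun i hi => hc i hi t ht) (fun n => hp n t ht) n
  have hGi : ∀ u : ℝ, 0 ≤ u → IntervalIntegrable
      (fun s => genRHS I lam ν s (fun k => lawOf P S k s) n) volume 0 u := fun u hu =>
    (hG.mono (by rw [uIcc_of_le hu]; exact Icc_subset_Ici_self)).intervalIntegrable
  have hFTC : ∀ u : ℝ, 0 ≤ u → ∫ s in (0 : ℝ)..u, genRHS I lam ν s (fun k => lawOf P S k s) n =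
      lawOf P S n u - lawOf P S n 0 := fun u hu => by
    refine intervalIntegral.integral_eq_sub_of_hasDeriv_right_of_le hu
      ((hp n).mono Icc_subset_Ici_self) (fun s hs => ?_) (hGi u hu)
    have h := (hinf s.toNNReal).hasDerivWithinAt_lawOf hI hlam_nonneg hlam_int hf hS n
    rwa [Real.coe_toNNReal s hs.1.le] at h
  refine absolutelyContinuousOnInterval_of_dist_le
    ((hGi T hT).absolutelyContinuousOnInterval_intervalIntegral (c := 0) left_mem_uIcc) ?_
  intro x hx y hy
  rw [uIcc_of_le hT] at hx hy
  rw [hFTC x hx.1, hFTC y hy.1, dist_sub_right]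

theorem isSolution_iff_of_continuousOn (hS : IsAdditiveFromZero P S)
    (hc : ∀ i ∈ I, ContinuousOn (lam i) (Ici (0 : ℝ))) :
    IsSolution I lam ν (lawOf P S) ↔
      (∀ n : ℤ, ContinuousOn (lawOf P S n) (Ici (0 : ℝ))) ∧
        ∀ t : ℝ≥0, HasInfinitesimalAt I lam f ν P S t := by
  refine ⟨fun h => ⟨continuousOn_lawOf h.abs_cont, fun t => ?_⟩, fun h =>
    isSolution_of_continuousOn hI hlam_nonneg hlam_int hf hS hc h.1 h.2⟩
  refine HasCompoundPoissonIncrements.hasInfinitesimalAt hI hlam_nonneg hlam_int hf hS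
    (h.hasCompoundPoissonIncrements hI hlam_nonneg hlam_int hf hS) fun i hi => ?_
  exact (hc i hi t t.coe_nonneg).mono (Ici_subset_Ici.2 t.coe_nonneg)

/-! ### State space -/

omit hI hlam_nonneg hlam_int hf [IsProbabilityMeasure P] in
theorem ae_mem_closure_jumpMeasure {s : ℝ} (hs : 0 ≤ s) (t : ℝ) :
    ∀ᵐ n ∂(jumpMeasure (pointIntensity fun n t => jumpRate I lam ν t n) s t),
      n ∈ AddSubmonoid.closure (I : Set ℤ) := by
  rw [jumpMeasure_pointIntensity _ hs, Measure.ae_sum_iff' .of_discrete]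
  intro n
  by_cases hn : n ∈ AddSubmonoid.closure (I : Set ℤ)
  · refine Measure.ae_smul_measure ?_ _
    rwa [ae_dirac_iff .of_discrete]
  · have h0 : ∀ u, jumpRate I lam ν u n = 0 := fun u => by
      refine jumpRate_eq_zero lam ν u ?_
      rintro ⟨i, hi, m, -, rfl⟩
      refine hn ?_
      rw [← nsmul_eq_mul]
      exact AddSubmonoid.nsmul_mem _ (AddSubmonoid.subset_closure hi) m
    simp [h0]

theorem HasCompoundPoissonIncrements.ae_mem_closure (hS : IsAdditiveFromZero P S)
    (hCP : HasCompoundPoissonIncrements P S fun n t => jumpRate I lam ν t n) (t : ℝ≥0) :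
    ∀ᵐ ω ∂P, S t ω ∈ AddSubmonoid.closure (I : Set ℤ) := by
  have hr := isRateFamily_of_isBernstein hI hlam_nonneg hlam_int hf
  have := hr.isFiniteMeasure_jumpMeasure (s := 0) (t := t) le_rfl
  have h := ae_mem_compoundPoisson (ae_mem_closure_jumpMeasure (I := I) (lam := lam) (ν := ν)
    le_rfl (t : ℝ))
  rw [← hCP.map_eq hS] at h
  exact ae_of_ae_map (hS.measurable t).aemeasurable h

end Skellam

/-! ### Generating functions -/

theorem IsRateFamily.integrable_jumpMeasure_iff {r : ℤ → ℝ → ℝ} {q : ℝ → ℝ} (hr : IsRateFamily r q)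
    (y : ℤ → ℂ) {s : ℝ} (hs : 0 ≤ s) (t : ℝ) :
    Integrable y (jumpMeasure (pointIntensity r) s t) ↔
      ∫⁻ u in Ioc s t, ∑' n, ENNReal.ofReal (r n u) * ‖y n‖ₑ < ∞ := by
  rw [← hr.lintegral_jumpMeasure _ hs]
  exact ⟨fun h => h.2, fun h => ⟨.of_discrete, h⟩⟩

theorem IsRateFamily.ae_tsum_lt_top {r : ℤ → ℝ → ℝ} {q : ℝ → ℝ} (hr : IsRateFamily r q)
    {y : ℤ → ℂ} {s : ℝ} (hs : 0 ≤ s) {t : ℝ}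
    (hy : Integrable y (jumpMeasure (pointIntensity r) s t)) :
    ∀ᵐ u ∂(volume.restrict (Ioc s t)), ∑' n, ENNReal.ofReal (r n u) * ‖y n‖ₑ < ∞ :=
  ae_lt_top' (AEMeasurable.tsum fun n =>
    (hr.aesm_Ioc n hs t).aemeasurable.ennreal_ofReal.mul_const _)
    ((hr.integrable_jumpMeasure_iff y hs t).1 hy).ne

theorem IsRateFamily.integral_jumpMeasure {r : ℤ → ℝ → ℝ} {q : ℝ → ℝ} (hr : IsRateFamily r q)
    {y : ℤ → ℂ} {s t : ℝ} (hs : 0 ≤ s) (hst : s ≤ t)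
    (hy : Integrable y (jumpMeasure (pointIntensity r) s t)) :
    ∫ n, y n ∂(jumpMeasure (pointIntensity r) s t) = ∫ u in s..t, ∑' n, r n u • y n := by
  have hfin := (hr.integrable_jumpMeasure_iff y hs t).1 hy
  have hm : ∀ n, AEMeasurable (fun u => ENNReal.ofReal (r n u)) (volume.restrict (Ioc s t)) :=
    fun n => (hr.aesm_Ioc n hs t).aemeasurable.ennreal_ofReal
  rw [lintegral_tsum fun n => (hm n).mul_const _] at hfin
  rw [jumpMeasure_pointIntensity r hs] at hy ⊢
  rw [← (hasSum_integral_measure hy).tsum_eq, intervalIntegral.integral_of_le hst, integral_tsum]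
  · congr 1
    ext n
    rw [integral_smul_measure, integral_dirac, integral_smul_const, hr.lintegral_Ioc n hs hst,
      ENNReal.toReal_ofReal (hr.integral_nonneg n hs hst), intervalIntegral.integral_of_le hst]
  · exact fun n => (hr.aesm_Ioc n hs t).smul_const _
  · convert hfin.ne using 3 with n
    refine setLIntegral_congr_fun measurableSet_Ioc fun u hu => ?_
    simp only [enorm_smul]
    rw [Real.enorm_of_nonneg (hr.nonneg n u (hs.trans (le_of_lt hu.1)))]

section FixedRate

variable {ν : Measure ℝ} (hν : ∫⁻ w in Ioi (0 : ℝ), ENNReal.ofReal (min w 1) ∂ν < ∞)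
  {i : ℤ} (hi : i ≠ 0) {c : ℝ} (hc : 0 ≤ c)
include hν hi hc

omit hν hi hc in
theorem zpow_natCast_mul {G : Type*} [DivisionMonoid G] (u : G) (m : ℕ) (i : ℤ) :
    u ^ ((m : ℤ) * i) = (u ^ i) ^ m := by
  rw [mul_comm, zpow_mul, zpow_natCast]

/-- The Poisson generating function at `‖u‖^i` without its zeroth term, integrated against `ν` by
Tonelli. -/
theorem tsum_jumpWeight_mul_zpow (u : ℂ) :
    ∑' n, ENNReal.ofReal (jumpWeight i ν c n) * ‖u ^ n‖ₑ =
      ∫⁻ w in Ioi (0 : ℝ), ENNReal.ofReal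
        (Real.exp (-(c * (1 - ‖u‖ ^ i) * w)) - Real.exp (-(c * w))) ∂ν := by
  rw [tsum_jumpWeight_mul hi, lintegral_tsum_poissonWeight hν hc]
  refine setLIntegral_congr_fun measurableSet_Ioi fun w hw => ?_
  have hx : 0 ≤ c * w := mul_nonneg hc (le_of_lt hw)
  have ha : 0 ≤ ‖u‖ ^ i := zpow_nonneg (norm_nonneg u) i
  have h := (hasSum_nat_add_iff' 1).2 (hasSum_poissonWeight_mul_pow_real (c * w) (‖u‖ ^ i))
  simp only [Finset.range_one, Finset.sum_singleton, pow_zero, mul_one, poissonWeight_zero] at h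
  rw [mul_right_comm c, ← h.tsum_eq, ENNReal.ofReal_tsum_of_nonneg _ h.summable]
  · congr 1
    ext m
    rw [zpow_natCast_mul, ENNReal.ofReal_mul (poissonWeight_nonneg _ hx), enorm_pow,
      ENNReal.ofReal_pow ha, ← norm_zpow, ofReal_norm]
  · exact fun m => mul_nonneg (poissonWeight_nonneg _ hx) (pow_nonneg ha _)

omit hi in
theorem lintegral_one_sub_exp :
    ∫⁻ w in Ioi (0 : ℝ), ENNReal.ofReal (1 - Real.exp (-(c * w))) ∂ν =
      ENNReal.ofReal (bernsteinFun ν c) := by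
  rw [bernsteinFun, ofReal_integral_eq_lintegral_ofReal (integrable_one_sub_exp hν hc)]
  filter_upwards [ae_restrict_mem measurableSet_Ioi] with w hw
  exact one_sub_exp_nonneg (mul_nonneg hc (le_of_lt hw))

/-- With `x = cw` and `a = ‖u‖^i`, the quantities `e^{-x(1-a)} - e^{-x}` and `|1 - e^{-x(1-a)}|`
differ by at most `1 - e^{-x}`, whose integral is finite. So this bound and its converse make the
two integrability conditions equivalent. -/
theorem lintegral_enorm_one_sub_exp_le (u : ℂ) :
    ∫⁻ w in Ioi (0 : ℝ), ‖1 - Real.exp (-(c * (1 - ‖u‖ ^ i) * w))‖ₑ ∂ν ≤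
      (∑' n, ENNReal.ofReal (jumpWeight i ν c n) * ‖u ^ n‖ₑ) +
        ENNReal.ofReal (bernsteinFun ν c) := by
  rw [tsum_jumpWeight_mul_zpow hν hi hc, ← lintegral_one_sub_exp hν hc,
    ← lintegral_add_left (by fun_prop)]
  refine setLIntegral_mono' measurableSet_Ioi fun w hw => ?_
  have hx : 0 ≤ c * w := mul_nonneg hc (le_of_lt hw)
  have ha : 0 ≤ ‖u‖ ^ i := zpow_nonneg (norm_nonneg u) i
  have h1 : Real.exp (-(c * w)) ≤ Real.exp (-(c * (1 - ‖u‖ ^ i) * w)) :=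
    Real.exp_le_exp.2 (by nlinarith [mul_nonneg hx ha])
  have h2 := one_sub_exp_nonneg hx
  rw [← ENNReal.ofReal_add (sub_nonneg.2 h1) h2, ← ofReal_norm, Real.norm_eq_abs]
  refine ENNReal.ofReal_le_ofReal (abs_le.2 ⟨by linarith, by linarith⟩)

theorem tsum_jumpWeight_mul_zpow_le (u : ℂ) :
    ∑' n, ENNReal.ofReal (jumpWeight i ν c n) * ‖u ^ n‖ₑ ≤
      (∫⁻ w in Ioi (0 : ℝ), ‖1 - Real.exp (-(c * (1 - ‖u‖ ^ i) * w))‖ₑ ∂ν) +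
        ENNReal.ofReal (bernsteinFun ν c) := by
  rw [tsum_jumpWeight_mul_zpow hν hi hc, ← lintegral_one_sub_exp hν hc,
    ← lintegral_add_left (by fun_prop)]
  refine setLIntegral_mono' measurableSet_Ioi fun w hw => ?_
  have h2 := one_sub_exp_nonneg (mul_nonneg hc (le_of_lt hw))
  rw [← ofReal_norm, ← ENNReal.ofReal_add (norm_nonneg _) h2, Real.norm_eq_abs]
  refine ENNReal.ofReal_le_ofReal ?_
  linarith [neg_abs_le (1 - Real.exp (-(c * (1 - ‖u‖ ^ i) * w)))]

/-- Subtract the Poisson series at `z = 1` from that at `z = u^i`: the terms `e^{-cw}` cancel and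
`e^{-cw(1-u^i)} - 1` remains. -/
theorem tsum_jumpWeight_smul_zpow_sub_one {u : ℂ}
    (hfin : ∑' n, ENNReal.ofReal (jumpWeight i ν c n) * ‖u ^ n - 1‖ₑ < ∞) :
    ∑' n, jumpWeight i ν c n • (u ^ n - 1) = -bernsteinC ν (c * (1 - u ^ i)) := by
  rw [tsum_jumpWeight_mul hi] at hfin
  have hs : Summable fun m : ℕ => mixedWeight ν (m + 1) c * ‖u ^ (((m + 1 : ℕ) : ℤ) * i) - 1‖ := by
    refine (ENNReal.summable_toReal hfin.ne).congr fun m => ?_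
    rw [ENNReal.toReal_mul, ENNReal.toReal_ofReal (mixedWeight_nonneg _ _ hc), toReal_enorm]
  have h := (hasSum_jumpWeight_smul_iff hi ν c (fun n => u ^ n - 1) _).2
    (hasSum_smul_mixedWeight hν hc hs)
  rw [h.tsum_eq, bernsteinC, ← integral_neg]
  refine integral_congr_ae (ae_of_all _ fun w => ?_)
  have h := (hasSum_poissonWeight_succ_mul_pow (c * w) (u ^ i)).sub
    (hasSum_poissonWeight_succ_mul_pow (c * w) 1)
  have e : ∀ m : ℕ, poissonWeight (m + 1) (c * w) • (u ^ (((m + 1 : ℕ) : ℤ) * i) - 1) =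
      (poissonWeight (m + 1) (c * w) : ℂ) * (u ^ i) ^ (m + 1) -
        (poissonWeight (m + 1) (c * w) : ℂ) * 1 ^ (m + 1) := fun m => by
    rw [zpow_natCast_mul, Complex.real_smul, one_pow, mul_sub]
  refine (hasSum_of_eq h e ?_).tsum_eq
  rw [sub_self, mul_zero, neg_zero, Complex.exp_zero, Complex.ofReal_mul,
    mul_right_comm (c : ℂ) (w : ℂ)]
  ring

end FixedRate

section Rates

variable {I : Finset ℤ} (hI : (0 : ℤ) ∉ I) {lam : ℤ → ℝ → ℝ}
  (hlam_nonneg : ∀ i ∈ I, ∀ t : ℝ, 0 ≤ t → 0 ≤ lam i t)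
  (hlam_int : ∀ i ∈ I, LocallyIntegrableOn (lam i) (Ici (0 : ℝ)))
  {f : ℤ → ℝ → ℝ} {ν : ℤ → Measure ℝ} (hf : ∀ i ∈ I, IsBernstein (f i) 0 0 (ν i))

theorem isRateFamily_jumpWeight {l : ℝ → ℝ} (h0 : ∀ t : ℝ, 0 ≤ t → 0 ≤ l t)
    (hint : LocallyIntegrableOn l (Ici (0 : ℝ))) {ν : Measure ℝ}
    (hν : ∫⁻ w in Ioi (0 : ℝ), ENNReal.ofReal (min w 1) ∂ν < ∞) {i : ℤ} (hi : i ≠ 0) :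
    IsRateFamily (fun n t => jumpWeight i ν (l t) n) (fun t => bernsteinFun ν (l t)) where
  nonneg n t ht := jumpWeight_nonneg i ν (h0 t ht) n
  zero t := jumpWeight_zero i ν (l t)
  hasSum t ht := hasSum_jumpWeight hν hi (h0 t ht)
  aesm n := aestronglyMeasurable_comp_rate h0 hint (continuousOn_jumpWeight hν i n)
  intervalIntegrable_total _ _ hs ht := intervalIntegrable_bernsteinFun_comp h0 hint hν hs ht

include hI hlam_nonneg hlam_int hf

/-- Splitting the jump measure by `i` turns integrability into a separate condition for each `i`,
with no cancellation as all parts are nonnegative. -/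
theorem jumpMeasure_jumpRate {s : ℝ} (hs : 0 ≤ s) (t : ℝ) :
    jumpMeasure (pointIntensity fun n t => jumpRate I lam ν t n) s t =
      ∑ i ∈ I, jumpMeasure (pointIntensity fun n t => jumpWeight i (ν i) (lam i t) n) s t := by
  have hi : ∀ i ∈ I, i ≠ 0 := fun i hi h => hI (h ▸ hi)
  have hri := fun i (h : i ∈ I) => isRateFamily_jumpWeight (hlam_nonneg i h) (hlam_int i h)
    (hf i h).levy (hi i h)
  refine Measure.ext_of_lintegral _ fun F _ => ?_
  rw [lintegral_finsetSum_measure,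
    (isRateFamily_of_isBernstein hI hlam_nonneg hlam_int hf).lintegral_jumpMeasure F hs,
    Finset.sum_congr rfl fun i h => (hri i h).lintegral_jumpMeasure F hs t,
    ← lintegral_finsetSum' I fun i h => AEMeasurable.tsum fun n =>
      ((hri i h).aesm_Ioc n hs t).aemeasurable.ennreal_ofReal.mul_const _]
  refine setLIntegral_congr_fun measurableSet_Ioc fun u hu => ?_
  have hu0 : 0 ≤ u := hs.trans (le_of_lt hu.1)
  rw [← Summable.tsum_finsetSum fun _ _ => ENNReal.summable]
  congr 1
  ext n
  rw [jumpRate_eq_sum_jumpWeight, ENNReal.ofReal_sum_of_nonneg fun i h => (hri i h).nonneg n u hu0,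
    Finset.sum_mul]

theorem integrable_zpow_jumpMeasure_iff (u : ℂ) (t : ℝ) :
    Integrable (fun n : ℤ => u ^ n)
        (jumpMeasure (pointIntensity fun n t => jumpRate I lam ν t n) 0 t) ↔
      ∀ i ∈ I, ∫⁻ s in Ioc (0 : ℝ) t, ∫⁻ w in Ioi (0 : ℝ),
        ‖1 - Real.exp (-(lam i s * (1 - ‖u‖ ^ i) * w))‖ₑ ∂(ν i) < ∞ := by
  have hi : ∀ i ∈ I, i ≠ 0 := fun i hi h => hI (h ▸ hi)
  rw [jumpMeasure_jumpRate hI hlam_nonneg hlam_int hf le_rfl, integrable_finsetSum_measure]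
  refine forall₂_congr fun i h => ?_
  have hr := isRateFamily_jumpWeight (hlam_nonneg i h) (hlam_int i h) (hf i h).levy (hi i h)
  rw [hr.integrable_jumpMeasure_iff _ le_rfl]
  -- The sign of `t` is not fixed here; for `t < 0` the interval `(0, t]` is empty.
  have hq := hr.intervalIntegrable_total 0 (max 0 t) le_rfl (le_max_left _ _)
  rw [intervalIntegrable_iff_integrableOn_Ioc_of_le (le_max_left _ _)] at hq
  have hq := hq.mono_set (Ioc_subset_Ioc_right (le_max_right 0 t))
  have hm := hq.aestronglyMeasurable.aemeasurable.ennreal_ofReal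
  have hb : ∫⁻ s in Ioc (0 : ℝ) t, ENNReal.ofReal (bernsteinFun (ν i) (lam i s)) < ∞ :=
    hq.lintegral_lt_top
  constructor <;> intro hfin
  · refine lt_of_le_of_lt (setLIntegral_mono' measurableSet_Ioc fun s hs =>
      lintegral_enorm_one_sub_exp_le (hf i h).levy (hi i h)
        (hlam_nonneg i h s (le_of_lt hs.1)) u) ?_
    rw [lintegral_add_right' _ hm]
    exact ENNReal.add_lt_top.2 ⟨hfin, hb⟩
  · refine lt_of_le_of_lt (setLIntegral_mono' measurableSet_Ioc fun s hs =>
      tsum_jumpWeight_mul_zpow_le (hf i h).levy (hi i h)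
        (hlam_nonneg i h s (le_of_lt hs.1)) u) ?_
    rw [lintegral_add_right' _ hm]
    exact ENNReal.add_lt_top.2 ⟨hfin, hb⟩

theorem integral_zpow_sub_one_jumpMeasure {u : ℂ} {t : ℝ} (ht : 0 ≤ t)
    (hu : Integrable (fun n : ℤ => u ^ n)
      (jumpMeasure (pointIntensity fun n t => jumpRate I lam ν t n) 0 t)) :
    ∫ n, (u ^ n - 1) ∂(jumpMeasure (pointIntensity fun n t => jumpRate I lam ν t n) 0 t) =
      -∑ i ∈ I, ∫ s in (0 : ℝ)..t, bernsteinC (ν i) ((lam i s : ℂ) * (1 - u ^ i)) := by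
  have hi : ∀ i ∈ I, i ≠ 0 := fun i hi h => hI (h ▸ hi)
  have := (isRateFamily_of_isBernstein hI hlam_nonneg hlam_int hf).isFiniteMeasure_jumpMeasure
    (s := 0) (t := t) le_rfl
  have hu1 : Integrable (fun n : ℤ => u ^ n - 1) _ := hu.sub (integrable_const (1 : ℂ))
  rw [jumpMeasure_jumpRate hI hlam_nonneg hlam_int hf le_rfl, integrable_finsetSum_measure] at hu1
  rw [jumpMeasure_jumpRate hI hlam_nonneg hlam_int hf le_rfl, integral_finsetSum_measure hu1,
    ← Finset.sum_neg_distrib]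
  refine Finset.sum_congr rfl fun i h => ?_
  have hr := isRateFamily_jumpWeight (hlam_nonneg i h) (hlam_int i h) (hf i h).levy (hi i h)
  rw [hr.integral_jumpMeasure le_rfl ht (hu1 i h), ← intervalIntegral.integral_neg,
    intervalIntegral.integral_of_le ht, intervalIntegral.integral_of_le ht]
  refine integral_congr_ae ?_
  filter_upwards [hr.ae_tsum_lt_top le_rfl (hu1 i h), ae_restrict_mem measurableSet_Ioc] with s hs hs'
  exact tsum_jumpWeight_smul_zpow_sub_one (hf i h).levy (hi i h)
    (hlam_nonneg i h s (le_of_lt hs'.1)) hs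

omit hI hlam_nonneg hlam_int hf in
theorem nonneg_of_mem_closure (hpos : ∀ i ∈ I, 0 < i) {n : ℤ}
    (hn : n ∈ AddSubmonoid.closure (I : Set ℤ)) : 0 ≤ n := by
  induction hn using AddSubmonoid.closure_induction with
  | mem i hi => exact (hpos i hi).le
  | zero => exact le_rfl
  | add x y _ _ hx hy => exact add_nonneg hx hy

omit hI hlam_nonneg hlam_int hf in
-- For `u = 0` the rule fails for exponents of opposite sign, but then all of `I` is positive and
-- only nonnegative exponents occur.
theorem zpow_add_of_mem_closure {u : ℂ} (hu : u = 0 → ∀ i ∈ I, 0 < i) {x y : ℤ}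
    (hx : x ∈ AddSubmonoid.closure (I : Set ℤ)) (hy : y ∈ AddSubmonoid.closure (I : Set ℤ)) :
    u ^ (x + y) = u ^ x * u ^ y := by
  by_cases h0 : u = 0
  · obtain ⟨k, rfl⟩ := Int.eq_ofNat_of_zero_le (nonneg_of_mem_closure (hu h0) hx)
    obtain ⟨l, rfl⟩ := Int.eq_ofNat_of_zero_le (nonneg_of_mem_closure (hu h0) hy)
    exact_mod_cast pow_add u k l
  · exact zpow_add₀ h0 x y

variable {Ω : Type*} [MeasurableSpace Ω] {P : Measure Ω} [IsProbabilityMeasure P]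
  {S : ℝ≥0 → Ω → ℤ} (hS : IsAdditiveFromZero P S)
  (hCP : HasCompoundPoissonIncrements P S fun n t => jumpRate I lam ν t n)
include hS hCP

theorem HasCompoundPoissonIncrements.integrable_zpow_iff {u : ℂ} (hu : u = 0 → ∀ i ∈ I, 0 < i)
    (t : ℝ≥0) :
    Integrable (fun ω => u ^ (S t ω)) P ↔
      Integrable (fun n : ℤ => u ^ n)
        (jumpMeasure (pointIntensity fun n t => jumpRate I lam ν t n) 0 t) := by
  have := (isRateFamily_of_isBernstein hI hlam_nonneg hlam_int hf).isFiniteMeasure_jumpMeasure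
    (s := 0) (t := t) le_rfl
  rw [← integrable_compoundPoisson_iff (ae_mem_closure_jumpMeasure le_rfl _) (zpow_zero u)
    fun x hx y hy => zpow_add_of_mem_closure hu hx hy, ← hCP.map_eq hS,
    integrable_map_measure .of_discrete (hS.measurable t).aemeasurable]
  rfl

theorem HasCompoundPoissonIncrements.integral_zpow {u : ℂ} (hu : u = 0 → ∀ i ∈ I, 0 < i)
    (t : ℝ≥0) (hint : Integrable (fun ω => u ^ (S t ω)) P) :
    ∫ ω, u ^ (S t ω) ∂P = Complex.exp (-∑ i ∈ I, ∫ s in (0 : ℝ)..t,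
      bernsteinC (ν i) ((lam i s : ℂ) * (1 - u ^ i))) := by
  have := (isRateFamily_of_isBernstein hI hlam_nonneg hlam_int hf).isFiniteMeasure_jumpMeasure
    (s := 0) (t := t) le_rfl
  have hJ := (hCP.integrable_zpow_iff hI hlam_nonneg hlam_int hf hS hu t).1 hint
  rw [← integral_zpow_sub_one_jumpMeasure hI hlam_nonneg hlam_int hf t.coe_nonneg hJ,
    ← integral_compoundPoisson (ae_mem_closure_jumpMeasure le_rfl _) (zpow_zero u)
    (fun x hx y hy => zpow_add_of_mem_closure hu hx hy) hJ, ← hCP.map_eq hS,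
    integral_map (hS.measurable t).aemeasurable .of_discrete]

theorem HasCompoundPoissonIncrements.integrable_real_zpow (hpos : ∀ i ∈ I, 0 < i) (t : ℝ≥0)
    {u : ℝ} (hu : |u| ≤ 1) : Integrable (fun ω => u ^ (S t ω)) P := by
  have hm : Measurable fun ω => u ^ (S t ω) :=
    (measurable_of_countable fun n : ℤ => u ^ n).comp (hS.measurable t)
  refine Integrable.of_bound hm.aestronglyMeasurable 1 ?_
  filter_upwards [hCP.ae_mem_closure hI hlam_nonneg hlam_int hf hS t] with ω hω
  obtain ⟨k, hk⟩ := Int.eq_ofNat_of_zero_le (nonneg_of_mem_closure hpos hω)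
  rw [hk, zpow_natCast, norm_pow]
  exact pow_le_one₀ (norm_nonneg u) hu

omit hI hlam_nonneg hlam_int hf hS hCP [IsProbabilityMeasure P] in
theorem bernsteinC_ofReal (ν : Measure ℝ) (x : ℝ) :
    bernsteinC ν (x : ℂ) = (bernsteinFun ν x : ℂ) := by
  rw [bernsteinC, bernsteinFun, ← integral_complex_ofReal]
  push_cast
  rfl

theorem HasCompoundPoissonIncrements.integral_real_zpow (hpos : ∀ i ∈ I, 0 < i) (t : ℝ≥0)
    {u : ℝ} (hu : |u| ≤ 1) :
    ∫ ω, u ^ (S t ω) ∂P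
      = Real.exp (-∑ i ∈ I, ∫ s in (0 : ℝ)..t, f i (lam i s * (1 - u ^ i))) := by
  have hint : Integrable (fun ω => (u : ℂ) ^ (S t ω)) P := by
    refine ((hCP.integrable_real_zpow hI hlam_nonneg hlam_int hf hS hpos t hu).ofReal
      (𝕜 := ℂ)).congr (ae_of_all _ fun ω => ?_)
    simp
  have h := hCP.integral_zpow hI hlam_nonneg hlam_int hf hS (fun _ => hpos) t hint
  have hl : ∫ ω, (u : ℂ) ^ (S t ω) ∂P = ((∫ ω, u ^ (S t ω) ∂P : ℝ) : ℂ) := by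
    rw [← integral_complex_ofReal]
    push_cast
    rfl
  have hr : ∀ i ∈ I, ∫ s in (0 : ℝ)..t, bernsteinC (ν i) ((lam i s : ℂ) * (1 - (u : ℂ) ^ i)) =
      ((∫ s in (0 : ℝ)..t, f i (lam i s * (1 - u ^ i)) : ℝ) : ℂ) := fun i hi => by
    rw [← intervalIntegral.integral_ofReal]
    refine intervalIntegral.integral_congr fun s hs => ?_
    rw [uIcc_of_le t.coe_nonneg] at hs
    -- This keeps the argument of `f i` nonnegative, the only range in which its integral
    -- representation is given.
    have h1 : u ^ i ≤ 1 := by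
      obtain ⟨k, rfl⟩ := Int.eq_ofNat_of_zero_le (hpos i hi).le
      exact_mod_cast (le_abs_self _).trans (by rw [abs_pow]; exact pow_le_one₀ (abs_nonneg u) hu)
    change _ = ((f i (lam i s * (1 - u ^ i)) : ℝ) : ℂ)
    rw [(hf i hi).eq_bernsteinFun (mul_nonneg (hlam_nonneg i hi s hs.1) (sub_nonneg.2 h1)),
      ← bernsteinC_ofReal]
    push_cast
    rfl
  rw [hl, Finset.sum_congr rfl hr] at h
  exact_mod_cast h

end Rates

theorem mainTheorem3 (I : Finset ℤ) (hI : (0 : ℤ) ∉ I)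
    (lam : ℤ → ℝ → ℝ)
    (hlam_nonneg : ∀ i ∈ I, ∀ t : ℝ, 0 ≤ t → 0 ≤ lam i t)
    (hlam_int : ∀ i ∈ I, LocallyIntegrableOn (lam i) (Ici (0 : ℝ)))
    (f : ℤ → ℝ → ℝ) (ν : ℤ → Measure ℝ)
    (hf : ∀ i ∈ I, IsBernstein (f i) 0 0 (ν i)) :
    -- the process exists
    (∃ (Ω : Type) (_ : MeasurableSpace Ω) (P : Measure Ω) (S : ℝ≥0 → Ω → ℤ),
      IsProbabilityMeasure P ∧ IsBernsteinSkellam I lam f ν P S) ∧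
    -- the problem has at most one solution
    (∀ p q : ℤ → ℝ → ℝ, IsSolution I lam ν p → IsSolution I lam ν q →
      ∀ (n : ℤ) (t : ℝ), 0 ≤ t → p n t = q n t) ∧
    -- the processes with independent increments whose law solves the problem are exactly
    -- those with the prescribed infinitesimal behaviour
    (∀ (Ω : Type v) [MeasurableSpace Ω] (P : Measure Ω) [IsProbabilityMeasure P]
        (S : ℝ≥0 → Ω → ℤ), IsAdditiveFromZero P S →
      (IsSolution I lam ν (lawOf P S) ↔ IsBernsteinSkellam I lam f ν P S) ∧
      ((∀ i ∈ I, ContinuousOn (lam i) (Ici (0 : ℝ))) →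
        (IsSolution I lam ν (lawOf P S) ↔
          (∀ n : ℤ, ContinuousOn (lawOf P S n) (Ici (0 : ℝ))) ∧
            ∀ t : ℝ≥0, HasInfinitesimalAt I lam f ν P S t))) ∧
    -- further properties of the process
    (∀ (Ω : Type v) [MeasurableSpace Ω] (P : Measure Ω) [IsProbabilityMeasure P]
        (S : ℝ≥0 → Ω → ℤ), IsBernsteinSkellam I lam f ν P S →
      -- state space
      (∀ t : ℝ≥0, ∀ᵐ ω ∂P, S t ω ∈ AddSubmonoid.closure (I : Set ℤ)) ∧
      -- the equation holds at every time at which the rates are continuous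
      (∀ t : ℝ, 0 ≤ t → (∀ i ∈ I, ContinuousWithinAt (lam i) (Ici 0) t) → ∀ n : ℤ,
        HasDerivWithinAt (lawOf P S n) (genRHS I lam ν t (fun k => lawOf P S k t) n) (Ici 0) t) ∧
      -- so does the infinitesimal behaviour, wherever the rates are right-continuous
      (∀ t : ℝ≥0, (∀ i ∈ I, ContinuousWithinAt (lam i) (Ici (t : ℝ)) t) →
        HasInfinitesimalAt I lam f ν P S t) ∧
      -- probability generating function, positive jumps, `u` in the neighbourhood `[-1, 1]` of `0`
      ((∀ i ∈ I, 0 < i) → ∀ (t : ℝ≥0) (u : ℝ), |u| ≤ 1 →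
        Integrable (fun ω => u ^ (S t ω)) P ∧
        ∫ ω, u ^ (S t ω) ∂P
          = Real.exp (-∑ i ∈ I, ∫ s in (0 : ℝ)..t, f i (lam i s * (1 - u ^ i)))) ∧
      -- probability generating function in general: wherever it converges
      (∀ (t : ℝ≥0) (u : ℂ), (u = 0 → ∀ i ∈ I, 0 < i) →
        (Integrable (fun ω => u ^ (S t ω)) P ↔
          ∀ i ∈ I, ∫⁻ s in Ioc (0 : ℝ) t, ∫⁻ w in Ioi (0 : ℝ),
            ‖1 - Real.exp (-(lam i s * (1 - ‖u‖ ^ i) * w))‖ₑ ∂(ν i) < ∞) ∧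
        (Integrable (fun ω => u ^ (S t ω)) P →
          ∫ ω, u ^ (S t ω) ∂P
            = Complex.exp (-∑ i ∈ I, ∫ s in (0 : ℝ)..t,
                bernsteinC (ν i) ((lam i s : ℂ) * (1 - u ^ i)))))) := by
  -- Any process in the class, not just the constructed one, has compound Poisson increments: it
  -- solves (1), and uniqueness applies. The remaining properties are read off from this.
  have hprocess : ∀ {Ω : Type v} [MeasurableSpace Ω] {P : Measure Ω} [IsProbabilityMeasure P]
      {S : ℝ≥0 → Ω → ℤ}, IsBernsteinSkellam I lam f ν P S →
      HasCompoundPoissonIncrements P S fun n t => jumpRate I lam ν t n := fun h =>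
    (h.isSolution hI hlam_nonneg hlam_int hf).hasCompoundPoissonIncrements hI hlam_nonneg
      hlam_int hf h.additive
  refine ⟨?_, fun p q hp hq n t ht => hp.unique hI hlam_nonneg hlam_int hf hq n ht,
    fun Ω _ P _ S hS => ⟨isSolution_iff_isBernsteinSkellam hI hlam_nonneg hlam_int hf hS,
      fun hc => isSolution_iff_of_continuousOn hI hlam_nonneg hlam_int hf hS hc⟩,
    fun Ω _ P _ S h => ⟨fun t => ?_, fun t ht hc n => ?_, fun t hc => ?_, fun hpos t u hu => ?_,
      fun t u hu => ⟨?_, fun hint => ?_⟩⟩⟩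
  · obtain ⟨Ω, _, P, S, hP, h, -⟩ := exists_isBernsteinSkellam hI hlam_nonneg hlam_int hf
    exact ⟨Ω, _, P, S, hP, h⟩
  · exact (hprocess h).ae_mem_closure hI hlam_nonneg hlam_int hf h.additive t
  · exact (h.isSolution hI hlam_nonneg hlam_int hf).hasDerivWithinAt_lawOf hI hlam_nonneg
      hlam_int hf ht hc n
  · exact (hprocess h).hasInfinitesimalAt hI hlam_nonneg hlam_int hf h.additive hc
  · exact ⟨(hprocess h).integrable_real_zpow hI hlam_nonneg hlam_int hf h.additive hpos t hu,
      (hprocess h).integral_real_zpow hI hlam_nonneg hlam_int hf h.additive hpos t hu⟩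
  · rw [(hprocess h).integrable_zpow_iff hI hlam_nonneg hlam_int hf h.additive hu t,
      integrable_zpow_jumpMeasure_iff hI hlam_nonneg hlam_int hf]
  · exact (hprocess h).integral_zpow hI hlam_nonneg hlam_int hf h.additive hu t hint
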